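/- **Notation.** For $\rho>0$ let $\mathbb T_\rho=\{|z|=\rho\}$, $\mathbb T=\mathbb T_1$, $D_\rho=\{|z|<\rho\}$, $D^\infty_\rho=\{z\in\hat{\mathbb C}:|z|>\rho\}$, and for $0<r<1<R$ let $A_{r,R}=\{r<|z|<R\}$. Write $M_\rho(f)=\int_0^{2\pi}|f(\rho e^{i\theta})|^2\frac{d\theta}{2\pi}$. The space $H^2(U)$, for $U=D_r$, $D^\infty_R$ or $A_{r,R}$, consists of the holomorphic functions on $U$ whose mean squares $M_\rho(f)$ over the circles $\mathbb T_\rho$ stay bounded as $\rho$ approaches the radii of the boundary circles of $U$; $H^2_0(D^\infty_R)$ is the subspace of functions in $H^2(D^\infty_R)$ vanishing at $\infty$. Such functions have boundary values in $L^2(\mathbb T_\rho)=L^2(\mathbb T_\rho,d\theta/2\pi)$ on each boundary circle, denoted by the same letter, and $\|f\|_{H^2(U)}^2$ is the sum of the squared $L^2$-norms of the boundary values. The direct sum $H^2(D_r)\oplus H^2_0(D^\infty_R)$ has the norm $(\|h_1\|^2+\|h_2\|^2)^{1/2}$. **Setting.** Let $\tau:\mathbb T\to\mathbb T$ be analytic,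 orientation preserving, with $|\tau'(z)|>1$ for all $z\in\mathbb T$; write $\tau$ also for its holomorphic extension to annuli around $\mathbb T$. Let $\mathcal A$ be the family of annuli $A_{r,R}$, $0<r<1<R$, on which $\tau$ and $1/\tau$ are holomorphic. Let $A=A_{r,R}\in\mathcal A$ be such that there are $A_0,A'\in\mathcal A$ with $\overline{A_0}\subset A'$, $\overline{A'}\subset A$ and $\tau(\partial A_0)\cap\overline A=\emptyset$. Assume moreover that $\tau$ extends continuously to $\overline A$, with $\tau(\partial A)\cap\overline A=\emptyset$. **Proposition 4.5.** 1. There is $K>1$ such that every $z\in A$ has exactly $K$ preimages under $\tau$ in $A$, with $\tau'\ne0$ at each of them; hence $\tau$ has $K$ local inverses $\phi_1,\dots,\phi_K$ with values in $A$ near each point of $A$. The transfer operator $$(\mathcal Lf)(z)=\sum_{k=1}^K\phi_k'(z)\,f(\phi_k(z))=\sum_{w\in A,\ \tau(w)=z}\frac{f(w)}{\tau'(w)}\qquad(z\in A)$$ is a well-defined bounded operator $\mathcal L:H^2(A)\to H^2(A)$. 2. The formula $$J(h_1,h_2)(f)=\frac1{2\pi i}\int_{\mathbb T_r}f(z)h_1(z)\,dz+\frac1{2\pi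 i}\int_{\mathbb T_R}f(z)h_2(z)\,dz\qquad(f\in H^2(A))$$ defines an isomorphism of topological vector spaces $J:H^2(D_r)\oplus H^2_0(D^\infty_R)\to H^2(A)^*$ onto the strong dual of $H^2(A)$. 3. The formulas $(C^{(r)}h)(z)=h(\tau(z))$, $z\in\mathbb T_r$, and $(C^{(R)}h)(z)=h(\tau(z))$, $z\in\mathbb T_R$, define bounded operators $C^{(r)}:H^2(D_r)\to L^2(\mathbb T_r)$ and $C^{(R)}:H^2_0(D^\infty_R)\to L^2(\mathbb T_R)$. 4. For $\rho\in\{r,R\}$ and $g(z)=\sum_{n\in\mathbb Z}g_nz^n$ in $L^2(\mathbb T_\rho)$ put $\Pi^{(\rho)}_+g=\sum_{n\ge0}g_nz^n\in H^2(D_\rho)$ and $\Pi^{(\rho)}_-g=\sum_{n\ge1}g_{-n}z^{-n}\in H^2_0(D^\infty_\rho)$. Let $\mathcal L^*:H^2(A)^*\to H^2(A)^*$, $(\mathcal L^*l)(f)=l(\mathcal Lf)$, be the Banach space adjoint of $\mathcal L$. Then $$J^{-1}\mathcal L^*J=\mathcal L'=\begin{pmatrix}\Pi^{(r)}_+C^{(r)}&\Pi^{(R)}_+C^{(R)}\\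 \Pi^{(r)}_-C^{(r)}&\Pi^{(R)}_-C^{(R)}\end{pmatrix}$$ as operators on $H^2(D_r)\oplus H^2_0(D^\infty_R)$, where the values of $\Pi^{(R)}_+C^{(R)}$ are restricted to $D_r\subset D_R$ and those of $\Pi^{(r)}_-C^{(r)}$ to $D^\infty_R\subset D^\infty_r$. -/

import Mathlib

open Real Complex Set Filter Topology MeasureTheory AddCircle

noncomputable section

namespace ExpandingCircle

/-! ### Circles and the space `L²(𝕋_ρ, dθ/2π)` -/

instance fact_two_pi_pos : Fact (0 < 2 * π) := ⟨Real.two_pi_pos⟩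

/-- The point `ρ e^{iθ}`, for an angle `θ` modulo `2π`. -/
def circlePt (ρ : ℝ) (θ : AddCircle (2 * π)) : ℂ := (ρ : ℂ) * (toCircle θ : ℂ)

/-- The Hilbert space `L²(𝕋_ρ, dθ/2π)`; functions on `𝕋_ρ` are written as functions of the angle
`θ` modulo `2π`, and `haarAddCircle` is the normalised measure `dθ/2π`. -/
abbrev L2Circle : Type := Lp ℂ 2 (haarAddCircle : Measure (AddCircle (2 * π)))

/-- The mean square `M_ρ(f) = ∫ |f(ρ e^{iθ})|² dθ/2π`. -/
def meanSq (ρ : ℝ) (f : ℂ → ℂ) : ℝ :=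
  ∫ θ : AddCircle (2 * π), ‖f (circlePt ρ θ)‖ ^ 2 ∂haarAddCircle

open Classical in
/-- The restriction of `f` to `𝕋_ρ` as an element of `L²(𝕋_ρ)` (zero if it is not
square integrable, which does not happen for `f` continuous on `𝕋_ρ`). -/
def slice (f : ℂ → ℂ) (ρ : ℝ) : L2Circle :=
  if h : MemLp (fun θ => f (circlePt ρ θ)) 2 haarAddCircle then h.toLp else 0

/-- The boundary values on `𝕋_ρ` of a function `f` in a Hardy space on a domain which has `𝕋_ρ` as
an outer boundary circle: the limit in `L²` of `θ ↦ f(s e^{iθ})` as `s ↗ ρ`. -/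
def bdryFromInside (ρ : ℝ) (f : ℂ → ℂ) : L2Circle := limUnder (𝓝[<] ρ) (slice f)

/-- The boundary values on `𝕋_ρ` of a function `f` in a Hardy space on a domain which has `𝕋_ρ` as
an inner boundary circle: the limit in `L²` of `θ ↦ f(s e^{iθ})` as `s ↘ ρ`. -/
def bdryFromOutside (ρ : ℝ) (f : ℂ → ℂ) : L2Circle := limUnder (𝓝[>] ρ) (slice f)

lemma continuous_circlePt (ρ : ℝ) : Continuous (circlePt ρ) :=
  continuous_const.mul (continuous_subtype_val.comp continuous_toCircle)

lemma norm_circlePt {ρ : ℝ} (hρ : 0 ≤ ρ) (θ : AddCircle (2 * π)) : ‖circlePt ρ θ‖ = ρ := by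
  rw [circlePt, norm_mul, Circle.norm_coe, mul_one, Complex.norm_real, Real.norm_of_nonneg hρ]

lemma continuous_comp_circlePt {f : ℂ → ℂ} {U : Set ℂ} (hf : ContinuousOn f U) {ρ : ℝ}
    (hU : ∀ θ, circlePt ρ θ ∈ U) : Continuous fun θ => f (circlePt ρ θ) :=
  hf.comp_continuous (continuous_circlePt ρ) hU

lemma memLp_of_continuous {g : AddCircle (2 * π) → ℂ} (hg : Continuous g) :
    MemLp g 2 haarAddCircle := by
  obtain ⟨C, hC⟩ := isCompact_univ.exists_bound_of_continuousOn hg.continuousOn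
  exact MemLp.of_bound hg.aestronglyMeasurable C (ae_of_all _ fun θ => hC θ (mem_univ _))

lemma slice_eq {f : ℂ → ℂ} {ρ : ℝ} (h : Continuous fun θ => f (circlePt ρ θ)) :
    slice f ρ = (memLp_of_continuous h).toLp := by
  rw [slice, dif_pos (memLp_of_continuous h)]

lemma meanSq_eq {f : ℂ → ℂ} {ρ : ℝ} (h : Continuous fun θ => f (circlePt ρ θ)) :
    meanSq ρ f = ‖slice f ρ‖ ^ 2 := by
  rw [← inner_self_eq_norm_sq (𝕜 := ℂ), L2.inner_def, slice_eq h, meanSq,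
    ← integral_re (L2.integrable_inner _ _)]
  refine integral_congr_ae ?_
  filter_upwards [(memLp_of_continuous h).coeFn_toLp] with θ hθ
  rw [hθ, inner_self_eq_norm_sq (𝕜 := ℂ)]

/-- The open annulus `{a < |z| < b}`. -/
def annulusSet (a b : ℝ) : Set ℂ := {z | a < ‖z‖ ∧ ‖z‖ < b}

lemma isOpen_annulusSet (a b : ℝ) : IsOpen (annulusSet a b) :=
  (isOpen_lt continuous_const continuous_norm).inter (isOpen_lt continuous_norm continuous_const)

lemma circlePt_mem_annulusSet {a b ρ : ℝ} (ha : 0 ≤ a) (hρ : ρ ∈ Ioo a b) (θ) :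
    circlePt ρ θ ∈ annulusSet a b := by
  have := norm_circlePt (ha.trans hρ.1.le) θ
  exact ⟨by rw [this]; exact hρ.1, by rw [this]; exact hρ.2⟩

lemma repr_slice {f : ℂ → ℂ} {ρ : ℝ} (hρ : 0 < ρ) (h : Continuous fun θ => f (circlePt ρ θ))
    (n : ℤ) : fourierBasis.repr (slice f ρ) n =
      ((2 * π * I)⁻¹ * ∮ z in C(0, ρ), f z * z ^ (-n - 1)) * (ρ : ℂ) ^ n := by
  have hρ' : (ρ : ℂ) ≠ 0 := by exact_mod_cast hρ.ne'
  rw [fourierBasis_repr, slice_eq h, fourierCoeff_congr_ae (memLp_of_continuous h).coeFn_toLp,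
    fourierCoeff_eq_intervalIntegral _ _ 0, circleIntegral, zero_add]
  have hpi : (π : ℂ) ≠ 0 := by exact_mod_cast Real.pi_ne_zero
  have key : ∀ θ : ℝ, deriv (circleMap 0 ρ) θ • (f (circleMap 0 ρ θ) * circleMap 0 ρ θ ^ (-n - 1))
      = (I * (ρ : ℂ) ^ (-n)) * ((fourier (-n) (θ : AddCircle (2 * π)) : ℂ) •
        f (circlePt ρ (θ : AddCircle (2 * π)))) := by
    intro θ
    have hne : circleMap 0 ρ θ ≠ 0 := circleMap_ne_center hρ.ne'
    have h1 : circlePt ρ (θ : AddCircle (2 * π)) = circleMap 0 ρ θ := by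
      rw [circlePt, toCircle_apply_mk, Circle.coe_exp, circleMap, zero_add]
      congr 3
      rw [div_self Real.two_pi_pos.ne', one_mul]
    have h2 : (ρ : ℂ) ^ (-n) * (fourier (-n) (θ : AddCircle (2 * π)) : ℂ)
        = circleMap 0 ρ θ ^ (-n) := by
      rw [← h1, circlePt, mul_zpow, fourier_apply, toCircle_zsmul, Circle.coe_zpow]
    rw [deriv_circleMap, h1, smul_eq_mul, smul_eq_mul, zpow_sub_one₀ hne, ← h2]
    field_simp
  simp_rw [key]
  rw [intervalIntegral.integral_const_mul, Complex.real_smul]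
  have : (ρ : ℂ) ^ (-n) * (ρ : ℂ) ^ n = 1 := by
    rw [← zpow_add₀ hρ']; simp
  push_cast
  generalize (∫ x : ℝ in (0)..(2 * π), (fourier (-n) (x : AddCircle (2 * π)) : ℂ) •
        f (circlePt ρ (x : AddCircle (2 * π)))) = W
  have hI : I ≠ 0 := I_ne_zero
  calc 1 / (2 * (π : ℂ)) * W = (2 * (π : ℂ))⁻¹ * W * ((ρ : ℂ) ^ (-n) * (ρ : ℂ) ^ n) := by
        rw [this]; ring
    _ = _ := by field_simp

/-- Laurent coefficients: the Fourier coefficients on `𝕋_ρ` of a function holomorphic in an annulus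
are `c_n ρ^n` with `c_n` independent of `ρ`. -/
lemma exists_laurent {f : ℂ → ℂ} {a b : ℝ} (ha : 0 ≤ a)
    (hf : DifferentiableOn ℂ f (annulusSet a b)) :
    ∃ c : ℤ → ℂ, ∀ ρ ∈ Ioo a b, ∀ n, fourierBasis.repr (slice f ρ) n = c n * (ρ : ℂ) ^ n := by
  rcases (Ioo a b).eq_empty_or_nonempty with h | ⟨ρ₀, h₀⟩
  · exact ⟨0, by simp [h]⟩
  refine ⟨fun n => (2 * π * I)⁻¹ * ∮ z in C(0, ρ₀), f z * z ^ (-n - 1), fun ρ hρ n => ?_⟩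
  have main : ∀ s ∈ Ioo a b, ∀ t ∈ Ioo a b, s ≤ t →
      (∮ z in C(0, t), f z * z ^ (-n - 1)) = ∮ z in C(0, s), f z * z ^ (-n - 1) := by
    intro s hs t ht hst
    have hs0 : 0 < s := ha.trans_lt hs.1
    have hd : DifferentiableOn ℂ (fun z => f z * z ^ (-n - 1)) (annulusSet a b) := by
      refine hf.mul fun z hz => ?_
      exact (differentiableAt_zpow.2 (Or.inl (norm_pos_iff.1 (ha.trans_lt hz.1)))).differentiableWithinAt
    have hsub : Metric.closedBall (0 : ℂ) t \ Metric.ball 0 s ⊆ annulusSet a b := by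
      intro z hz
      simp only [Set.mem_sdiff, Metric.mem_closedBall, dist_zero_right, Metric.mem_ball, not_lt] at hz
      exact ⟨hs.1.trans_le hz.2, hz.1.trans_lt ht.2⟩
    refine circleIntegral_eq_of_differentiable_on_annulus_off_countable hs0 hst
      countable_empty (hd.continuousOn.mono hsub) fun z hz => ?_
    refine (hd z (hsub ?_)).differentiableAt ((isOpen_annulusSet a b).mem_nhds (hsub ?_)) <;>
    · exact ⟨Metric.ball_subset_closedBall hz.1.1,
        fun h => hz.1.2 (Metric.ball_subset_closedBall h)⟩
  rw [repr_slice (ha.trans_lt hρ.1) (continuous_comp_circlePt hf.continuousOn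
    (circlePt_mem_annulusSet ha hρ))]
  congr 2
  rcases le_total ρ ρ₀ with h | h
  · exact (main ρ hρ ρ₀ h₀ h).symm
  · exact main ρ₀ h₀ ρ hρ h

lemma norm_sq_eq_tsum (x : L2Circle) : ‖x‖ ^ 2 = ∑' n, ‖fourierBasis.repr x n‖ ^ 2 := by
  rw [← fourierBasis.repr.norm_map]
  have := lp.norm_rpow_eq_tsum (p := 2) (by simp) (fourierBasis.repr x)
  simpa using this

lemma summable_repr_sq (x : L2Circle) : Summable fun n => ‖fourierBasis.repr x n‖ ^ 2 := by
  have := (lp.memℓp (fourierBasis.repr x)).summable (by simp)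
  simpa using this

/-- Existence of the boundary values in the mean-square sense. -/
lemma exists_bdry {f : ℂ → ℂ} {a b C e : ℝ} (ha : 0 ≤ a) (hab : a < b)
    (hf : DifferentiableOn ℂ f (annulusSet a b)) (hC : ∀ ρ ∈ Ioo a b, meanSq ρ f ≤ C)
    (he : 0 < e) (heab : e = a ∨ e = b) :
    ∃ g : L2Circle, Tendsto (slice f) (𝓝[Ioo a b] e) (𝓝 g) := by
  obtain ⟨c, hc⟩ := exists_laurent ha hf
  have hne : (𝓝[Ioo a b] e).NeBot := by
    rw [← mem_closure_iff_nhdsWithin_neBot, closure_Ioo hab.ne]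
    rcases heab with rfl | rfl
    · exact left_mem_Icc.2 hab.le
    · exact right_mem_Icc.2 hab.le
  have hnorm : ∀ ρ ∈ Ioo a b, Summable (fun n : ℤ => ‖c n * (ρ : ℂ) ^ n‖ ^ 2) ∧
      ∑' n : ℤ, ‖c n * (ρ : ℂ) ^ n‖ ^ 2 ≤ C := by
    intro ρ hρ
    have h1 := summable_repr_sq (slice f ρ)
    have h2 := norm_sq_eq_tsum (slice f ρ)
    simp_rw [hc ρ hρ] at h1 h2
    refine ⟨h1, ?_⟩
    rw [← h2, ← meanSq_eq (continuous_comp_circlePt hf.continuousOn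
      (circlePt_mem_annulusSet ha hρ))]
    exact hC ρ hρ
  have hcont : ∀ n : ℤ, Tendsto (fun ρ : ℝ => c n * (ρ : ℂ) ^ n) (𝓝[Ioo a b] e)
      (𝓝 (c n * (e : ℂ) ^ n)) := by
    intro n
    have : ContinuousAt (fun ρ : ℝ => c n * (ρ : ℂ) ^ n) e :=
      continuousAt_const.mul ((continuousAt_zpow₀ (e : ℂ) n (Or.inl (by exact_mod_cast he.ne'))).comp
        Complex.continuous_ofReal.continuousAt)
    exact this.tendsto.mono_left nhdsWithin_le_nhds
  have hse : Summable (fun n : ℤ => ‖c n * (e : ℂ) ^ n‖ ^ 2) := by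
    refine summable_of_sum_le (c := C) (fun n => by positivity) fun s => ?_
    refine le_of_tendsto (tendsto_finsetSum s fun n _ => ((hcont n).norm.pow 2)) ?_
    filter_upwards [self_mem_nhdsWithin] with ρ hρ
    exact ((hnorm ρ hρ).1.sum_le_tsum s fun n _ => by positivity).trans (hnorm ρ hρ).2
  have hmem : Memℓp (fun n : ℤ => c n * (e : ℂ) ^ n) 2 := by
    refine memℓp_gen ?_
    simpa using hse
  refine ⟨fourierBasis.repr.symm ⟨_, hmem⟩, ?_⟩
  obtain ⟨ρ₁, h₁⟩ : (Ioo a b).Nonempty := nonempty_Ioo.2 hab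
  rw [tendsto_iff_norm_sub_tendsto_zero]
  suffices H : Tendsto (fun ρ => ‖slice f ρ - fourierBasis.repr.symm ⟨_, hmem⟩‖ ^ 2)
      (𝓝[Ioo a b] e) (𝓝 0) by
    have := H.sqrt
    simpa [Real.sqrt_sq (norm_nonneg _)] using this
  have hEq : ∀ᶠ ρ : ℝ in 𝓝[Ioo a b] e,
      ∑' n : ℤ, ‖c n * (ρ : ℂ) ^ n - c n * (e : ℂ) ^ n‖ ^ 2 =
        ‖slice f ρ - fourierBasis.repr.symm ⟨_, hmem⟩‖ ^ 2 := by
    filter_upwards [self_mem_nhdsWithin] with ρ hρ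
    rw [norm_sq_eq_tsum]
    refine tsum_congr fun n => ?_
    rw [map_sub, LinearIsometryEquiv.apply_symm_apply, lp.coeFn_sub, Pi.sub_apply, hc ρ hρ]
  refine Tendsto.congr' hEq ?_
  have hz : (0 : ℝ) = ∑' n : ℤ, (0 : ℝ) := by simp
  rw [hz]
  refine tendsto_tsum_of_dominated_convergence
    (bound := fun n : ℤ => 8 * ‖c n * (ρ₁ : ℂ) ^ n‖ ^ 2 + 8 * ‖c n * (e : ℂ) ^ n‖ ^ 2)
    (((hnorm ρ₁ h₁).1.mul_left 8).add (hse.mul_left 8)) (fun n => ?_) ?_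
  · have := ((hcont n).sub_const (c n * (e : ℂ) ^ n)).norm.pow 2
    simpa using this
  · have hnear : ∀ᶠ ρ : ℝ in 𝓝[Ioo a b] e, ρ₁ ≤ ρ ∧ ρ ≤ e ∨ e ≤ ρ ∧ ρ ≤ ρ₁ := by
      rcases heab with rfl | rfl
      · filter_upwards [self_mem_nhdsWithin, mem_nhdsWithin_of_mem_nhds (Iio_mem_nhds h₁.1)]
          with ρ hρ h2
        exact Or.inr ⟨hρ.1.le, (mem_Iio.1 h2).le⟩
      · filter_upwards [self_mem_nhdsWithin, mem_nhdsWithin_of_mem_nhds (Ioi_mem_nhds h₁.2)]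
          with ρ hρ h2
        exact Or.inl ⟨(mem_Ioi.1 h2).le, hρ.2.le⟩
    have h₁0 : 0 < ρ₁ := ha.trans_lt h₁.1
    have hpow : ∀ x y t : ℝ, 0 < x → x ≤ t → t ≤ y → ∀ n : ℤ, t ^ n ≤ x ^ n + y ^ n := by
      intro x y t hx hxt hty n
      have ht : 0 < t := hx.trans_le hxt
      have hy : 0 < y := ht.trans_le hty
      rcases le_total 0 n with hn | hn
      · have := zpow_le_zpow_left₀ hn ht.le hty
        have := zpow_nonneg hx.le n
        linarith
      · have h3 := zpow_le_zpow_left₀ (neg_nonneg.2 hn) hx.le hxt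
        rw [zpow_neg, zpow_neg, inv_le_inv₀ (zpow_pos hx n) (zpow_pos ht n)] at h3
        have := zpow_nonneg hy.le n
        linarith
    filter_upwards [self_mem_nhdsWithin, hnear] with ρ hρ hρ2 n
    have hρ0 : 0 < ρ := ha.trans_lt hρ.1
    have hle : ρ ^ n ≤ ρ₁ ^ n + e ^ n := by
      rcases hρ2 with h | h
      · exact hpow _ _ _ h₁0 h.1 h.2 n
      · rw [add_comm]; exact hpow _ _ _ he h.1 h.2 n
    have e1 : ∀ t : ℝ, 0 < t → ‖c n * (t : ℂ) ^ n‖ = ‖c n‖ * t ^ n := by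
      intro t ht
      rw [norm_mul, norm_zpow, Complex.norm_real, Real.norm_of_nonneg ht.le]
    have h5 : ‖c n * (ρ : ℂ) ^ n - c n * (e : ℂ) ^ n‖ ≤ ‖c n‖ * ρ₁ ^ n + 2 * (‖c n‖ * e ^ n) := by
      refine (norm_sub_le _ _).trans ?_
      rw [e1 ρ hρ0, e1 e he]
      have := mul_le_mul_of_nonneg_left hle (norm_nonneg (c n))
      linarith
    rw [Real.norm_of_nonneg (by positivity), e1 ρ₁ h₁0, e1 e he]
    have h6 := pow_le_pow_left₀ (norm_nonneg _) h5 2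
    nlinarith [sq_nonneg (‖c n‖ * ρ₁ ^ n - 2 * (‖c n‖ * e ^ n)), sq_nonneg (‖c n‖ * ρ₁ ^ n)]

/-- A function with vanishing boundary values on one boundary circle vanishes near it. -/
lemma eq_zero_of_bdry {f : ℂ → ℂ} {a b e : ℝ} (ha : 0 ≤ a) (hab : a < b)
    (hf : DifferentiableOn ℂ f (annulusSet a b)) (he : 0 < e) (heab : e = a ∨ e = b)
    (h : Tendsto (slice f) (𝓝[Ioo a b] e) (𝓝 0)) : ∀ z ∈ annulusSet a b, f z = 0 := by
  obtain ⟨c, hc⟩ := exists_laurent ha hf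
  have hne : (𝓝[Ioo a b] e).NeBot := by
    rw [← mem_closure_iff_nhdsWithin_neBot, closure_Ioo hab.ne]
    rcases heab with rfl | rfl
    · exact left_mem_Icc.2 hab.le
    · exact right_mem_Icc.2 hab.le
  have hc0 : ∀ n, c n = 0 := by
    intro n
    have he' : (e : ℂ) ≠ 0 := by exact_mod_cast he.ne'
    have h1 : Tendsto (fun ρ : ℝ => c n * (ρ : ℂ) ^ n) (𝓝[Ioo a b] e) (𝓝 (c n * (e : ℂ) ^ n)) := by
      have : ContinuousAt (fun ρ : ℝ => c n * (ρ : ℂ) ^ n) e :=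
        continuousAt_const.mul ((continuousAt_zpow₀ (e : ℂ) n (Or.inl he')).comp
          Complex.continuous_ofReal.continuousAt)
      exact this.tendsto.mono_left nhdsWithin_le_nhds
    have h2 : Tendsto (fun ρ : ℝ => c n * (ρ : ℂ) ^ n) (𝓝[Ioo a b] e) (𝓝 0) := by
      rw [tendsto_zero_iff_norm_tendsto_zero]
      refine squeeze_zero' (Eventually.of_forall fun _ => norm_nonneg _) ?_
        (tendsto_zero_iff_norm_tendsto_zero.1 h)
      filter_upwards [self_mem_nhdsWithin] with ρ hρ
      rw [← hc ρ hρ, ← fourierBasis.repr.norm_map (slice f ρ)]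
      exact lp.norm_apply_le_norm (by simp) _ n
    have h3 := tendsto_nhds_unique h1 h2
    exact (mul_eq_zero.1 h3).resolve_right (zpow_ne_zero n he')
  intro z hz
  have hcont := continuous_comp_circlePt hf.continuousOn
    (circlePt_mem_annulusSet (ρ := ‖z‖) ha hz)
  have h0 : slice f ‖z‖ = 0 := by
    apply fourierBasis.repr.injective
    ext n
    rw [hc _ hz, hc0 n, map_zero]; simp
  rw [slice_eq hcont] at h0
  have h1 : (fun θ => f (circlePt ‖z‖ θ)) =ᵐ[haarAddCircle] fun _ => (0 : ℂ) :=
    (memLp_of_continuous hcont).coeFn_toLp.symm.trans (by rw [h0]; exact Lp.coeFn_zero _ _ _)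
  have h2 := (Continuous.ae_eq_iff_eq haarAddCircle hcont continuous_const).1 h1
  have h3 := congrFun h2 ((Complex.arg z : ℝ) : AddCircle (2 * π))
  have h4 : circlePt ‖z‖ ((Complex.arg z : ℝ) : AddCircle (2 * π)) = z := by
    rw [circlePt, toCircle_apply_mk, Circle.coe_exp, div_self Real.two_pi_pos.ne', one_mul,
      Complex.norm_mul_exp_arg_mul_I]
  simpa [h4] using h3

lemma slice_add {f g : ℂ → ℂ} {ρ : ℝ} (hf : Continuous fun θ => f (circlePt ρ θ))
    (hg : Continuous fun θ => g (circlePt ρ θ)) :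
    slice (f + g) ρ = slice f ρ + slice g ρ := by
  rw [slice_eq hf, slice_eq hg, slice_eq (f := f + g) (hf.add hg)]
  exact MemLp.toLp_add (memLp_of_continuous hf) (memLp_of_continuous hg)

lemma slice_smul {f : ℂ → ℂ} {ρ : ℝ} (c : ℂ) (hf : Continuous fun θ => f (circlePt ρ θ)) :
    slice (c • f) ρ = c • slice f ρ := by
  rw [slice_eq hf, slice_eq (f := c • f) (hf.const_smul c)]
  exact MemLp.toLp_const_smul c (memLp_of_continuous hf)

/-! ### Hardy-Hilbert spaces -/

/-- The functions `f` which are holomorphic on `U` and whose mean squares `M_ρ(f)` over the circles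
`𝕋_ρ ⊆ U` are bounded. Such a function is represented by its extension by zero outside `U`. -/
def hardySpace (U : Set ℂ) : Submodule ℂ (ℂ → ℂ) where
  carrier := {f | DifferentiableOn ℂ f U ∧ (∀ z, z ∉ U → f z = 0) ∧
    ∃ C : ℝ, ∀ ρ : ℝ, 0 < ρ → Metric.sphere 0 ρ ⊆ U → meanSq ρ f ≤ C}
  zero_mem' := ⟨differentiableOn_const 0, fun _ _ => rfl, 0, fun ρ _ _ => by simp [meanSq]⟩
  add_mem' := by
    rintro f g ⟨hf, hf0, C, hC⟩ ⟨hg, hg0, D, hD⟩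
    refine ⟨hf.add hg, fun z hz => by simp [hf0 z hz, hg0 z hz], 2 * C + 2 * D,
      fun ρ hρ hU => ?_⟩
    have hm : ∀ θ, circlePt ρ θ ∈ U := fun θ => hU (by simp [norm_circlePt hρ.le])
    have cf := continuous_comp_circlePt hf.continuousOn hm
    have cg := continuous_comp_circlePt hg.continuousOn hm
    have h1 := hC ρ hρ hU
    have h2 := hD ρ hρ hU
    have h3 : slice (f + g) ρ = slice f ρ + slice g ρ := slice_add cf cg
    rw [meanSq_eq cf] at h1
    rw [meanSq_eq cg] at h2
    rw [meanSq_eq (f := f + g) (cf.add cg), h3]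
    have h4 := norm_add_le (slice f ρ) (slice g ρ)
    have h5 := pow_le_pow_left₀ (norm_nonneg _) h4 2
    nlinarith [sq_nonneg (‖slice f ρ‖ - ‖slice g ρ‖)]
  smul_mem' := by
    rintro c f ⟨hf, hf0, C, hC⟩
    refine ⟨hf.const_smul c, fun z hz => by simp [hf0 z hz], ‖c‖ ^ 2 * C, fun ρ hρ hU => ?_⟩
    have h1 := hC ρ hρ hU
    have : meanSq ρ (c • f) = ‖c‖ ^ 2 * meanSq ρ f := by
      simp only [meanSq, Pi.smul_apply, norm_smul, mul_pow]
      exact integral_const_mul _ _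
    rw [this]
    exact mul_le_mul_of_nonneg_left h1 (by positivity)

/-- The exterior disk `{|z| > R}` (without the point at infinity). -/
def exteriorSet (R : ℝ) : Set ℂ := {z | R < ‖z‖}

/-- The functions vanishing at infinity. -/
def vanishingAtInfinity : Submodule ℂ (ℂ → ℂ) where
  carrier := {f | Tendsto f (Bornology.cobounded ℂ) (𝓝 0)}
  zero_mem' := tendsto_const_nhds
  add_mem' := fun {f g} hf hg => by
    have := Tendsto.add hf hg
    rwa [add_zero] at this
  smul_mem' := fun c f hf => by
    have := Tendsto.const_smul hf c
    rwa [smul_zero] at this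

/-- Two radii `0 < r < 1 < R`. -/
structure AnnulusRadii where
  r : ℝ
  R : ℝ
  r_pos : 0 < r
  r_lt_one : r < 1
  one_lt_R : 1 < R

/-- The annulus `A_{r,R}`. -/
def AnnulusRadii.toSet (A : AnnulusRadii) : Set ℂ := annulusSet A.r A.R

lemma AnnulusRadii.r_lt_R (A : AnnulusRadii) : A.r < A.R := A.r_lt_one.trans A.one_lt_R

instance AnnulusRadii.fact_r (A : AnnulusRadii) : Fact (0 < A.r) := ⟨A.r_pos⟩

instance AnnulusRadii.fact_R (A : AnnulusRadii) : Fact (0 < A.R) :=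
  ⟨one_pos.trans A.one_lt_R⟩

/-- The Hardy-Hilbert space `H²(D_r)`. -/
def HardyDisk (r : ℝ) : Type := hardySpace (Metric.ball 0 r)

/-- The Hardy-Hilbert space `H²₀(D^∞_R)`. A function on `{|z| > R}` which is holomorphic and tends
to `0` at infinity is the same as a function which is holomorphic on `D^∞_R` and vanishes at the
point `∞`. -/
def HardyExterior (R : ℝ) : Type := ↥(hardySpace (exteriorSet R) ⊓ vanishingAtInfinity)

/-- The Hardy-Hilbert space `H²(A_{r,R})`. -/
def HardyAnnulus (A : AnnulusRadii) : Type := hardySpace A.toSet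

instance (r : ℝ) : AddCommGroup (HardyDisk r) :=
  inferInstanceAs (AddCommGroup (hardySpace (Metric.ball 0 r)))

instance (r : ℝ) : Module ℂ (HardyDisk r) :=
  inferInstanceAs (Module ℂ (hardySpace (Metric.ball 0 r)))

instance (R : ℝ) : AddCommGroup (HardyExterior R) :=
  inferInstanceAs (AddCommGroup ↥(hardySpace (exteriorSet R) ⊓ vanishingAtInfinity))

instance (R : ℝ) : Module ℂ (HardyExterior R) :=
  inferInstanceAs (Module ℂ ↥(hardySpace (exteriorSet R) ⊓ vanishingAtInfinity))

instance (A : AnnulusRadii) : AddCommGroup (HardyAnnulus A) :=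
  inferInstanceAs (AddCommGroup (hardySpace A.toSet))

instance (A : AnnulusRadii) : Module ℂ (HardyAnnulus A) :=
  inferInstanceAs (Module ℂ (hardySpace A.toSet))

/-- The underlying function. -/
def HardyDisk.toFun {r : ℝ} (f : HardyDisk r) : ℂ → ℂ := f.1

/-- The underlying function. -/
def HardyExterior.toFun {R : ℝ} (f : HardyExterior R) : ℂ → ℂ := f.1

/-- The underlying function. -/
def HardyAnnulus.toFun {A : AnnulusRadii} (f : HardyAnnulus A) : ℂ → ℂ := f.1

instance (r : ℝ) : CoeFun (HardyDisk r) (fun _ => ℂ → ℂ) := ⟨HardyDisk.toFun⟩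

instance (R : ℝ) : CoeFun (HardyExterior R) (fun _ => ℂ → ℂ) := ⟨HardyExterior.toFun⟩

instance (A : AnnulusRadii) : CoeFun (HardyAnnulus A) (fun _ => ℂ → ℂ) := ⟨HardyAnnulus.toFun⟩

lemma sphere_subset_of_Ioo {a b ρ : ℝ} (hρ : ρ ∈ Ioo a b) :
    Metric.sphere (0 : ℂ) ρ ⊆ annulusSet a b := by
  intro z hz
  rw [mem_sphere_zero_iff_norm] at hz
  exact ⟨by rw [hz]; exact hρ.1, by rw [hz]; exact hρ.2⟩

/-- What is needed of an element of a Hardy space on an annulus inside its domain. -/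
lemma hardy_exists_bdry {f : ℂ → ℂ} {U : Set ℂ} (hf : f ∈ hardySpace U) {a b e : ℝ} (ha : 0 ≤ a)
    (hab : a < b) (hU : annulusSet a b ⊆ U) (he : 0 < e) (heab : e = a ∨ e = b) :
    ∃ g, Tendsto (slice f) (𝓝[Ioo a b] e) (𝓝 g) := by
  obtain ⟨h1, -, C, hC⟩ := hf
  exact exists_bdry ha hab (h1.mono hU)
    (fun ρ hρ => hC ρ (ha.trans_lt hρ.1) ((sphere_subset_of_Ioo hρ).trans hU)) he heab

lemma tendsto_bdryFromInside {f : ℂ → ℂ} {U : Set ℂ} (hf : f ∈ hardySpace U) {a b : ℝ} (ha : 0 ≤ a)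
    (hab : a < b) (hU : annulusSet a b ⊆ U) :
    Tendsto (slice f) (𝓝[<] b) (𝓝 (bdryFromInside b f)) := by
  have h := hardy_exists_bdry hf ha hab hU (ha.trans_lt hab) (Or.inr rfl)
  rw [nhdsWithin_Ioo_eq_nhdsLT hab] at h
  exact tendsto_nhds_limUnder h

lemma tendsto_bdryFromOutside {f : ℂ → ℂ} {U : Set ℂ} (hf : f ∈ hardySpace U) {a b : ℝ} (ha : 0 < a)
    (hab : a < b) (hU : annulusSet a b ⊆ U) :
    Tendsto (slice f) (𝓝[>] a) (𝓝 (bdryFromOutside a f)) := by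
  have h := hardy_exists_bdry hf ha.le hab hU ha (Or.inl rfl)
  rw [nhdsWithin_Ioo_eq_nhdsGT hab] at h
  exact tendsto_nhds_limUnder h

lemma hardy_slice_cont {f : ℂ → ℂ} {U : Set ℂ} (hf : f ∈ hardySpace U) {a b ρ : ℝ} (ha : 0 ≤ a)
    (hU : annulusSet a b ⊆ U) (hρ : ρ ∈ Ioo a b) : Continuous fun θ => f (circlePt ρ θ) :=
  continuous_comp_circlePt hf.1.continuousOn fun θ => hU (circlePt_mem_annulusSet ha hρ θ)

lemma bdryFromInside_add {f g : ℂ → ℂ} {U : Set ℂ} (hf : f ∈ hardySpace U) (hg : g ∈ hardySpace U)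
    {a b : ℝ} (ha : 0 ≤ a) (hab : a < b) (hU : annulusSet a b ⊆ U) :
    bdryFromInside b (f + g) = bdryFromInside b f + bdryFromInside b g := by
  refine tendsto_nhds_unique (tendsto_bdryFromInside (add_mem hf hg) ha hab hU) ?_
  refine ((tendsto_bdryFromInside hf ha hab hU).add
    (tendsto_bdryFromInside hg ha hab hU)).congr' ?_
  rw [← nhdsWithin_Ioo_eq_nhdsLT hab]
  filter_upwards [self_mem_nhdsWithin] with ρ hρ
  exact (slice_add (hardy_slice_cont hf ha hU hρ) (hardy_slice_cont hg ha hU hρ)).symm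

lemma bdryFromOutside_add {f g : ℂ → ℂ} {U : Set ℂ} (hf : f ∈ hardySpace U) (hg : g ∈ hardySpace U)
    {a b : ℝ} (ha : 0 < a) (hab : a < b) (hU : annulusSet a b ⊆ U) :
    bdryFromOutside a (f + g) = bdryFromOutside a f + bdryFromOutside a g := by
  refine tendsto_nhds_unique (tendsto_bdryFromOutside (add_mem hf hg) ha hab hU) ?_
  refine ((tendsto_bdryFromOutside hf ha hab hU).add
    (tendsto_bdryFromOutside hg ha hab hU)).congr' ?_
  rw [← nhdsWithin_Ioo_eq_nhdsGT hab]
  filter_upwards [self_mem_nhdsWithin] with ρ hρ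
  exact (slice_add (hardy_slice_cont hf ha.le hU hρ) (hardy_slice_cont hg ha.le hU hρ)).symm

lemma bdryFromInside_smul {f : ℂ → ℂ} {U : Set ℂ} (c : ℂ) (hf : f ∈ hardySpace U)
    {a b : ℝ} (ha : 0 ≤ a) (hab : a < b) (hU : annulusSet a b ⊆ U) :
    bdryFromInside b (c • f) = c • bdryFromInside b f := by
  refine tendsto_nhds_unique
    (tendsto_bdryFromInside (Submodule.smul_mem _ c hf) ha hab hU) ?_
  refine ((tendsto_bdryFromInside hf ha hab hU).const_smul c).congr' ?_
  rw [← nhdsWithin_Ioo_eq_nhdsLT hab]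
  filter_upwards [self_mem_nhdsWithin] with ρ hρ
  exact (slice_smul c (hardy_slice_cont hf ha hU hρ)).symm

lemma bdryFromOutside_smul {f : ℂ → ℂ} {U : Set ℂ} (c : ℂ) (hf : f ∈ hardySpace U)
    {a b : ℝ} (ha : 0 < a) (hab : a < b) (hU : annulusSet a b ⊆ U) :
    bdryFromOutside a (c • f) = c • bdryFromOutside a f := by
  refine tendsto_nhds_unique
    (tendsto_bdryFromOutside (Submodule.smul_mem _ c hf) ha hab hU) ?_
  refine ((tendsto_bdryFromOutside hf ha hab hU).const_smul c).congr' ?_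
  rw [← nhdsWithin_Ioo_eq_nhdsGT hab]
  filter_upwards [self_mem_nhdsWithin] with ρ hρ
  exact (slice_smul c (hardy_slice_cont hf ha.le hU hρ)).symm

lemma annulusSet_subset_ball (r : ℝ) : annulusSet 0 r ⊆ Metric.ball 0 r :=
  fun z hz => by simpa using hz.2

lemma annulusSet_subset_exteriorSet (R : ℝ) : annulusSet R (R + 1) ⊆ exteriorSet R :=
  fun _ hz => hz.1

/-- Boundary values on `𝕋_r` of functions in `H²(D_r)`. -/
def HardyDisk.bdry (r : ℝ) [hr : Fact (0 < r)] : HardyDisk r →ₗ[ℂ] L2Circle where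
  toFun f := bdryFromInside r f
  map_add' f g := bdryFromInside_add f.2 g.2 le_rfl hr.out (annulusSet_subset_ball r)
  map_smul' c f := bdryFromInside_smul c f.2 le_rfl hr.out (annulusSet_subset_ball r)

/-- Boundary values on `𝕋_R` of functions in `H²₀(D^∞_R)`. -/
def HardyExterior.bdry (R : ℝ) [hR : Fact (0 < R)] : HardyExterior R →ₗ[ℂ] L2Circle where
  toFun f := bdryFromOutside R f
  map_add' f g := bdryFromOutside_add f.2.1 g.2.1 hR.out (lt_add_one R)
    (annulusSet_subset_exteriorSet R)
  map_smul' c f := bdryFromOutside_smul c f.2.1 hR.out (lt_add_one R)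
    (annulusSet_subset_exteriorSet R)

/-- Boundary values on the inner circle `𝕋_r` of functions in `H²(A_{r,R})`. -/
def HardyAnnulus.innerBdry (A : AnnulusRadii) : HardyAnnulus A →ₗ[ℂ] L2Circle where
  toFun f := bdryFromOutside A.r f
  map_add' f g := bdryFromOutside_add f.2 g.2 A.r_pos A.r_lt_R subset_rfl
  map_smul' c f := bdryFromOutside_smul c f.2 A.r_pos A.r_lt_R subset_rfl

/-- Boundary values on the outer circle `𝕋_R` of functions in `H²(A_{r,R})`. -/
def HardyAnnulus.outerBdry (A : AnnulusRadii) : HardyAnnulus A →ₗ[ℂ] L2Circle where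
  toFun f := bdryFromInside A.R f
  map_add' f g := bdryFromInside_add f.2 g.2 A.r_pos.le A.r_lt_R subset_rfl
  map_smul' c f := bdryFromInside_smul c f.2 A.r_pos.le A.r_lt_R subset_rfl

lemma HardyDisk.bdry_injective (r : ℝ) [hr : Fact (0 < r)] :
    Function.Injective (HardyDisk.bdry r) := by
  refine (injective_iff_map_eq_zero _).2 fun f hf => ?_
  have h1 := tendsto_bdryFromInside f.2 le_rfl hr.out (annulusSet_subset_ball r)
  have h2 : bdryFromInside r f.1 = 0 := hf
  rw [h2, ← nhdsWithin_Ioo_eq_nhdsLT hr.out] at h1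
  have h3 := eq_zero_of_bdry le_rfl hr.out (f.2.1.mono (annulusSet_subset_ball r)) hr.out
    (Or.inr rfl) h1
  have h4 : ∀ z ∈ Metric.ball (0 : ℂ) r, z ≠ 0 → f.1 z = 0 := fun z hz hz0 =>
    h3 z ⟨norm_pos_iff.2 hz0, by simpa using hz⟩
  refine Subtype.ext (funext fun z => ?_)
  change f.1 z = 0
  by_cases hz : z ∈ Metric.ball (0 : ℂ) r
  · rcases eq_or_ne z 0 with rfl | hz0
    · have hc : ContinuousAt f.1 0 :=
        (f.2.1 0 hz).continuousWithinAt.continuousAt (Metric.isOpen_ball.mem_nhds hz)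
      refine tendsto_nhds_unique (hc.tendsto.mono_left (nhdsWithin_le_nhds (s := {0}ᶜ))) ?_
      refine tendsto_const_nhds.congr' ?_
      filter_upwards [self_mem_nhdsWithin,
        mem_nhdsWithin_of_mem_nhds (Metric.isOpen_ball.mem_nhds hz)] with w hw hw2
      exact (h4 w hw2 hw).symm
    · exact h4 z hz hz0
  · exact f.2.2.1 z hz

lemma HardyExterior.bdry_injective (R : ℝ) [hR : Fact (0 < R)] :
    Function.Injective (HardyExterior.bdry R) := by
  refine (injective_iff_map_eq_zero _).2 fun f hf => ?_
  refine Subtype.ext (funext fun z => ?_)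
  change f.1 z = 0
  by_cases hz : z ∈ exteriorSet R
  · have hz' : R < ‖z‖ := hz
    have hsub : annulusSet R (‖z‖ + 1) ⊆ exteriorSet R := fun _ h => h.1
    have hlt : R < ‖z‖ + 1 := by linarith
    have h1 := tendsto_bdryFromOutside f.2.1 hR.out hlt hsub
    have h2 : bdryFromOutside R f.1 = 0 := hf
    rw [h2, ← nhdsWithin_Ioo_eq_nhdsGT hlt] at h1
    exact eq_zero_of_bdry hR.out.le hlt (f.2.1.1.mono hsub) hR.out (Or.inl rfl) h1 z
      ⟨hz', by linarith⟩
  · exact f.2.1.2.1 z hz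

/-- The pair of boundary values of a function in `H²(A_{r,R})`. -/
def HardyAnnulus.bdry (A : AnnulusRadii) : HardyAnnulus A →ₗ[ℂ] WithLp 2 (L2Circle × L2Circle) :=
  (WithLp.linearEquiv 2 ℂ (L2Circle × L2Circle)).symm.toLinearMap ∘ₗ
    (HardyAnnulus.innerBdry A).prod (HardyAnnulus.outerBdry A)

lemma HardyAnnulus.bdry_injective (A : AnnulusRadii) :
    Function.Injective (HardyAnnulus.bdry A) := by
  refine (injective_iff_map_eq_zero _).2 fun f hf => ?_
  have h0 : bdryFromInside A.R f.1 = 0 := congrArg (fun x => x.snd) hf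
  refine Subtype.ext (funext fun z => ?_)
  change f.1 z = 0
  by_cases hz : z ∈ A.toSet
  · have h1 := tendsto_bdryFromInside f.2 A.r_pos.le A.r_lt_R subset_rfl
    rw [h0, ← nhdsWithin_Ioo_eq_nhdsLT A.r_lt_R] at h1
    exact eq_zero_of_bdry A.r_pos.le A.r_lt_R f.2.1 (A.r_pos.trans A.r_lt_R) (Or.inr rfl) h1 z hz
  · exact f.2.2.1 z hz

/-- `‖f‖² = ∫ |f(re^{iθ})|² dθ/2π`, through the boundary values of `f`. -/
instance (r : ℝ) [Fact (0 < r)] : NormedAddCommGroup (HardyDisk r) :=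
  NormedAddCommGroup.induced _ _ (HardyDisk.bdry r) (HardyDisk.bdry_injective r)

instance (r : ℝ) [Fact (0 < r)] : NormedSpace ℂ (HardyDisk r) :=
  NormedSpace.induced ℂ _ _ (HardyDisk.bdry r)

/-- `‖f‖² = ∫ |f(Re^{iθ})|² dθ/2π`, through the boundary values of `f`. -/
instance (R : ℝ) [Fact (0 < R)] : NormedAddCommGroup (HardyExterior R) :=
  NormedAddCommGroup.induced _ _ (HardyExterior.bdry R) (HardyExterior.bdry_injective R)

instance (R : ℝ) [Fact (0 < R)] : NormedSpace ℂ (HardyExterior R) :=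
  NormedSpace.induced ℂ _ _ (HardyExterior.bdry R)

/-- `‖f‖² = ∫ |f(re^{iθ})|² dθ/2π + ∫ |f(Re^{iθ})|² dθ/2π`, through the boundary values of `f`. -/
instance (A : AnnulusRadii) : NormedAddCommGroup (HardyAnnulus A) :=
  NormedAddCommGroup.induced _ _ (HardyAnnulus.bdry A) (HardyAnnulus.bdry_injective A)

instance (A : AnnulusRadii) : NormedSpace ℂ (HardyAnnulus A) :=
  NormedSpace.induced ℂ _ _ (HardyAnnulus.bdry A)

/-! ### The projections `Π_±` -/

lemma norm_fourierCoeff_le (g : L2Circle) (n : ℤ) : ‖fourierCoeff g n‖ ≤ ‖g‖ := by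
  rw [← fourierBasis_repr, ← fourierBasis.repr.norm_map g]
  exact lp.norm_apply_le_norm (by simp) _ n

/-- For `g = ∑ g_n z^n` in `L²(𝕋_ρ)`, the function `g_+(z) = ∑_{n ≥ 0} g_n z^n` on the disk `D_σ`,
`σ ≤ ρ`. Here `g_n ρ^n` is the `n`-th Fourier coefficient of `θ ↦ g(ρ e^{iθ})`. -/
def rieszPlusFun (ρ σ : ℝ) (g : L2Circle) (z : ℂ) : ℂ :=
  (Metric.ball 0 σ).indicator (fun z => ∑' n : ℕ, fourierCoeff g n * (z / ρ) ^ n) z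

/-- For `g = ∑ g_n z^n` in `L²(𝕋_ρ)`, the function `g_-(z) = ∑_{n ≥ 1} g_{-n} z^{-n}` on the exterior
disk `D^∞_σ`, `σ ≥ ρ`. Here `g_{-n} ρ^{-n}` is the `-n`-th Fourier coefficient of
`θ ↦ g(ρ e^{iθ})`. -/
def rieszMinusFun (ρ σ : ℝ) (g : L2Circle) (z : ℂ) : ℂ :=
  (exteriorSet σ).indicator
    (fun z => ∑' n : ℕ, fourierCoeff g (-((n : ℤ) + 1)) * (ρ / z) ^ (n + 1)) z

lemma summable_power {c : ℕ → ℂ} {M : ℝ} (hc : ∀ n, ‖c n‖ ≤ M) {w : ℂ} (hw : ‖w‖ < 1) :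
    Summable fun n => c n * w ^ n := by
  refine Summable.of_norm_bounded (g := fun n => M * ‖w‖ ^ n)
    ((summable_geometric_of_lt_one (norm_nonneg _) hw).mul_left M) fun n => ?_
  rw [norm_mul, norm_pow]
  exact mul_le_mul_of_nonneg_right (hc n) (by positivity)

lemma differentiableOn_power {c : ℕ → ℂ} {M : ℝ} (hc : ∀ n, ‖c n‖ ≤ M) :
    DifferentiableOn ℂ (fun w => ∑' n, c n * w ^ n) (Metric.ball 0 1) := by
  intro w hw
  have hw1 : ‖w‖ < 1 := by simpa using hw
  obtain ⟨s, hs, hs1⟩ := exists_between hw1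
  have hs0 : 0 ≤ s := (norm_nonneg w).trans hs.le
  have h : DifferentiableOn ℂ (fun w => ∑' n, c n * w ^ n) (Metric.ball 0 s) := by
    refine differentiableOn_tsum_of_summable_norm (u := fun n => M * s ^ n)
      ((summable_geometric_of_lt_one hs0 hs1).mul_left M)
      (fun n => (differentiable_id.pow n |>.const_mul (c n)).differentiableOn) Metric.isOpen_ball
      fun n z hz => ?_
    rw [norm_mul, norm_pow]
    have hz' : ‖z‖ ≤ s := by simpa using (Metric.mem_ball.1 hz).le
    have hM : 0 ≤ M := (norm_nonneg _).trans (hc n)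
    exact mul_le_mul (hc n) (pow_le_pow_left₀ (norm_nonneg _) hz' n) (by positivity) hM
  exact (h.differentiableAt (Metric.isOpen_ball.mem_nhds (by simpa using hs))).differentiableWithinAt

/-- Partial Fourier series with damped coefficients do not increase the `L²` norm. -/
lemma norm_slice_le {f : ℂ → ℂ} {s : ℝ} (g : L2Circle) (k : ℕ → ℤ) (hk : Function.Injective k)
    (t : ℕ → ℝ) (ht0 : ∀ n, 0 ≤ t n) (ht1 : ∀ n, t n ≤ 1) (ht : Summable t)
    (hf : ∀ θ, f (circlePt s θ) =
      ∑' n, fourierCoeff g (k n) * ((t n : ℂ) * (toCircle θ : ℂ) ^ (k n))) :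
    Continuous (fun θ => f (circlePt s θ)) ∧ ‖slice f s‖ ≤ ‖g‖ := by
  set u : ℕ → C(AddCircle (2 * π), ℂ) :=
    fun n => (fourierCoeff g (k n) * (t n : ℂ)) • fourier (k n) with hu
  have hcoef : ∀ n, ‖fourierCoeff g (k n) * (t n : ℂ)‖ ≤ ‖g‖ * t n := by
    intro n
    rw [norm_mul, Complex.norm_real, Real.norm_of_nonneg (ht0 n)]
    exact mul_le_mul_of_nonneg_right (norm_fourierCoeff_le g _) (ht0 n)
  have hsum : Summable u := by
    refine Summable.of_norm_bounded (g := fun n => ‖g‖ * t n) (ht.mul_left _) fun n => ?_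
    rw [hu, norm_smul, fourier_norm, mul_one]
    exact hcoef n
  have hF : (fun θ => f (circlePt s θ)) = ⇑(∑' n, u n) := by
    funext θ
    rw [hf]
    refine Eq.trans ?_ (ContinuousMap.tsum_apply hsum θ)
    refine tsum_congr fun n => ?_
    simp only [hu, ContinuousMap.smul_apply, fourier_apply, toCircle_zsmul, Circle.coe_zpow,
      smul_eq_mul, mul_assoc]
  have hcont : Continuous fun θ => f (circlePt s θ) := by
    rw [hF]; exact (∑' n, u n).continuous
  refine ⟨hcont, ?_⟩
  have hs : slice f s = ContinuousMap.toLp 2 haarAddCircle ℂ (∑' n, u n) := by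
    rw [slice_eq hcont]
    apply Lp.ext
    refine (memLp_of_continuous hcont).coeFn_toLp.trans ?_
    rw [hF]
    exact (ContinuousMap.coeFn_toLp haarAddCircle _).symm
  have hlim : Tendsto (fun S : Finset ℕ => ∑ n ∈ S,
      (fourierCoeff g (k n) * (t n : ℂ)) • fourierLp (T := 2 * π) 2 (k n)) atTop
      (𝓝 (slice f s)) := by
    rw [hs]
    have := hsum.hasSum.mapL (ContinuousMap.toLp (E := ℂ) 2
      (haarAddCircle : Measure (AddCircle (2 * π))) ℂ)
    simpa [HasSum, hu] using this
  refine le_of_tendsto hlim.norm (Eventually.of_forall fun S => ?_)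
  have hon : Orthonormal ℂ fun n => fourierLp (T := 2 * π) 2 (k n) :=
    orthonormal_fourier.comp k hk
  refine (pow_le_pow_iff_left₀ (norm_nonneg _) (norm_nonneg _) two_ne_zero).1 ?_
  rw [← inner_self_eq_norm_sq (𝕜 := ℂ), hon.inner_sum, norm_sq_eq_tsum g, map_sum]
  have hsg := summable_repr_sq g
  calc ∑ n ∈ S, RCLike.re ((starRingEnd ℂ) (fourierCoeff g (k n) * (t n : ℂ)) *
          (fourierCoeff g (k n) * (t n : ℂ)))
      ≤ ∑ n ∈ S, ‖fourierBasis.repr g (k n)‖ ^ 2 := by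
        refine Finset.sum_le_sum fun n _ => ?_
        rw [RCLike.conj_mul, fourierBasis_repr]
        have h1 : ‖fourierCoeff g (k n) * (t n : ℂ)‖ ≤ ‖fourierCoeff g (k n)‖ := by
          rw [norm_mul, Complex.norm_real, Real.norm_of_nonneg (ht0 n)]
          exact mul_le_of_le_one_right (norm_nonneg _) (ht1 n)
        have h2 := pow_le_pow_left₀ (norm_nonneg _) h1 2
        exact_mod_cast h2
    _ = ∑ m ∈ S.map ⟨k, hk⟩, ‖fourierBasis.repr g m‖ ^ 2 := by
        rw [Finset.sum_map]; rfl
    _ ≤ _ := hsg.sum_le_tsum _ fun n _ => by positivity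

lemma fourierCoeff_Lp_add (g h : L2Circle) (n : ℤ) :
    fourierCoeff (g + h : L2Circle) n = fourierCoeff g n + fourierCoeff h n := by
  rw [← fourierBasis_repr, ← fourierBasis_repr, ← fourierBasis_repr, map_add]; rfl

lemma fourierCoeff_Lp_smul (c : ℂ) (g : L2Circle) (n : ℤ) :
    fourierCoeff (c • g : L2Circle) n = c * fourierCoeff g n := by
  rw [← fourierBasis_repr, ← fourierBasis_repr, map_smul]; rfl

lemma div_norm_lt {ρ σ : ℝ} (hσ : 0 < σ) (h : σ ≤ ρ) {z : ℂ} (hz : z ∈ Metric.ball (0 : ℂ) σ) :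
    ‖z / ρ‖ < 1 := by
  have hz' : ‖z‖ < σ := by simpa using hz
  rw [norm_div, Complex.norm_real, Real.norm_of_nonneg (hσ.le.trans h),
    div_lt_one (hσ.trans_le h)]
  exact hz'.trans_le h

lemma div_norm_lt' {ρ σ : ℝ} (hρ : 0 ≤ ρ) (h : ρ ≤ σ) {z : ℂ} (hz : z ∈ exteriorSet σ) :
    ‖(ρ : ℂ) / z‖ < 1 := by
  have hz' : σ < ‖z‖ := hz
  rw [norm_div, Complex.norm_real, Real.norm_of_nonneg hρ,
    div_lt_one ((hρ.trans h).trans_lt hz')]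
  exact h.trans_lt hz'

lemma rieszPlusFun_slice {ρ σ s : ℝ} (h : σ ≤ ρ) (hs : s ∈ Ioo 0 σ) (g : L2Circle) :
    Continuous (fun θ => rieszPlusFun ρ σ g (circlePt s θ)) ∧
      ‖slice (rieszPlusFun ρ σ g) s‖ ≤ ‖g‖ := by
  have hρ : 0 < ρ := (hs.1.trans hs.2).trans_le h
  have h0 : 0 ≤ s / ρ := div_nonneg hs.1.le hρ.le
  have h1 : s / ρ < 1 := (div_lt_one hρ).2 (hs.2.trans_le h)
  refine norm_slice_le g (fun n => (n : ℤ)) Nat.cast_injective (fun n => (s / ρ) ^ n)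
    (fun n => pow_nonneg h0 n) (fun n => pow_le_one₀ h0 h1.le)
    (summable_geometric_of_lt_one h0 h1) fun θ => ?_
  have hmem : circlePt s θ ∈ Metric.ball (0 : ℂ) σ := by
    simpa [norm_circlePt hs.1.le] using hs.2
  rw [rieszPlusFun, indicator_of_mem hmem]
  refine tsum_congr fun n => ?_
  rw [circlePt, zpow_natCast]
  push_cast
  rw [← mul_pow]
  congr 2
  ring

lemma rieszMinusFun_slice {ρ σ s : ℝ} (hρ : 0 < ρ) (h : ρ ≤ σ) (hs : σ < s) (g : L2Circle) :
    Continuous (fun θ => rieszMinusFun ρ σ g (circlePt s θ)) ∧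
      ‖slice (rieszMinusFun ρ σ g) s‖ ≤ ‖g‖ := by
  have hs0 : 0 < s := (hρ.trans_le h).trans hs
  have h0 : 0 ≤ ρ / s := div_nonneg hρ.le hs0.le
  have h1 : ρ / s < 1 := (div_lt_one hs0).2 (h.trans_lt hs)
  refine norm_slice_le g (fun n => -((n : ℤ) + 1)) (fun m n hmn => by simpa using hmn)
    (fun n => (ρ / s) ^ (n + 1))
    (fun n => pow_nonneg h0 _) (fun n => pow_le_one₀ h0 h1.le)
    ((summable_nat_add_iff 1).2 (summable_geometric_of_lt_one h0 h1)) fun θ => ?_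
  have hmem : circlePt s θ ∈ exteriorSet σ := by
    change σ < ‖circlePt s θ‖
    rwa [norm_circlePt hs0.le]
  rw [rieszMinusFun, indicator_of_mem hmem]
  refine tsum_congr fun n => ?_
  rw [circlePt, zpow_neg, ← Nat.cast_succ, zpow_natCast, ← inv_pow]
  push_cast
  rw [← mul_pow, div_mul_eq_div_div, div_eq_mul_inv (_ / _)]

lemma rieszPlusFun_mem {ρ σ : ℝ} (hσ : 0 < σ) (h : σ ≤ ρ) (g : L2Circle) :
    rieszPlusFun ρ σ g ∈ hardySpace (Metric.ball 0 σ) := by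
  refine ⟨?_, fun z hz => indicator_of_notMem hz _, ‖g‖ ^ 2, fun s hs hU => ?_⟩
  · have h1 : DifferentiableOn ℂ (fun z : ℂ => ∑' n : ℕ, fourierCoeff g n * (z / ρ) ^ n)
        (Metric.ball 0 σ) :=
      (differentiableOn_power (c := fun n : ℕ => fourierCoeff g n)
        fun n => norm_fourierCoeff_le g n).comp
        (differentiable_id.div_const (ρ : ℂ)).differentiableOn
        fun z hz => by simpa using div_norm_lt hσ h hz
    exact h1.congr fun z hz => indicator_of_mem hz _
  · have hsσ : s < σ := by
      have : ((s : ℂ)) ∈ Metric.ball (0 : ℂ) σ := hU (by simp [abs_of_pos hs])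
      simpa [abs_of_pos hs] using this
    obtain ⟨h1, h2⟩ := rieszPlusFun_slice h ⟨hs, hsσ⟩ g
    rw [meanSq_eq h1]
    exact pow_le_pow_left₀ (norm_nonneg _) h2 2

lemma rieszMinusFun_mem {ρ σ : ℝ} (hρ : 0 < ρ) (h : ρ ≤ σ) (g : L2Circle) :
    rieszMinusFun ρ σ g ∈ hardySpace (exteriorSet σ) ⊓ vanishingAtInfinity := by
  have hc : ∀ n : ℕ, ‖fourierCoeff g (-((n : ℤ) + 1))‖ ≤ ‖g‖ := fun n => norm_fourierCoeff_le g _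
  have hG := differentiableOn_power (c := fun n : ℕ => fourierCoeff g (-((n : ℤ) + 1))) hc
  have heq : ∀ z ∈ exteriorSet σ, rieszMinusFun ρ σ g z = ((ρ : ℂ) / z) *
      ∑' n : ℕ, fourierCoeff g (-((n : ℤ) + 1)) * ((ρ : ℂ) / z) ^ n := by
    intro z hz
    rw [rieszMinusFun, indicator_of_mem hz, ← tsum_mul_left]
    exact tsum_congr fun n => by ring
  refine ⟨⟨?_, fun z hz => indicator_of_notMem hz _, ‖g‖ ^ 2, fun s hs hU => ?_⟩, ?_⟩
  · have hd : DifferentiableOn ℂ (fun z : ℂ => (ρ : ℂ) / z) (exteriorSet σ) := by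
      refine (differentiableOn_const _).div differentiableOn_id fun z hz => ?_
      exact norm_pos_iff.1 ((hρ.trans_le h).trans hz)
    have h1 := hd.mul (hG.comp hd fun z hz => by simpa using div_norm_lt' hρ.le h hz)
    exact h1.congr heq
  · have hsσ : σ < s := by
      have : ((s : ℂ)) ∈ exteriorSet σ := hU (by simp [abs_of_pos hs])
      simpa [exteriorSet, abs_of_pos hs] using this
    obtain ⟨h1, h2⟩ := rieszMinusFun_slice hρ h hsσ g
    rw [meanSq_eq h1]
    exact pow_le_pow_left₀ (norm_nonneg _) h2 2
  · have hlim : Tendsto (fun z : ℂ => (ρ : ℂ) / z) (Bornology.cobounded ℂ) (𝓝 0) := by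
      simpa [div_eq_mul_inv] using (tendsto_inv₀_cobounded (α := ℂ)).const_mul (ρ : ℂ)
    have hcont : ContinuousAt (fun w : ℂ => w *
        ∑' n : ℕ, fourierCoeff g (-((n : ℤ) + 1)) * w ^ n) 0 :=
      continuousAt_id.mul (hG.differentiableAt
        (Metric.isOpen_ball.mem_nhds (by simp))).continuousAt
    have h2 : Tendsto _ (Bornology.cobounded ℂ) _ := hcont.tendsto.comp hlim
    rw [zero_mul] at h2
    refine h2.congr' ?_
    have : ∀ᶠ z : ℂ in Bornology.cobounded ℂ, σ < ‖z‖ :=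
      tendsto_norm_cobounded_atTop.eventually_gt_atTop σ
    filter_upwards [this] with z hz
    exact (heq z hz).symm

/-- `Π_+^{(ρ)} : L²(𝕋_ρ) → H²(D_ρ)`, `g ↦ g_+`, with the function `g_+` restricted to the disk `D_σ`,
`σ ≤ ρ` (no restriction for `σ = ρ`). -/
def rieszPlus (ρ σ : ℝ) [hσ : Fact (0 < σ)] (h : σ ≤ ρ) : L2Circle →L[ℂ] HardyDisk σ :=
  LinearMap.mkContinuous
    { toFun := fun g => (⟨rieszPlusFun ρ σ g, rieszPlusFun_mem hσ.out h g⟩ :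
        hardySpace (Metric.ball 0 σ))
      map_add' := fun g₁ g₂ => Subtype.ext <| funext fun z => by
        change rieszPlusFun ρ σ (g₁ + g₂) z = rieszPlusFun ρ σ g₁ z + rieszPlusFun ρ σ g₂ z
        by_cases hz : z ∈ Metric.ball (0 : ℂ) σ
        · simp only [rieszPlusFun, indicator_of_mem hz, fourierCoeff_Lp_add, add_mul]
          exact (summable_power (fun n : ℕ => norm_fourierCoeff_le g₁ n)
            (div_norm_lt hσ.out h hz)).tsum_add (summable_power
              (fun n : ℕ => norm_fourierCoeff_le g₂ n) (div_norm_lt hσ.out h hz))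
        · simp only [rieszPlusFun, indicator_of_notMem hz, add_zero]
      map_smul' := fun c g => Subtype.ext <| funext fun z => by
        change rieszPlusFun ρ σ (c • g) z = c * rieszPlusFun ρ σ g z
        by_cases hz : z ∈ Metric.ball (0 : ℂ) σ
        · simp only [rieszPlusFun, indicator_of_mem hz, fourierCoeff_Lp_smul, mul_assoc,
            tsum_mul_left]
        · simp only [rieszPlusFun, indicator_of_notMem hz, mul_zero] } 1 <| by
  intro g
  rw [one_mul]
  change ‖bdryFromInside σ (rieszPlusFun ρ σ g)‖ ≤ ‖g‖
  refine le_of_tendsto (tendsto_bdryFromInside (rieszPlusFun_mem hσ.out h g) le_rfl hσ.out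
    (annulusSet_subset_ball σ)).norm ?_
  rw [← nhdsWithin_Ioo_eq_nhdsLT hσ.out]
  filter_upwards [self_mem_nhdsWithin] with s hs
  exact (rieszPlusFun_slice h hs g).2

/-- `Π_-^{(ρ)} : L²(𝕋_ρ) → H²₀(D^∞_ρ)`, `g ↦ g_-`, with the function `g_-` restricted to the
exterior disk `D^∞_σ`, `σ ≥ ρ` (no restriction for `σ = ρ`). -/
def rieszMinus (ρ σ : ℝ) [hρ : Fact (0 < ρ)] [hσ : Fact (0 < σ)] (h : ρ ≤ σ) :
    L2Circle →L[ℂ] HardyExterior σ :=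
  LinearMap.mkContinuous
    { toFun := fun g => (⟨rieszMinusFun ρ σ g, rieszMinusFun_mem hρ.out h g⟩ :
        ↥(hardySpace (exteriorSet σ) ⊓ vanishingAtInfinity))
      map_add' := fun g₁ g₂ => Subtype.ext <| funext fun z => by
        change rieszMinusFun ρ σ (g₁ + g₂) z = rieszMinusFun ρ σ g₁ z + rieszMinusFun ρ σ g₂ z
        by_cases hz : z ∈ exteriorSet σ
        · simp only [rieszMinusFun, indicator_of_mem hz, fourierCoeff_Lp_add, add_mul]
          have hsum : ∀ g : L2Circle, Summable fun n : ℕ =>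
              fourierCoeff g (-((n : ℤ) + 1)) * ((ρ : ℂ) / z) ^ (n + 1) := fun g => by
            have := (summable_power (fun n : ℕ => norm_fourierCoeff_le g (-((n : ℤ) + 1)))
              (div_norm_lt' hρ.out.le h hz)).mul_left ((ρ : ℂ) / z)
            refine this.congr fun n => by ring
          exact (hsum g₁).tsum_add (hsum g₂)
        · simp only [rieszMinusFun, indicator_of_notMem hz, add_zero]
      map_smul' := fun c g => Subtype.ext <| funext fun z => by
        change rieszMinusFun ρ σ (c • g) z = c * rieszMinusFun ρ σ g z
        by_cases hz : z ∈ exteriorSet σ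
        · simp only [rieszMinusFun, indicator_of_mem hz, fourierCoeff_Lp_smul, mul_assoc,
            tsum_mul_left]
        · simp only [rieszMinusFun, indicator_of_notMem hz, mul_zero] } 1 <| by
  intro g
  rw [one_mul]
  change ‖bdryFromOutside σ (rieszMinusFun ρ σ g)‖ ≤ ‖g‖
  refine le_of_tendsto (tendsto_bdryFromOutside (rieszMinusFun_mem hρ.out h g).1 hσ.out
    (lt_add_one σ) (annulusSet_subset_exteriorSet σ)).norm ?_
  filter_upwards [self_mem_nhdsWithin] with s hs
  exact (rieszMinusFun_slice hρ.out h hs g).2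

/-! ### Expanding circle maps, transfer operators, and the block operator -/

/-- `τ` restricts to an analytic expanding map of the unit circle which preserves orientation: for
`|z| = 1` the number `zτ'(z)/τ(z)` is real, namely the derivative of a lift of the circle map. -/
structure IsAnalyticExpanding (τ : ℂ → ℂ) : Prop where
  mapsTo : MapsTo τ (Metric.sphere 0 1) (Metric.sphere 0 1)
  analytic : AnalyticOnNhd ℂ τ (Metric.sphere 0 1)
  expanding : ∀ z ∈ Metric.sphere (0 : ℂ) 1, 1 < ‖deriv τ z‖
  orientation : ∀ z ∈ Metric.sphere (0 : ℂ) 1, 0 < (z * deriv τ z / τ z).re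

/-- The family of annuli on which `τ` and `1/τ` are holomorphic. -/
def holomorphyAnnuli (τ : ℂ → ℂ) : Set AnnulusRadii :=
  {A | DifferentiableOn ℂ τ A.toSet ∧ ∀ z ∈ A.toSet, τ z ≠ 0}

/-- The annuli `A` on which the transfer operator is considered. -/
structure IsSuitableAnnulus (τ : ℂ → ℂ) (A : AnnulusRadii) : Prop where
  mem : A ∈ holomorphyAnnuli τ
  nested : ∃ A₀ ∈ holomorphyAnnuli τ, ∃ A' ∈ holomorphyAnnuli τ,
    closure A₀.toSet ⊆ A'.toSet ∧ closure A'.toSet ⊆ A.toSet ∧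
    τ '' frontier A₀.toSet ∩ closure A.toSet = ∅
  continuousOn : ContinuousOn τ (closure A.toSet)
  boundary : τ '' frontier A.toSet ∩ closure A.toSet = ∅

/-- The points of `A` which `τ` maps to `z`. -/
def fibre (τ : ℂ → ℂ) (A : AnnulusRadii) (z : ℂ) : Set ℂ := {w ∈ A.toSet | τ w = z}

/-- `L` is the transfer operator `(L f)(z) = ∑_k φ_k'(z) f(φ_k(z))`. The values `φ_k(z)` of the `K`
local inverses of `τ` are the `K` points `w` of `A` with `τ(w) = z`, at which `τ'(w) ≠ 0`, and
`φ_k'(z) = 1 / τ'(φ_k(z))`. -/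
def IsTransferOperator (τ : ℂ → ℂ) (A : AnnulusRadii)
    (L : HardyAnnulus A →L[ℂ] HardyAnnulus A) : Prop :=
  ∃ K : ℕ, 1 < K ∧ ∀ z ∈ A.toSet,
    (fibre τ A z).ncard = K ∧ (∀ w ∈ fibre τ A z, deriv τ w ≠ 0) ∧
    ∀ f : HardyAnnulus A, L f z = ∑ᶠ w ∈ fibre τ A z, (deriv τ w)⁻¹ * f w

/-- The topological direct sum `H²(D_r) ⊕ H²₀(D^∞_R)` with its Hilbert space norm. -/
abbrev DualModel (A : AnnulusRadii) : Type := WithLp 2 (HardyDisk A.r × HardyExterior A.R)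

/-- `(1/2πi) ∫_{𝕋_ρ} u(z) v(z) dz`, where `dz/(2πi) = ρe^{iθ} dθ/2π`. -/
def contourPairing (ρ : ℝ) (u v : L2Circle) : ℂ :=
  ∫ θ : AddCircle (2 * π), u θ * v θ * circlePt ρ θ ∂haarAddCircle

/-- `J(h₁,h₂)(f) = (1/2πi) ∫_{𝕋_r} f(z) h₁(z) dz + (1/2πi) ∫_{𝕋_R} f(z) h₂(z) dz`. -/
def IsDualityMap (A : AnnulusRadii) (J : DualModel A → StrongDual ℂ (HardyAnnulus A)) : Prop :=
  ∀ (h : DualModel A) (f : HardyAnnulus A),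
    J h f = contourPairing A.r (HardyAnnulus.innerBdry A f) (HardyDisk.bdry A.r h.fst) +
      contourPairing A.R (HardyAnnulus.outerBdry A f) (HardyExterior.bdry A.R h.snd)

/-- The Banach space adjoint `L*`, that is `(L* l)(f) = l(L f)`. -/
def banachAdjoint {A : AnnulusRadii} (L : HardyAnnulus A →L[ℂ] HardyAnnulus A) :
    StrongDual ℂ (HardyAnnulus A) →L[ℂ] StrongDual ℂ (HardyAnnulus A) :=
  ContinuousLinearMap.precomp ℂ L

/-- The operator `(g₁, g₂) ↦ (Π_+^{(r)} g₁ + Π_+^{(R)} g₂, Π_-^{(r)} g₁ + Π_-^{(R)} g₂)` applied to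
`g₁ = C_r h₁`, `g₂ = C_R h₂`; that is, the block matrix with rows
`Π_+^{(r)} C_r, Π_+^{(R)} C_R` and `Π_-^{(r)} C_r, Π_-^{(R)} C_R`. -/
def blockOperator (A : AnnulusRadii) (Cr : HardyDisk A.r →L[ℂ] L2Circle)
    (CR : HardyExterior A.R →L[ℂ] L2Circle) : DualModel A →L[ℂ] DualModel A :=
  let e := WithLp.prodContinuousLinearEquiv 2 ℂ (HardyDisk A.r) (HardyExterior A.R)
  (e.symm : _ →L[ℂ] DualModel A) ∘L
    (((rieszPlus A.r A.r le_rfl ∘L Cr).coprod (rieszPlus A.R A.r A.r_lt_R.le ∘L CR)).prod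
      ((rieszMinus A.r A.R A.r_lt_R.le ∘L Cr).coprod (rieszMinus A.R A.R le_rfl ∘L CR))) ∘L
    (e : DualModel A →L[ℂ] _)

end ExpandingCircle

end

/-!
# The transfer operator of an analytic expanding circle map and its adjoint

*Preimages.* A holomorphic lift `T` of `τ` through `exp` maps the imaginary axis to itself with
`T' > 1`, so `T(w + 2πi) = T(w) + 2πiK` with a degree `K > 1`. By the maximum principle
`|τ| > R` on the outer and `|τ| < r` on the inner boundary circle (`norm_gt_of_outer`,
`norm_lt_of_inner`). The lift therefore takes every value in the strip over `A`, by an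
open-and-closed argument, and the solutions of `T(w) = log z + 2πij` for `0 ≤ j < K` yield `K`
distinct preimages of `z ∈ A`. The argument principle allows only `K` with multiplicities, so there
are no others and all of them are simple (`exists_degree_fibre`).

*The transfer operator.* By the residue theorem `∑ f(w) / τ'(w)` over the fibre of `z` is the
boundary integral of `f(w) / (τ(w) - z)` (`finsum_fibre_eq`). As `τ(∂A)` has positive distance
from `A`, expanding the kernel in geometric series on the two circles writes `𝓛 f` as a Laurent
series which converges geometrically on `A` (`finsum_fibre_eq_tsum`). This gives holomorphy and a
bound for `sup_A |𝓛 f|` in terms of `‖f‖`, hence the bounded operator `transferOp`. The coefficients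
of `𝓛 f` are the pairings of `f` with `τ^k` on `𝕋_r` and with `τ^{-k-1}` on `𝕋_R`.

*Duality.* Boundary values embed `H²(A)` isometrically into `L²(𝕋_r) ⊕ L²(𝕋_R)`. By the
Hahn-Banach and Riesz theorems a functional is a sum of pairings with some `g₁` on `𝕋_r` and `g₂` on
`𝕋_R`. On monomials one sees that the pairing with the part of `g₁` in negative powers of `z` can be
moved to `𝕋_R`, and the one with the part of `g₂` in nonnegative powers to `𝕋_r`
(`contourPairing_inner`, `contourPairing_outer`); so `J` is onto. It is injective because
`J(h₁, h₂)` at monomials returns the coefficients of `h₁` and `h₂`, and the open mapping theorem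
makes it an isomorphism (`dualityEquiv`).

*The adjoint.* Comparing coefficients, the pairing of `𝓛 f` with a monomial `h` on its circle is
the pairing of `f` with `h ∘ τ` there (`contourPairing_innerBdry_transferOp`,
`contourPairing_outerBdry_transferOp`), and by density this holds for all `h`. Moving the parts of
`h₁ ∘ τ` and `h₂ ∘ τ` to the proper circles as before gives the block matrix.
-/

noncomputable section

namespace ExpandingCircle

/-! ### Fourier monomials and the contour pairing on `L²` of a circle -/

/-- Continuous linear maps on `L²` of the circle are determined by their values on the
monomials `e^{inθ}`. -/
lemma ext_fourierLp {E : Type*} [NormedAddCommGroup E] [NormedSpace ℂ E]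
    {φ ψ : L2Circle →L[ℂ] E}
    (h : ∀ n : ℤ, φ (fourierLp (T := 2 * π) 2 n) = ψ (fourierLp (T := 2 * π) 2 n)) : φ = ψ := by
  refine ContinuousLinearMap.ext_on (s := range (fourierLp (T := 2 * π) 2)) ?_ ?_
  · have := span_fourierLp_closure_eq_top (T := 2 * π) (p := 2) (by simp)
    rwa [Submodule.dense_iff_topologicalClosure_eq_top]
  · rintro _ ⟨n, rfl⟩
    exact h n

lemma ext_fourierCoeff {g h : L2Circle} (H : ∀ n, fourierCoeff g n = fourierCoeff h n) : g = h := by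
  apply fourierBasis.repr.injective
  ext n
  rw [fourierBasis_repr, fourierBasis_repr, H]

lemma fourierCoeff_fourierLp (n m : ℤ) :
    fourierCoeff (fourierLp (T := 2 * π) 2 n) m = if m = n then 1 else 0 := by
  rw [← fourierBasis_repr, ← coe_fourierBasis, HilbertBasis.repr_self]
  simp [lp.single_apply, Pi.single_apply]

/-- The `n`-th Fourier coefficient as a continuous linear functional. -/
def fourierCoeffCLM (n : ℤ) : L2Circle →L[ℂ] ℂ :=
  LinearMap.mkContinuous
    { toFun := fun g => fourierCoeff g n
      map_add' := fun g h => fourierCoeff_Lp_add g h n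
      map_smul' := fun c g => fourierCoeff_Lp_smul c g n } 1
    fun g => by rw [one_mul]; exact norm_fourierCoeff_le g n

lemma fourierCoeffCLM_apply (n : ℤ) (g : L2Circle) : fourierCoeffCLM n g = fourierCoeff g n := rfl

lemma fourierCoeffCLM_fourierLp (n m : ℤ) :
    fourierCoeffCLM m (fourierLp (T := 2 * π) 2 n) = if m = n then 1 else 0 :=
  fourierCoeff_fourierLp n m

lemma norm_circlePt_eq_abs (ρ : ℝ) (θ : AddCircle (2 * π)) : ‖circlePt ρ θ‖ = |ρ| := by
  rw [circlePt, norm_mul, Circle.norm_coe, mul_one, Complex.norm_real, Real.norm_eq_abs]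

lemma integrable_contourPairing (ρ : ℝ) (u v : L2Circle) :
    Integrable (fun θ => u θ * v θ * circlePt ρ θ) haarAddCircle := by
  have h1 : Integrable (fun θ => u θ * v θ) haarAddCircle :=
    MemLp.integrable_mul (Lp.memLp u) (Lp.memLp v)
  refine h1.mul_bdd (c := |ρ|) (continuous_circlePt ρ).aestronglyMeasurable
    (ae_of_all _ fun θ => (norm_circlePt_eq_abs ρ θ).le)

lemma contourPairing_comm (ρ : ℝ) (u v : L2Circle) :
    contourPairing ρ u v = contourPairing ρ v u := by
  simp only [contourPairing, mul_comm (u _)]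

lemma contourPairing_add_left (ρ : ℝ) (u u' v : L2Circle) :
    contourPairing ρ (u + u') v = contourPairing ρ u v + contourPairing ρ u' v := by
  rw [contourPairing, contourPairing, contourPairing, ← integral_add
    (integrable_contourPairing ρ u v) (integrable_contourPairing ρ u' v)]
  refine integral_congr_ae ?_
  filter_upwards [Lp.coeFn_add u u'] with θ h
  rw [h, Pi.add_apply]
  ring

lemma contourPairing_smul_left (ρ : ℝ) (c : ℂ) (u v : L2Circle) :
    contourPairing ρ (c • u) v = c * contourPairing ρ u v := by
  rw [contourPairing, contourPairing, ← integral_const_mul]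
  refine integral_congr_ae ?_
  filter_upwards [Lp.coeFn_smul c u] with θ h
  rw [h, Pi.smul_apply, smul_eq_mul]
  ring

lemma norm_contourPairing_le (ρ : ℝ) (u v : L2Circle) :
    ‖contourPairing ρ u v‖ ≤ |ρ| * ‖u‖ * ‖v‖ := by
  -- the bound is Cauchy-Schwarz for `v` and `w = conj (u * ρ e^{iθ})`
  have hm : MemLp (fun θ => (starRingEnd ℂ) (u θ * circlePt ρ θ)) 2 haarAddCircle := by
    refine MemLp.of_le_mul (c := |ρ|) (Lp.memLp u) ?_ (ae_of_all _ fun θ => ?_)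
    · exact Complex.continuous_conj.comp_aestronglyMeasurable
        ((Lp.aestronglyMeasurable u).mul (continuous_circlePt ρ).aestronglyMeasurable)
    · rw [RCLike.norm_conj, norm_mul, norm_circlePt_eq_abs, mul_comm]
  have h1 : contourPairing ρ u v = inner ℂ hm.toLp v := by
    rw [L2.inner_def, contourPairing]
    refine integral_congr_ae ?_
    filter_upwards [hm.coeFn_toLp] with θ h
    rw [h, RCLike.inner_apply, Complex.conj_conj]
    ring
  have h2 : ‖hm.toLp‖ ≤ |ρ| * ‖u‖ := by
    refine Lp.norm_le_mul_norm_of_ae_le_mul ?_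
    filter_upwards [hm.coeFn_toLp] with θ h
    rw [h, RCLike.norm_conj, norm_mul, norm_circlePt_eq_abs, mul_comm]
  rw [h1]
  exact (norm_inner_le_norm _ _).trans (mul_le_mul_of_nonneg_right h2 (norm_nonneg _))

/-- The contour pairing as a continuous bilinear form. -/
def pairingCLM (ρ : ℝ) : L2Circle →L[ℂ] L2Circle →L[ℂ] ℂ :=
  LinearMap.mkContinuous₂
    (LinearMap.mk₂ ℂ (contourPairing ρ) (contourPairing_add_left ρ)
      (fun c u v => contourPairing_smul_left ρ c u v)
      (fun u v w => by
        rw [contourPairing_comm, contourPairing_add_left, contourPairing_comm ρ v,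
          contourPairing_comm ρ w])
      (fun c u v => by
        rw [contourPairing_comm, contourPairing_smul_left, contourPairing_comm ρ v, smul_eq_mul]))
    |ρ| (norm_contourPairing_le ρ)

lemma pairingCLM_apply (ρ : ℝ) (u v : L2Circle) : pairingCLM ρ u v = contourPairing ρ u v := rfl

lemma contourPairing_fourierLp (ρ : ℝ) (u : L2Circle) (n : ℤ) :
    contourPairing ρ u (fourierLp (T := 2 * π) 2 n) = ρ * fourierCoeff u (-n - 1) := by
  rw [contourPairing, fourierCoeff, ← integral_const_mul]
  refine integral_congr_ae ?_
  filter_upwards [coeFn_fourierLp (T := 2 * π) 2 n] with θ h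
  rw [h, circlePt, ← fourier_one, neg_sub, sub_neg_eq_add, add_comm, fourier_add, smul_eq_mul]
  ring

lemma contourPairing_eq_mul (ρ : ℝ) (u v : L2Circle) :
    contourPairing ρ u v = ρ * contourPairing 1 u v := by
  rw [contourPairing, contourPairing, ← integral_const_mul]
  refine integral_congr_ae (ae_of_all _ fun θ => ?_)
  simp only [circlePt]
  push_cast
  ring

/-- A continuous function on the circle as an element of `L²`. -/
def contToL2 : C(AddCircle (2 * π), ℂ) →L[ℂ] L2Circle := ContinuousMap.toLp 2 haarAddCircle ℂ

lemma coeFn_contToL2 (g : C(AddCircle (2 * π), ℂ)) : contToL2 g =ᵐ[haarAddCircle] g :=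
  ContinuousMap.coeFn_toLp haarAddCircle g

lemma norm_contToL2_le (g : C(AddCircle (2 * π), ℂ)) : ‖contToL2 g‖ ≤ ‖g‖ := by
  have h1 : ∀ᵐ θ ∂haarAddCircle, ‖contToL2 g θ‖ ≤ ‖g‖ := by
    filter_upwards [coeFn_contToL2 g] with θ h
    rw [h]
    exact g.norm_coe_le_norm θ
  refine (Lp.norm_le_of_ae_bound (norm_nonneg g) h1).trans (le_of_eq ?_)
  simp [measureUnivNNReal]

lemma slice_eq_contToL2 {f : ℂ → ℂ} {ρ : ℝ} (g : C(AddCircle (2 * π), ℂ))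
    (h : ∀ θ, f (circlePt ρ θ) = g θ) : slice f ρ = contToL2 g := by
  have h' : (fun θ => f (circlePt ρ θ)) = g := funext h
  have hc : Continuous fun θ => f (circlePt ρ θ) := h' ▸ g.continuous
  rw [slice_eq hc]
  apply Lp.ext
  refine (memLp_of_continuous hc).coeFn_toLp.trans ?_
  rw [h']
  exact (coeFn_contToL2 g).symm

lemma contToL2_fourier (n : ℤ) : contToL2 (fourier n) = fourierLp (T := 2 * π) 2 n := rfl

lemma fourier_eq_zpow (n : ℤ) (θ : AddCircle (2 * π)) :
    fourier n θ = (toCircle θ : ℂ) ^ n := by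
  rw [fourier_apply, toCircle_zsmul, Circle.coe_zpow]

/-- If `f(z) = c z^n` on the circle of radius `ρ`, then its slice is a multiple of the
monomial `e^{inθ}`. -/
lemma slice_monomial {f : ℂ → ℂ} {ρ : ℝ} {c : ℂ} {n : ℤ}
    (h : ∀ θ, f (circlePt ρ θ) = c * circlePt ρ θ ^ n) :
    slice f ρ = (c * (ρ : ℂ) ^ n) • fourierLp (T := 2 * π) 2 n := by
  rw [slice_eq_contToL2 ((c * (ρ : ℂ) ^ n) • fourier n), map_smul, contToL2_fourier]
  intro θ
  rw [h, circlePt, mul_zpow, ContinuousMap.smul_apply, fourier_eq_zpow, smul_eq_mul, mul_assoc]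

lemma contourPairing_contToL2 (ρ : ℝ) (g h : C(AddCircle (2 * π), ℂ)) :
    contourPairing ρ (contToL2 g) (contToL2 h) =
      ∫ θ, g θ * h θ * circlePt ρ θ ∂haarAddCircle := by
  refine integral_congr_ae ?_
  filter_upwards [coeFn_contToL2 g, coeFn_contToL2 h] with θ h1 h2
  rw [h1, h2]

lemma circlePt_coe (ρ θ : ℝ) : circlePt ρ (θ : AddCircle (2 * π)) = circleMap 0 ρ θ := by
  rw [circlePt, toCircle_apply_mk, Circle.coe_exp, circleMap, zero_add]
  congr 3
  rw [div_self Real.two_pi_pos.ne', one_mul]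

/-- For functions continuous on the circle the contour pairing is a contour integral. -/
lemma contourPairing_slice {f g : ℂ → ℂ} {ρ : ℝ}
    (hf : Continuous fun θ => f (circlePt ρ θ)) (hg : Continuous fun θ => g (circlePt ρ θ)) :
    contourPairing ρ (slice f ρ) (slice g ρ) =
      (2 * π * I)⁻¹ * ∮ z in C(0, ρ), f z * g z := by
  rw [slice_eq_contToL2 ⟨_, hf⟩ fun θ => rfl, slice_eq_contToL2 ⟨_, hg⟩ fun θ => rfl,
    contourPairing_contToL2]
  have h0 := fourierCoeff_eq_intervalIntegral
    (fun θ => f (circlePt ρ θ) * g (circlePt ρ θ) * circlePt ρ θ) 0 0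
  rw [fourierCoeff] at h0
  simp only [neg_zero, fourier_zero, one_smul, zero_add] at h0
  have key : ∀ θ : ℝ, deriv (circleMap 0 ρ) θ • (f (circleMap 0 ρ θ) * g (circleMap 0 ρ θ)) =
      I * (f (circlePt ρ (θ : AddCircle (2 * π))) * g (circlePt ρ (θ : AddCircle (2 * π))) *
        circlePt ρ (θ : AddCircle (2 * π))) := fun θ => by
    rw [deriv_circleMap, circlePt_coe, smul_eq_mul]
    ring
  rw [circleIntegral]
  simp only [key, intervalIntegral.integral_const_mul]
  simp only [ContinuousMap.coe_mk]
  rw [h0, Complex.real_smul]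
  have hpi : (π : ℂ) ≠ 0 := by exact_mod_cast Real.pi_ne_zero
  have hI : I ≠ 0 := I_ne_zero
  push_cast
  field_simp

/-! ### Fourier coefficients of boundary values -/

/-- If the slices of `f` have the Fourier coefficients `c_n s^n`, then so have their limits as `s`
tends to a positive radius. -/
lemma fourierCoeff_of_tendsto_slice {f : ℂ → ℂ} {c : ℤ → ℂ} {e : ℝ} (he : 0 < e) {l : Filter ℝ}
    [l.NeBot] (hl : l ≤ 𝓝 e) {g : L2Circle} (h : Tendsto (slice f) l (𝓝 g))
    (hc : ∀ᶠ s : ℝ in l, ∀ n, fourierCoeff (slice f s) n = c n * (s : ℂ) ^ n) (n : ℤ) :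
    fourierCoeff g n = c n * (e : ℂ) ^ n := by
  have h1 : Tendsto (fun s => fourierCoeff (slice f s) n) l (𝓝 (fourierCoeff g n)) :=
    ((fourierCoeffCLM n).continuous.tendsto g).comp h
  have h2 : Tendsto (fun s : ℝ => c n * (s : ℂ) ^ n) l (𝓝 (c n * (e : ℂ) ^ n)) := by
    have he' : (e : ℂ) ≠ 0 := by exact_mod_cast he.ne'
    have : ContinuousAt (fun s : ℝ => c n * (s : ℂ) ^ n) e :=
      continuousAt_const.mul ((continuousAt_zpow₀ (e : ℂ) n (Or.inl he')).comp
        Complex.continuous_ofReal.continuousAt)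
    exact this.tendsto.mono_left hl
  refine tendsto_nhds_unique h1 (h2.congr' ?_)
  filter_upwards [hc] with s hs using (hs n).symm

lemma AnnulusRadii.R_pos (A : AnnulusRadii) : 0 < A.R := one_pos.trans A.one_lt_R

/-- Laurent coefficients of a function in `H²(A)`, and the Fourier coefficients of its boundary
values. -/
lemma HardyAnnulus.exists_coeff {A : AnnulusRadii} (f : HardyAnnulus A) :
    ∃ c : ℤ → ℂ,
      (∀ s ∈ Ioo A.r A.R, ∀ n, fourierCoeff (slice f s) n = c n * (s : ℂ) ^ n) ∧
      (∀ n, fourierCoeff (HardyAnnulus.innerBdry A f) n = c n * (A.r : ℂ) ^ n) ∧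
      (∀ n, fourierCoeff (HardyAnnulus.outerBdry A f) n = c n * (A.R : ℂ) ^ n) := by
  obtain ⟨c, hc⟩ := exists_laurent A.r_pos.le f.2.1
  simp only [fourierBasis_repr] at hc
  refine ⟨c, hc, ?_, ?_⟩
  · refine fourierCoeff_of_tendsto_slice A.r_pos nhdsWithin_le_nhds
      (tendsto_bdryFromOutside f.2 A.r_pos A.r_lt_R subset_rfl) ?_
    rw [← nhdsWithin_Ioo_eq_nhdsGT A.r_lt_R]
    filter_upwards [self_mem_nhdsWithin] with s hs using hc s hs
  · refine fourierCoeff_of_tendsto_slice A.R_pos nhdsWithin_le_nhds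
      (tendsto_bdryFromInside f.2 A.r_pos.le A.r_lt_R subset_rfl) ?_
    rw [← nhdsWithin_Ioo_eq_nhdsLT A.r_lt_R]
    filter_upwards [self_mem_nhdsWithin] with s hs using hc s hs

lemma HardyDisk.fourierCoeff_bdry_of_neg {r : ℝ} [hr : Fact (0 < r)] (h : HardyDisk r) {n : ℤ}
    (hn : n < 0) : fourierCoeff (HardyDisk.bdry r h) n = 0 := by
  have hr0 := hr.out
  obtain ⟨c, hc⟩ := exists_laurent le_rfl (h.2.1.mono (annulusSet_subset_ball r))
  simp only [fourierBasis_repr] at hc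
  have hlim := fourierCoeff_of_tendsto_slice hr0 (l := 𝓝[<] r) nhdsWithin_le_nhds
    (tendsto_bdryFromInside h.2 le_rfl hr0 (annulusSet_subset_ball r)) (c := c) (by
      rw [← nhdsWithin_Ioo_eq_nhdsLT hr0]
      filter_upwards [self_mem_nhdsWithin] with s hs using hc s hs) n
  have hs : r / 2 ∈ Ioo 0 r := ⟨by linarith, by linarith⟩
  have hcont := continuous_comp_circlePt (h.2.1.mono (annulusSet_subset_ball r)).continuousOn
    (circlePt_mem_annulusSet le_rfl hs)
  have h1 := repr_slice hs.1 hcont n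
  -- Cauchy's theorem on the disk, as `z^(-n-1)` is holomorphic for `n < 0`
  have h2 : (∮ z in C(0, r / 2), h.1 z * z ^ (-n - 1)) = 0 := by
    obtain ⟨k, hk⟩ : ∃ k : ℕ, -n - 1 = k := ⟨(-n - 1).toNat, by omega⟩
    have hd : DifferentiableOn ℂ (fun z => h.1 z * z ^ (-n - 1)) (Metric.ball 0 r) := by
      simp only [hk, zpow_natCast]
      exact h.2.1.mul (differentiable_id.pow k).differentiableOn
    have hsub : Metric.closedBall (0 : ℂ) (r / 2) ⊆ Metric.ball 0 r :=
      Metric.closedBall_subset_ball hs.2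
    exact circleIntegral_eq_zero_of_differentiable_on_off_countable hs.1.le countable_empty
      (hd.continuousOn.mono hsub) fun z hz => (hd.differentiableAt
        (Metric.isOpen_ball.mem_nhds (hsub (Metric.ball_subset_closedBall hz.1))))
  rw [fourierBasis_repr, h2, mul_zero, zero_mul, hc _ hs] at h1
  have hne : ((r / 2 : ℝ) : ℂ) ^ n ≠ 0 := zpow_ne_zero n (by exact_mod_cast hs.1.ne')
  have h3 : c n = 0 := (mul_eq_zero.1 h1).resolve_right hne
  rw [h3, zero_mul] at hlim
  exact hlim

lemma HardyExterior.fourierCoeff_bdry_of_nonneg {R : ℝ} [hR : Fact (0 < R)] (h : HardyExterior R)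
    {n : ℤ} (hn : 0 ≤ n) : fourierCoeff (HardyExterior.bdry R h) n = 0 := by
  have hR0 := hR.out
  have hlt := lt_add_one R
  obtain ⟨c, hc⟩ := exists_laurent hR0.le
    (h.2.1.1.mono (annulusSet_subset_exteriorSet R))
  simp only [fourierBasis_repr] at hc
  have hlim := fourierCoeff_of_tendsto_slice hR0 (l := 𝓝[>] R) nhdsWithin_le_nhds
    (tendsto_bdryFromOutside h.2.1 hR0 hlt (annulusSet_subset_exteriorSet R)) (c := c) (by
      rw [← nhdsWithin_Ioo_eq_nhdsGT hlt]
      filter_upwards [self_mem_nhdsWithin] with s hs using hc s hs) n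
  -- the coefficient `c_n` is the same on all circles of radius `s > R`
  have hcs : ∀ s : ℝ, R + 1 ≤ s → fourierCoeff (slice h.1 s) n = c n * (s : ℂ) ^ n := by
    intro s hs
    have hsub : annulusSet R (s + 1) ⊆ exteriorSet R := fun _ h => h.1
    obtain ⟨c', hc'⟩ := exists_laurent hR0.le (h.2.1.1.mono hsub)
    simp only [fourierBasis_repr] at hc'
    have hmid : R + 1 / 2 ∈ Ioo R (R + 1) := ⟨by linarith, by linarith⟩
    have hmid' : R + 1 / 2 ∈ Ioo R (s + 1) := ⟨by linarith, by linarith⟩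
    have hne : ((R + 1 / 2 : ℝ) : ℂ) ^ n ≠ 0 :=
      zpow_ne_zero n (by exact_mod_cast (hR0.trans hmid.1).ne')
    have := (hc _ hmid n).symm.trans (hc' _ hmid' n)
    rw [mul_right_cancel₀ hne this]
    exact hc' s ⟨by linarith, by linarith⟩ n
  have hc0 : c n = 0 := by
    by_contra hne
    have hpos : 0 < ‖c n‖ := norm_pos_iff.2 hne
    have hz : Tendsto h.1 (Bornology.cobounded ℂ) (𝓝 0) := h.2.2
    have h1 : ∀ᶠ z in Bornology.cobounded ℂ, ‖h.1 z‖ < ‖c n‖ := by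
      simpa using hz.norm.eventually_lt_const (by simpa using hpos)
    rw [← comap_norm_atTop] at h1
    obtain ⟨s, hs⟩ := (eventually_comap.1 h1).exists_forall_of_atTop
    set t := max (max s (R + 1)) 1 with ht
    have ht1 : 1 ≤ t := le_max_right _ _
    have htR : R + 1 ≤ t := (le_max_right _ _).trans (le_max_left _ _)
    have hts : s ≤ t := (le_max_left _ _).trans (le_max_left _ _)
    have ht0 : 0 < t := by linarith
    have hcont : Continuous fun θ => h.1 (circlePt t θ) :=
      continuous_comp_circlePt h.2.1.1.continuousOn fun θ => by
        change R < ‖circlePt t θ‖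
        rw [norm_circlePt ht0.le]
        linarith
    obtain ⟨θ₀, -, hθ₀⟩ := isCompact_univ.exists_isMaxOn univ_nonempty hcont.norm.continuousOn
    have h2 : ‖h.1 (circlePt t θ₀)‖ < ‖c n‖ := hs t hts _ (norm_circlePt ht0.le θ₀)
    have h3 : ‖slice h.1 t‖ ≤ ‖h.1 (circlePt t θ₀)‖ := by
      rw [slice_eq_contToL2 ⟨_, hcont⟩ fun θ => rfl]
      refine (norm_contToL2_le _).trans ?_
      exact (ContinuousMap.norm_le _ (norm_nonneg _)).2 fun θ => hθ₀ (mem_univ θ)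
    have h4 := norm_fourierCoeff_le (slice h.1 t) n
    rw [hcs t htR, norm_mul, norm_zpow, Complex.norm_real, Real.norm_of_nonneg ht0.le] at h4
    have h5 : 1 ≤ t ^ n := one_le_zpow₀ ht1 hn
    nlinarith
  rw [hc0, zero_mul] at hlim
  exact hlim

/-! ### Hardy spaces as closed subspaces of `L²`, and the Riesz projections of monomials -/

/-- The boundary values of functions in `H²(D_r)` as a linear isometry. -/
def HardyDisk.bdryLI (r : ℝ) [Fact (0 < r)] : HardyDisk r →ₗᵢ[ℂ] L2Circle :=
  ⟨HardyDisk.bdry r, fun _ => rfl⟩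

/-- The boundary values of functions in `H²₀(D^∞_R)` as a linear isometry. -/
def HardyExterior.bdryLI (R : ℝ) [Fact (0 < R)] : HardyExterior R →ₗᵢ[ℂ] L2Circle :=
  ⟨HardyExterior.bdry R, fun _ => rfl⟩

/-- The boundary values of functions in `H²(A)` as a linear isometry. -/
def HardyAnnulus.bdryLI (A : AnnulusRadii) :
    HardyAnnulus A →ₗᵢ[ℂ] WithLp 2 (L2Circle × L2Circle) :=
  ⟨HardyAnnulus.bdry A, fun _ => rfl⟩

lemma rieszPlusFun_fourierLp {ρ σ : ℝ} (n : ℤ) {z : ℂ} (hz : z ∈ Metric.ball (0 : ℂ) σ) :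
    rieszPlusFun ρ σ (fourierLp (T := 2 * π) 2 n) z =
      if 0 ≤ n then (ρ : ℂ) ^ (-n) * z ^ n else 0 := by
  rw [rieszPlusFun, indicator_of_mem hz]
  simp only [fourierCoeff_fourierLp]
  split_ifs with hn
  · lift n to ℕ using hn
    rw [tsum_eq_single n fun m hm => by simp [hm]]
    simp [div_eq_mul_inv, mul_comm, mul_pow]
  · convert tsum_zero with m
    rw [if_neg (by omega), zero_mul]

lemma rieszMinusFun_fourierLp {ρ σ : ℝ} (n : ℤ) {z : ℂ} (hz : z ∈ exteriorSet σ) :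
    rieszMinusFun ρ σ (fourierLp (T := 2 * π) 2 n) z =
      if 0 ≤ n then 0 else (ρ : ℂ) ^ (-n) * z ^ n := by
  rw [rieszMinusFun, indicator_of_mem hz]
  simp only [fourierCoeff_fourierLp]
  split_ifs with hn
  · convert tsum_zero with m
    rw [if_neg (by omega), zero_mul]
  · obtain ⟨k, hk⟩ : ∃ k : ℕ, n = -((k : ℤ) + 1) := ⟨(-n - 1).toNat, by omega⟩
    rw [tsum_eq_single k fun m hm => by rw [if_neg (by omega), zero_mul], if_pos hk.symm, hk,
      neg_neg, zpow_neg, ← Nat.cast_succ, zpow_natCast, zpow_natCast, div_pow, one_mul,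
      div_eq_mul_inv]

lemma bdry_rieszPlus_fourierLp {ρ σ : ℝ} [hσ : Fact (0 < σ)] (h : σ ≤ ρ) (n : ℤ) :
    HardyDisk.bdry σ (rieszPlus ρ σ h (fourierLp (T := 2 * π) 2 n)) =
      if 0 ≤ n then ((ρ : ℂ) ^ (-n) * (σ : ℂ) ^ n) • fourierLp (T := 2 * π) 2 n else 0 := by
  have hσ0 := hσ.out
  have hlim := tendsto_bdryFromInside (rieszPlusFun_mem hσ0 h (fourierLp (T := 2 * π) 2 n))
    le_rfl hσ0 (annulusSet_subset_ball σ)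
  have hs : ∀ s ∈ Ioo 0 σ, slice (rieszPlusFun ρ σ (fourierLp (T := 2 * π) 2 n)) s =
      ((if 0 ≤ n then (ρ : ℂ) ^ (-n) else 0) * (s : ℂ) ^ n) • fourierLp (T := 2 * π) 2 n := by
    intro s hs
    refine slice_monomial fun θ => ?_
    rw [rieszPlusFun_fourierLp n (by simpa [norm_circlePt hs.1.le] using hs.2)]
    split_ifs <;> simp
  apply ext_fourierCoeff
  intro m
  have := fourierCoeff_of_tendsto_slice hσ0 nhdsWithin_le_nhds hlim
    (c := fun m => if m = n then (if 0 ≤ n then (ρ : ℂ) ^ (-n) else 0) else 0) (by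
      rw [← nhdsWithin_Ioo_eq_nhdsLT hσ0]
      filter_upwards [self_mem_nhdsWithin] with s hs' m
      rw [hs s hs', fourierCoeff_Lp_smul, fourierCoeff_fourierLp]
      by_cases hmn : m = n <;> simp [hmn]) m
  refine Eq.trans this ?_
  rw [← fourierCoeffCLM_apply]
  by_cases hmn : m = n <;> by_cases hn : 0 ≤ n <;> simp [hmn, hn, fourierCoeffCLM_fourierLp]

lemma bdry_rieszMinus_fourierLp {ρ σ : ℝ} [hρ : Fact (0 < ρ)] [hσ : Fact (0 < σ)] (h : ρ ≤ σ)
    (n : ℤ) : HardyExterior.bdry σ (rieszMinus ρ σ h (fourierLp (T := 2 * π) 2 n)) =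
      if 0 ≤ n then 0 else ((ρ : ℂ) ^ (-n) * (σ : ℂ) ^ n) • fourierLp (T := 2 * π) 2 n := by
  have hσ0 := hσ.out
  have hlim := tendsto_bdryFromOutside (rieszMinusFun_mem hρ.out h
    (fourierLp (T := 2 * π) 2 n)).1 hσ0 (lt_add_one σ) (annulusSet_subset_exteriorSet σ)
  have hs : ∀ s ∈ Ioi σ, slice (rieszMinusFun ρ σ (fourierLp (T := 2 * π) 2 n)) s =
      ((if 0 ≤ n then 0 else (ρ : ℂ) ^ (-n)) * (s : ℂ) ^ n) • fourierLp (T := 2 * π) 2 n := by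
    intro s hs
    refine slice_monomial fun θ => ?_
    have hs0 : 0 ≤ s := (hσ0.trans hs).le
    rw [rieszMinusFun_fourierLp n (by
      change σ < ‖circlePt s θ‖
      rwa [norm_circlePt hs0])]
    split_ifs <;> simp
  apply ext_fourierCoeff
  intro m
  have := fourierCoeff_of_tendsto_slice hσ0 nhdsWithin_le_nhds hlim
    (c := fun m => if m = n then (if 0 ≤ n then 0 else (ρ : ℂ) ^ (-n)) else 0) (by
      filter_upwards [self_mem_nhdsWithin] with s hs' m
      rw [hs s hs', fourierCoeff_Lp_smul, fourierCoeff_fourierLp]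
      by_cases hmn : m = n <;> simp [hmn]) m
  refine Eq.trans this ?_
  rw [← fourierCoeffCLM_apply]
  by_cases hmn : m = n <;> by_cases hn : 0 ≤ n <;> simp [hmn, hn, fourierCoeffCLM_fourierLp]

lemma fourierCoeff_bdry_rieszPlus {r : ℝ} [hr : Fact (0 < r)] (g : L2Circle) (m : ℤ) :
    fourierCoeff (HardyDisk.bdry r (rieszPlus r r le_rfl g)) m =
      if 0 ≤ m then fourierCoeff g m else 0 := by
  have hr' : (r : ℂ) ≠ 0 := by exact_mod_cast hr.out.ne'
  have H : fourierCoeffCLM m ∘L (HardyDisk.bdryLI r).toContinuousLinearMap ∘L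
      rieszPlus r r le_rfl = if 0 ≤ m then fourierCoeffCLM m else 0 := by
    refine ext_fourierLp fun n => ?_
    change fourierCoeffCLM m (HardyDisk.bdry r (rieszPlus r r le_rfl _)) = _
    rw [bdry_rieszPlus_fourierLp, ← zpow_add₀ hr']
    by_cases hmn : m = n
    · subst hmn
      by_cases hm : 0 ≤ m <;> simp [hm]
    · by_cases hm : 0 ≤ m <;> by_cases hn : 0 ≤ n <;>
        simp [hm, hn, fourierCoeffCLM_fourierLp, hmn]
  have := congrArg (fun φ => φ g) H
  refine Eq.trans this ?_
  by_cases hm : 0 ≤ m <;> simp [hm, fourierCoeffCLM_apply]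

lemma fourierCoeff_bdry_rieszMinus {R : ℝ} [hR : Fact (0 < R)] (g : L2Circle) (m : ℤ) :
    fourierCoeff (HardyExterior.bdry R (rieszMinus R R le_rfl g)) m =
      if 0 ≤ m then 0 else fourierCoeff g m := by
  have hR' : (R : ℂ) ≠ 0 := by exact_mod_cast hR.out.ne'
  have H : fourierCoeffCLM m ∘L (HardyExterior.bdryLI R).toContinuousLinearMap ∘L
      rieszMinus R R le_rfl = if 0 ≤ m then 0 else fourierCoeffCLM m := by
    refine ext_fourierLp fun n => ?_
    change fourierCoeffCLM m (HardyExterior.bdry R (rieszMinus R R le_rfl _)) = _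
    rw [bdry_rieszMinus_fourierLp, ← zpow_add₀ hR']
    by_cases hmn : m = n
    · subst hmn
      by_cases hm : 0 ≤ m <;> simp [hm]
    · by_cases hm : 0 ≤ m <;> by_cases hn : 0 ≤ n <;>
        simp [hm, hn, fourierCoeffCLM_fourierLp, hmn]
  have := congrArg (fun φ => φ g) H
  refine Eq.trans this ?_
  by_cases hm : 0 ≤ m <;> simp [hm, fourierCoeffCLM_apply]

/-- A function in `H²(D_r)` is the Riesz projection of its boundary values. -/
lemma rieszPlus_bdry {r : ℝ} [Fact (0 < r)] (h : HardyDisk r) :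
    rieszPlus r r le_rfl (HardyDisk.bdry r h) = h := by
  apply HardyDisk.bdry_injective r
  apply ext_fourierCoeff
  intro m
  rw [fourierCoeff_bdry_rieszPlus]
  split_ifs with hm
  · rfl
  · exact (HardyDisk.fourierCoeff_bdry_of_neg h (not_le.1 hm)).symm

/-- A function in `H²₀(D^∞_R)` is the Riesz projection of its boundary values. -/
lemma rieszMinus_bdry {R : ℝ} [Fact (0 < R)] (h : HardyExterior R) :
    rieszMinus R R le_rfl (HardyExterior.bdry R h) = h := by
  apply HardyExterior.bdry_injective R
  apply ext_fourierCoeff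
  intro m
  rw [fourierCoeff_bdry_rieszMinus]
  split_ifs with hm
  · exact (HardyExterior.fourierCoeff_bdry_of_nonneg h hm).symm
  · rfl

/-! ### The duality between `H²(A)` and `H²(D_r) ⊕ H²₀(D^∞_R)` -/

/-- The boundary values on the inner circle as a continuous linear map. -/
def HardyAnnulus.innerCLM (A : AnnulusRadii) : HardyAnnulus A →L[ℂ] L2Circle :=
  ContinuousLinearMap.fst ℂ L2Circle L2Circle ∘L
    (WithLp.prodContinuousLinearEquiv 2 ℂ L2Circle L2Circle : _ →L[ℂ] L2Circle × L2Circle) ∘L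
      (HardyAnnulus.bdryLI A).toContinuousLinearMap

/-- The boundary values on the outer circle as a continuous linear map. -/
def HardyAnnulus.outerCLM (A : AnnulusRadii) : HardyAnnulus A →L[ℂ] L2Circle :=
  ContinuousLinearMap.snd ℂ L2Circle L2Circle ∘L
    (WithLp.prodContinuousLinearEquiv 2 ℂ L2Circle L2Circle : _ →L[ℂ] L2Circle × L2Circle) ∘L
      (HardyAnnulus.bdryLI A).toContinuousLinearMap

lemma HardyAnnulus.norm_sq_eq {A : AnnulusRadii} (f : HardyAnnulus A) :
    ‖f‖ ^ 2 = ‖HardyAnnulus.innerBdry A f‖ ^ 2 + ‖HardyAnnulus.outerBdry A f‖ ^ 2 :=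
  WithLp.prod_norm_sq_eq_of_L2 (HardyAnnulus.bdry A f)

lemma HardyAnnulus.norm_innerBdry_le {A : AnnulusRadii} (f : HardyAnnulus A) :
    ‖HardyAnnulus.innerBdry A f‖ ≤ ‖f‖ := by
  refine (pow_le_pow_iff_left₀ (norm_nonneg _) (norm_nonneg _) two_ne_zero).1 ?_
  rw [HardyAnnulus.norm_sq_eq]
  exact le_add_of_nonneg_right (by positivity)

lemma HardyAnnulus.norm_outerBdry_le {A : AnnulusRadii} (f : HardyAnnulus A) :
    ‖HardyAnnulus.outerBdry A f‖ ≤ ‖f‖ := by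
  refine (pow_le_pow_iff_left₀ (norm_nonneg _) (norm_nonneg _) two_ne_zero).1 ?_
  rw [HardyAnnulus.norm_sq_eq]
  exact le_add_of_nonneg_left (by positivity)

/-- Pairing with `g` on the inner circle, written with the Riesz projections of `g`: the part `g_-`
can be moved to the outer circle. -/
lemma contourPairing_inner {A : AnnulusRadii} (f : HardyAnnulus A) (g : L2Circle) :
    contourPairing A.r (HardyAnnulus.innerBdry A f) g =
      contourPairing A.r (HardyAnnulus.innerBdry A f)
        (HardyDisk.bdry A.r (rieszPlus A.r A.r le_rfl g)) +
      contourPairing A.R (HardyAnnulus.outerBdry A f)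
        (HardyExterior.bdry A.R (rieszMinus A.r A.R A.r_lt_R.le g)) := by
  obtain ⟨c, -, hcr, hcR⟩ := f.exists_coeff
  have hr : (A.r : ℂ) ≠ 0 := by exact_mod_cast A.r_pos.ne'
  have hR : (A.R : ℂ) ≠ 0 := by exact_mod_cast A.R_pos.ne'
  have H : pairingCLM A.r (HardyAnnulus.innerBdry A f) =
      pairingCLM A.r (HardyAnnulus.innerBdry A f) ∘L
        (HardyDisk.bdryLI A.r).toContinuousLinearMap ∘L rieszPlus A.r A.r le_rfl +
      pairingCLM A.R (HardyAnnulus.outerBdry A f) ∘L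
        (HardyExterior.bdryLI A.R).toContinuousLinearMap ∘L
          rieszMinus A.r A.R A.r_lt_R.le := by
    refine ext_fourierLp fun n => ?_
    change _ = pairingCLM A.r _ (HardyDisk.bdry A.r (rieszPlus A.r A.r le_rfl _)) +
      pairingCLM A.R _ (HardyExterior.bdry A.R (rieszMinus A.r A.R A.r_lt_R.le _))
    rw [bdry_rieszPlus_fourierLp, bdry_rieszMinus_fourierLp]
    by_cases hn : 0 ≤ n
    · simp [hn, inv_mul_cancel₀ (zpow_ne_zero n hr)]
    · simp only [hn, if_false, map_zero, zero_add, map_smul]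
      rw [pairingCLM_apply, pairingCLM_apply, contourPairing_fourierLp, contourPairing_fourierLp,
        hcr, hcR, smul_eq_mul, zpow_sub_one₀ hr, zpow_sub_one₀ hR, zpow_neg (A.R : ℂ)]
      have := zpow_ne_zero n hR
      field_simp
  exact congrArg (fun φ => φ g) H

/-- Pairing with `g` on the outer circle, written with the Riesz projections of `g`: the part `g_+`
can be moved to the inner circle. -/
lemma contourPairing_outer {A : AnnulusRadii} (f : HardyAnnulus A) (g : L2Circle) :
    contourPairing A.R (HardyAnnulus.outerBdry A f) g =
      contourPairing A.r (HardyAnnulus.innerBdry A f)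
        (HardyDisk.bdry A.r (rieszPlus A.R A.r A.r_lt_R.le g)) +
      contourPairing A.R (HardyAnnulus.outerBdry A f)
        (HardyExterior.bdry A.R (rieszMinus A.R A.R le_rfl g)) := by
  obtain ⟨c, -, hcr, hcR⟩ := f.exists_coeff
  have hr : (A.r : ℂ) ≠ 0 := by exact_mod_cast A.r_pos.ne'
  have hR : (A.R : ℂ) ≠ 0 := by exact_mod_cast A.R_pos.ne'
  have H : pairingCLM A.R (HardyAnnulus.outerBdry A f) =
      pairingCLM A.r (HardyAnnulus.innerBdry A f) ∘L
        (HardyDisk.bdryLI A.r).toContinuousLinearMap ∘L rieszPlus A.R A.r A.r_lt_R.le +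
      pairingCLM A.R (HardyAnnulus.outerBdry A f) ∘L
        (HardyExterior.bdryLI A.R).toContinuousLinearMap ∘L rieszMinus A.R A.R le_rfl := by
    refine ext_fourierLp fun n => ?_
    change _ = pairingCLM A.r _ (HardyDisk.bdry A.r (rieszPlus A.R A.r A.r_lt_R.le _)) +
      pairingCLM A.R _ (HardyExterior.bdry A.R (rieszMinus A.R A.R le_rfl _))
    rw [bdry_rieszPlus_fourierLp, bdry_rieszMinus_fourierLp]
    by_cases hn : 0 ≤ n
    · simp only [hn, if_true, map_zero, add_zero, map_smul]
      rw [pairingCLM_apply, pairingCLM_apply, contourPairing_fourierLp, contourPairing_fourierLp,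
        hcr, hcR, smul_eq_mul, zpow_sub_one₀ hr, zpow_sub_one₀ hR, zpow_neg (A.r : ℂ)]
      have := zpow_ne_zero n hr
      field_simp
    · simp [hn, inv_mul_cancel₀ (zpow_ne_zero n hR)]
  exact congrArg (fun φ => φ g) H

/-- The monomial `z^n` as an element of `H²(A)`. -/
def HardyAnnulus.monomial (A : AnnulusRadii) (n : ℤ) : HardyAnnulus A :=
  (⟨A.toSet.indicator fun z => z ^ n, by
    refine ⟨?_, fun z hz => indicator_of_notMem hz _, A.r ^ (2 * n) + A.R ^ (2 * n),
      fun ρ hρ hU => ?_⟩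
    · refine DifferentiableOn.congr (f := fun z => z ^ n) (fun z hz => ?_)
        fun z hz => indicator_of_mem hz _
      exact (differentiableAt_zpow.2
        (Or.inl (norm_pos_iff.1 (A.r_pos.trans hz.1)))).differentiableWithinAt
    · have hm : (ρ : ℂ) ∈ A.toSet := hU (by simp [abs_of_pos hρ])
      have hρ1 : A.r < ρ := by simpa [abs_of_pos hρ] using hm.1
      have hρ2 : ρ < A.R := by simpa [abs_of_pos hρ] using hm.2
      have hval : ∀ θ, ‖A.toSet.indicator (fun z : ℂ => z ^ n) (circlePt ρ θ)‖ ^ 2 =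
          ρ ^ (2 * n) := by
        intro θ
        have hθ : circlePt ρ θ ∈ A.toSet := circlePt_mem_annulusSet A.r_pos.le ⟨hρ1, hρ2⟩ θ
        rw [indicator_of_mem hθ, norm_zpow, norm_circlePt hρ.le, ← zpow_natCast, ← zpow_mul,
          mul_comm]
        rfl
      simp only [meanSq, hval, integral_const, probReal_univ, one_smul]
      rcases le_total 0 (2 * n) with hn | hn
      · exact (zpow_le_zpow_left₀ hn hρ.le hρ2.le).trans
          (le_add_of_nonneg_left (zpow_nonneg A.r_pos.le _))
      · refine le_trans ?_ (le_add_of_nonneg_right (zpow_nonneg A.R_pos.le _))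
        have h3 := zpow_le_zpow_left₀ (neg_nonneg.2 hn) A.r_pos.le hρ1.le
        rwa [zpow_neg, zpow_neg, inv_le_inv₀ (zpow_pos A.r_pos _) (zpow_pos hρ _)] at h3⟩ :
    hardySpace A.toSet)

lemma HardyAnnulus.fourierCoeff_monomial (A : AnnulusRadii) (n m : ℤ) :
    fourierCoeff (HardyAnnulus.innerBdry A (HardyAnnulus.monomial A n)) m =
        (if m = n then 1 else 0) * (A.r : ℂ) ^ m ∧
      fourierCoeff (HardyAnnulus.outerBdry A (HardyAnnulus.monomial A n)) m =
        (if m = n then 1 else 0) * (A.R : ℂ) ^ m := by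
  obtain ⟨c, hc, hcr, hcR⟩ := (HardyAnnulus.monomial A n).exists_coeff
  have h1 : (1 : ℝ) ∈ Ioo A.r A.R := ⟨A.r_lt_one, A.one_lt_R⟩
  have hs : slice (HardyAnnulus.monomial A n) 1 =
      ((1 : ℂ) * ((1 : ℝ) : ℂ) ^ n) • fourierLp (T := 2 * π) 2 n := by
    refine slice_monomial fun θ => ?_
    rw [one_mul]
    exact indicator_of_mem (s := A.toSet) (circlePt_mem_annulusSet A.r_pos.le h1 θ)
      fun z : ℂ => z ^ n
  have h2 : c m = if m = n then 1 else 0 := by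
    have := hc 1 h1 m
    rw [hs, ← fourierCoeffCLM_apply, map_smul, fourierCoeffCLM_fourierLp] at this
    simpa using this.symm
  exact ⟨by rw [hcr, h2], by rw [hcR, h2]⟩

/-- The map `J` as a continuous linear map into the dual. -/
def dualityCLM (A : AnnulusRadii) : DualModel A →L[ℂ] StrongDual ℂ (HardyAnnulus A) :=
  let e := WithLp.prodContinuousLinearEquiv 2 ℂ (HardyDisk A.r) (HardyExterior A.R)
  (ContinuousLinearMap.precomp ℂ (HardyAnnulus.innerCLM A) ∘L (pairingCLM A.r).flip ∘L
      (HardyDisk.bdryLI A.r).toContinuousLinearMap ∘L ContinuousLinearMap.fst ℂ _ _ +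
    ContinuousLinearMap.precomp ℂ (HardyAnnulus.outerCLM A) ∘L (pairingCLM A.R).flip ∘L
      (HardyExterior.bdryLI A.R).toContinuousLinearMap ∘L ContinuousLinearMap.snd ℂ _ _) ∘L
    (e : DualModel A →L[ℂ] HardyDisk A.r × HardyExterior A.R)

lemma dualityCLM_apply {A : AnnulusRadii} (h : DualModel A) (f : HardyAnnulus A) :
    dualityCLM A h f =
      contourPairing A.r (HardyAnnulus.innerBdry A f) (HardyDisk.bdry A.r h.fst) +
      contourPairing A.R (HardyAnnulus.outerBdry A f) (HardyExterior.bdry A.R h.snd) := rfl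

lemma dualityCLM_injective (A : AnnulusRadii) : Function.Injective (dualityCLM A) := by
  refine (injective_iff_map_eq_zero _).2 fun h hh => ?_
  have hr : (A.r : ℂ) ≠ 0 := by exact_mod_cast A.r_pos.ne'
  have hR : (A.R : ℂ) ≠ 0 := by exact_mod_cast A.R_pos.ne'
  -- test `J h` on the monomial `z^(-n-1)`
  have key : ∀ n : ℤ, (A.r : ℂ) ^ (-n) * fourierCoeff (HardyDisk.bdry A.r h.fst) n +
      (A.R : ℂ) ^ (-n) * fourierCoeff (HardyExterior.bdry A.R h.snd) n = 0 := by
    intro n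
    have h1 : dualityCLM A h (HardyAnnulus.monomial A (-n - 1)) = 0 := by rw [hh]; rfl
    have e1 : HardyAnnulus.innerBdry A (HardyAnnulus.monomial A (-n - 1)) =
        (A.r : ℂ) ^ (-n - 1) • fourierLp (T := 2 * π) 2 (-n - 1) := by
      apply ext_fourierCoeff
      intro m
      rw [(HardyAnnulus.fourierCoeff_monomial A _ m).1, fourierCoeff_Lp_smul,
        fourierCoeff_fourierLp]
      by_cases hm : m = -n - 1 <;> simp [hm]
    have e2 : HardyAnnulus.outerBdry A (HardyAnnulus.monomial A (-n - 1)) =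
        (A.R : ℂ) ^ (-n - 1) • fourierLp (T := 2 * π) 2 (-n - 1) := by
      apply ext_fourierCoeff
      intro m
      rw [(HardyAnnulus.fourierCoeff_monomial A _ m).2, fourierCoeff_Lp_smul,
        fourierCoeff_fourierLp]
      by_cases hm : m = -n - 1 <;> simp [hm]
    rw [dualityCLM_apply, e1, e2, contourPairing_smul_left, contourPairing_smul_left,
      contourPairing_comm, contourPairing_comm A.R, contourPairing_fourierLp,
      contourPairing_fourierLp, show -(-n - 1) - 1 = n by ring, zpow_sub_one₀ hr,
      zpow_sub_one₀ hR] at h1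
    rw [← h1]
    field_simp
  have z1 : HardyDisk.bdry A.r h.fst = 0 := by
    apply ext_fourierCoeff
    intro n
    rw [← fourierCoeffCLM_apply, ← fourierCoeffCLM_apply, map_zero, fourierCoeffCLM_apply]
    rcases lt_or_ge n 0 with hn | hn
    · exact HardyDisk.fourierCoeff_bdry_of_neg _ hn
    · have := key n
      rw [HardyExterior.fourierCoeff_bdry_of_nonneg _ hn, mul_zero, add_zero] at this
      exact (mul_eq_zero.1 this).resolve_left (zpow_ne_zero _ hr)
  have z2 : HardyExterior.bdry A.R h.snd = 0 := by
    apply ext_fourierCoeff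
    intro n
    rw [← fourierCoeffCLM_apply, ← fourierCoeffCLM_apply, map_zero, fourierCoeffCLM_apply]
    rcases lt_or_ge n 0 with hn | hn
    · have := key n
      rw [HardyDisk.fourierCoeff_bdry_of_neg _ hn, mul_zero, zero_add] at this
      exact (mul_eq_zero.1 this).resolve_left (zpow_ne_zero _ hR)
    · exact HardyExterior.fourierCoeff_bdry_of_nonneg _ hn
  have w1 : h.fst = 0 := HardyDisk.bdry_injective A.r (by rw [z1, map_zero])
  have w2 : h.snd = 0 := HardyExterior.bdry_injective A.R (by rw [z2, map_zero])
  apply (WithLp.prodContinuousLinearEquiv 2 ℂ (HardyDisk A.r) (HardyExterior A.R)).injective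
  exact Prod.ext w1 w2

/-- A continuous linear functional on `L²` of a circle is a contour pairing. -/
lemma exists_contourPairing_eq {ρ : ℝ} (hρ : 0 < ρ) (l : L2Circle →L[ℂ] ℂ) :
    ∃ g : L2Circle, ∀ u, l u = contourPairing ρ u g := by
  -- with `w` from the Riesz representation theorem take `g = conj (w e^{iθ}) / ρ`
  set w : L2Circle := (InnerProductSpace.toDual ℂ L2Circle).symm l with hw
  have hm : MemLp (fun θ => (starRingEnd ℂ) (w θ * (toCircle θ : ℂ)) / ρ) 2 haarAddCircle := by
    refine MemLp.of_le_mul (c := ρ⁻¹) (Lp.memLp w) ?_ (ae_of_all _ fun θ => le_of_eq ?_)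
    · refine (Complex.continuous_conj.div_const (ρ : ℂ)).comp_aestronglyMeasurable
        ((Lp.aestronglyMeasurable w).mul ?_)
      exact (continuous_subtype_val.comp continuous_toCircle).aestronglyMeasurable
    · rw [norm_div, RCLike.norm_conj, norm_mul, Circle.norm_coe, mul_one, Complex.norm_real,
        Real.norm_of_nonneg hρ.le, div_eq_inv_mul]
  refine ⟨hm.toLp, fun u => ?_⟩
  have h1 : l u = inner ℂ w u := by
    rw [hw, InnerProductSpace.toDual_symm_apply]
  rw [h1, L2.inner_def, contourPairing]
  refine integral_congr_ae ?_
  filter_upwards [hm.coeFn_toLp] with θ h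
  have hc : (starRingEnd ℂ) (toCircle θ : ℂ) * (toCircle θ : ℂ) = 1 := by
    rw [Complex.conj_mul', Circle.norm_coe]
    simp
  have hρ' : (ρ : ℂ) ≠ 0 := by exact_mod_cast hρ.ne'
  rw [h, RCLike.inner_apply, circlePt, map_mul]
  calc u θ * (starRingEnd ℂ) (w θ)
      = u θ * (starRingEnd ℂ) (w θ) * ((starRingEnd ℂ) (toCircle θ : ℂ) * (toCircle θ : ℂ)) := by
        rw [hc, mul_one]
    _ = _ := by field_simp

/-- Every functional on `H²(A)` extends to the pairs of `L²` functions on the boundary circles, by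
the Hahn-Banach theorem; the Riesz projections of the representing functions are a preimage. -/
lemma dualityCLM_surjective (A : AnnulusRadii) : Function.Surjective (dualityCLM A) := by
  intro l
  set ι := HardyAnnulus.bdryLI A with hι
  let e := ι.equivRange
  obtain ⟨l', hl', -⟩ := exists_extension_norm_eq (LinearMap.range ι.toLinearMap)
    (l ∘L (e.symm : _ →L[ℂ] HardyAnnulus A))
  let E := WithLp.prodContinuousLinearEquiv 2 ℂ L2Circle L2Circle
  obtain ⟨g₁, hg₁⟩ := exists_contourPairing_eq A.r_pos
    (l' ∘L (E.symm : L2Circle × L2Circle →L[ℂ] WithLp 2 (L2Circle × L2Circle)) ∘L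
      ContinuousLinearMap.inl ℂ _ _)
  obtain ⟨g₂, hg₂⟩ := exists_contourPairing_eq A.R_pos
    (l' ∘L (E.symm : L2Circle × L2Circle →L[ℂ] WithLp 2 (L2Circle × L2Circle)) ∘L
      ContinuousLinearMap.inr ℂ _ _)
  have hl : ∀ f : HardyAnnulus A, l f = contourPairing A.r (HardyAnnulus.innerBdry A f) g₁ +
      contourPairing A.R (HardyAnnulus.outerBdry A f) g₂ := by
    intro f
    rw [← hg₁, ← hg₂]
    have h1 : l f = l' (ι f) := by
      have := hl' (e f)
      simp only [ContinuousLinearMap.comp_apply] at this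
      refine Eq.trans ?_ this.symm
      change l f = l (e.symm (e f))
      rw [e.symm_apply_apply]
    rw [h1]
    simp only [ContinuousLinearMap.comp_apply]
    rw [← map_add, ← map_add]
    congr 1
    apply E.injective
    refine Eq.trans ?_ (E.apply_symm_apply _).symm
    refine Prod.ext ?_ ?_
    · exact (add_zero _).symm
    · exact (zero_add _).symm
  refine ⟨(WithLp.prodContinuousLinearEquiv 2 ℂ (HardyDisk A.r) (HardyExterior A.R)).symm
    (rieszPlus A.r A.r le_rfl g₁ + rieszPlus A.R A.r A.r_lt_R.le g₂,
      rieszMinus A.r A.R A.r_lt_R.le g₁ + rieszMinus A.R A.R le_rfl g₂), ?_⟩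
  ext f
  rw [hl, contourPairing_inner f g₁, contourPairing_outer f g₂, dualityCLM_apply]
  change pairingCLM A.r _ (HardyDisk.bdry A.r (_ + _)) +
    pairingCLM A.R _ (HardyExterior.bdry A.R (_ + _)) = _
  rw [map_add, map_add, map_add, map_add]
  simp only [pairingCLM_apply]
  ring

instance (r : ℝ) [Fact (0 < r)] : CompleteSpace (HardyDisk r) := by
  rw [completeSpace_iff_isComplete_range (HardyDisk.bdryLI r).isometry.isUniformInducing]
  refine IsClosed.isComplete ?_
  have : range (HardyDisk.bdryLI r) = ⋂ n : ℤ, ⋂ _ : n < 0, {g | fourierCoeffCLM n g = 0} := by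
    ext g
    simp only [mem_iInter, mem_ofPred_eq]
    refine ⟨?_, fun h => ⟨rieszPlus r r le_rfl g, ?_⟩⟩
    · rintro ⟨h, rfl⟩ n hn
      exact HardyDisk.fourierCoeff_bdry_of_neg h hn
    · apply ext_fourierCoeff
      intro m
      refine (fourierCoeff_bdry_rieszPlus g m).trans ?_
      split_ifs with hm
      · rfl
      · exact (h m (not_le.1 hm)).symm
  rw [this]
  exact isClosed_iInter fun n => isClosed_iInter fun _ =>
    isClosed_eq (fourierCoeffCLM n).continuous continuous_const

instance (R : ℝ) [Fact (0 < R)] : CompleteSpace (HardyExterior R) := by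
  rw [completeSpace_iff_isComplete_range (HardyExterior.bdryLI R).isometry.isUniformInducing]
  refine IsClosed.isComplete ?_
  have : range (HardyExterior.bdryLI R) =
      ⋂ n : ℤ, ⋂ _ : 0 ≤ n, {g | fourierCoeffCLM n g = 0} := by
    ext g
    simp only [mem_iInter, mem_ofPred_eq]
    refine ⟨?_, fun h => ⟨rieszMinus R R le_rfl g, ?_⟩⟩
    · rintro ⟨h, rfl⟩ n hn
      exact HardyExterior.fourierCoeff_bdry_of_nonneg h hn
    · apply ext_fourierCoeff
      intro m
      refine (fourierCoeff_bdry_rieszMinus g m).trans ?_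
      split_ifs with hm
      · exact (h m hm).symm
      · rfl
  rw [this]
  exact isClosed_iInter fun n => isClosed_iInter fun _ =>
    isClosed_eq (fourierCoeffCLM n).continuous continuous_const

/-- The map `J` as an isomorphism, by the open mapping theorem. -/
def dualityEquiv (A : AnnulusRadii) : DualModel A ≃L[ℂ] StrongDual ℂ (HardyAnnulus A) :=
  ContinuousLinearEquiv.ofBijective (dualityCLM A)
    (LinearMap.ker_eq_bot.2 (dualityCLM_injective A))
    (LinearMap.range_eq_top.2 (dualityCLM_surjective A))

lemma dualityEquiv_apply {A : AnnulusRadii} (h : DualModel A) (f : HardyAnnulus A) :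
    dualityEquiv A h f =
      contourPairing A.r (HardyAnnulus.innerBdry A f) (HardyDisk.bdry A.r h.fst) +
      contourPairing A.R (HardyAnnulus.outerBdry A f) (HardyExterior.bdry A.R h.snd) := rfl

/-! ### Residues in an annulus -/

/-- Residue theorem in an annulus, for finitely many simple poles; the residue of `F` at `w` is the
limit of `(ζ - w) F(ζ)`. -/
lemma circleIntegral_sub_eq_sum_residues {a b s t : ℝ} (ha : 0 ≤ a) (hs : a < s) (hst : s < t)
    (ht : t < b) {c : ℂ → ℂ} (Z : Finset ℂ) (hZ : ∀ w ∈ Z, s < ‖w‖ ∧ ‖w‖ < t) {F : ℂ → ℂ}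
    (hF : DifferentiableOn ℂ F (annulusSet a b \ Z))
    (hc : ∀ w ∈ Z, Tendsto (fun ζ => (ζ - w) * F ζ) (𝓝[≠] w) (𝓝 (c w))) :
    ((∮ z in C(0, t), F z) - ∮ z in C(0, s), F z) = 2 * π * I * ∑ w ∈ Z, c w := by
  have hs0 : 0 < s := ha.trans_lt hs
  have ht0 : 0 < t := hs0.trans hst
  induction Z using Finset.induction_on generalizing F with
  | empty =>
    rw [Finset.sum_empty, mul_zero, sub_eq_zero]
    simp only [Finset.coe_empty, sdiff_empty] at hF
    have hsub : Metric.closedBall (0 : ℂ) t \ Metric.ball 0 s ⊆ annulusSet a b := by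
      intro z hz
      simp only [Set.mem_sdiff, Metric.mem_closedBall, dist_zero_right, Metric.mem_ball,
        not_lt] at hz
      exact ⟨hs.trans_le hz.2, hz.1.trans_lt ht⟩
    refine circleIntegral_eq_of_differentiable_on_annulus_off_countable hs0 hst.le
      countable_empty (hF.continuousOn.mono hsub) fun z hz => ?_
    refine (hF z (hsub ?_)).differentiableAt ((isOpen_annulusSet a b).mem_nhds (hsub ?_)) <;>
    · exact ⟨Metric.ball_subset_closedBall hz.1.1,
        fun h => hz.1.2 (Metric.ball_subset_closedBall h)⟩
  | insert w Z hwZ ih =>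
    have hw := hZ w (Finset.mem_insert_self w Z)
    -- subtract the principal part at `w` and remove the singularity
    set f : ℂ → ℂ := fun ζ => F ζ - c w * (ζ - w)⁻¹ with hf
    set G : ℂ → ℂ := Function.update f w (limUnder (𝓝[≠] w) f) with hG
    have hGf : ∀ ζ, ζ ≠ w → G ζ = F ζ - c w * (ζ - w)⁻¹ := fun ζ hζ => by
      rw [hG, Function.update_of_ne hζ]
    have hopen : IsOpen (annulusSet a b \ (Z : Set ℂ)) :=
      (isOpen_annulusSet a b).sdiff Z.finite_toSet.isClosed
    have hwS : w ∈ annulusSet a b \ (Z : Set ℂ) :=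
      ⟨⟨hs.trans hw.1, hw.2.trans ht⟩, by simpa using hwZ⟩
    have hGd : DifferentiableOn ℂ G (annulusSet a b \ (Z : Set ℂ)) := by
      refine Complex.differentiableOn_update_limUnder_of_isLittleO (hopen.mem_nhds hwS) ?_ ?_
      · refine (hF.mono fun z hz => ⟨hz.1.1, ?_⟩).sub fun z hz => ?_
        · simp only [Finset.coe_insert, mem_insert_iff, not_or]
          exact ⟨hz.2, hz.1.2⟩
        · have : z - w ≠ 0 := sub_ne_zero.2 hz.2
          exact (((differentiableAt_id.sub_const w).inv this).const_mul
            (c w)).differentiableWithinAt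
      · rw [Asymptotics.isLittleO_iff_tendsto']
        · have h1 : Tendsto (fun ζ => (ζ - w) * F ζ - c w - (ζ - w) * f w) (𝓝[≠] w)
              (𝓝 (c w - c w - 0 * f w)) := by
            refine ((hc w (Finset.mem_insert_self w Z)).sub_const _).sub (Tendsto.mul_const _ ?_)
            have : Tendsto (fun ζ : ℂ => ζ - w) (𝓝 w) (𝓝 (w - w)) := tendsto_id.sub_const w
            rw [sub_self] at this
            exact this.mono_left nhdsWithin_le_nhds
          simp only [sub_self, zero_mul] at h1
          refine h1.congr' ?_
          filter_upwards [self_mem_nhdsWithin] with ζ hζ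
          have : ζ - w ≠ 0 := sub_ne_zero.2 hζ
          simp only [hf]
          field_simp
        · filter_upwards [self_mem_nhdsWithin] with ζ hζ h0
          exact absurd (inv_eq_zero.1 h0) (sub_ne_zero.2 hζ)
    have hGc : ∀ v ∈ Z, Tendsto (fun ζ => (ζ - v) * G ζ) (𝓝[≠] v) (𝓝 (c v)) := by
      intro v hv
      have hvw : v ≠ w := fun h => hwZ (h ▸ hv)
      have h1 : Tendsto (fun ζ => (ζ - v) * (c w * (ζ - w)⁻¹)) (𝓝[≠] v) (𝓝 0) := by
        have : ContinuousAt (fun ζ => (ζ - v) * (c w * (ζ - w)⁻¹)) v :=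
          (continuousAt_id.sub continuousAt_const).mul (continuousAt_const.mul
            ((continuousAt_id.sub continuousAt_const).inv₀ (sub_ne_zero.2 hvw)))
        have h2 := this.tendsto
        simp only [sub_self, zero_mul] at h2
        exact h2.mono_left nhdsWithin_le_nhds
      have h3 := (hc v (Finset.mem_insert_of_mem hv)).sub h1
      rw [sub_zero] at h3
      refine h3.congr' ?_
      filter_upwards [mem_nhdsWithin_of_mem_nhds (isOpen_ne.mem_nhds hvw)] with ζ hζ
      rw [hGf ζ hζ]
      ring
    have key := ih (fun v hv => hZ v (Finset.mem_insert_of_mem hv)) hGd hGc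
    have hcircle : ∀ ρ, a < ρ → ρ < b → (∀ v ∈ insert w Z, ‖v‖ ≠ ρ) →
        (∮ z in C(0, ρ), G z) =
          (∮ z in C(0, ρ), F z) - c w * ∮ z in C(0, ρ), (z - w)⁻¹ := by
      intro ρ h1 h2 h3
      have hρ0 : 0 ≤ ρ := ha.trans h1.le
      have hne : ∀ z ∈ Metric.sphere (0 : ℂ) ρ, z ≠ w := by
        rintro z hz rfl
        exact h3 z (Finset.mem_insert_self _ _) (by simpa using hz)
      rw [circleIntegral.integral_congr hρ0 fun z hz => hGf z (hne z hz),
        circleIntegral.integral_sub, circleIntegral.integral_const_mul]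
      · refine (hF.continuousOn.mono fun z hz => ?_).circleIntegrable hρ0
        have hz' : ‖z‖ = ρ := by simpa using hz
        exact ⟨⟨by rwa [hz'], by rwa [hz']⟩, fun h => h3 z h hz'⟩
      · refine ContinuousOn.circleIntegrable hρ0 fun z hz => ?_
        exact (continuousAt_const.mul ((continuousAt_id.sub continuousAt_const).inv₀
          (sub_ne_zero.2 (hne z hz)))).continuousWithinAt
    have ht1 : (∮ z in C(0, t), (z - w)⁻¹) = 2 * π * I :=
      circleIntegral.integral_sub_inv_of_mem_ball (by simpa using hw.2)
    have hs1 : (∮ z in C(0, s), (z - w)⁻¹) = 0 := by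
      have hne : ∀ z ∈ Metric.closedBall (0 : ℂ) s, z - w ≠ 0 := by
        intro z hz h0
        rw [sub_eq_zero] at h0
        have : ‖z‖ ≤ s := by simpa using hz
        rw [h0] at this
        exact absurd hw.1 (not_lt.2 this)
      refine circleIntegral_eq_zero_of_differentiable_on_off_countable hs0.le countable_empty
        (fun z hz => ((continuousAt_id.sub continuousAt_const).inv₀
          (hne z hz)).continuousWithinAt) fun z hz => ?_
      exact (differentiableAt_id.sub_const w).inv (hne z (Metric.ball_subset_closedBall hz.1))
    rw [hcircle t (hs.trans hst) ht fun v hv => (hZ v hv).2.ne,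
      hcircle s hs (hst.trans ht) fun v hv => (hZ v hv).1.ne', ht1, hs1] at key
    rw [Finset.sum_insert hwZ, mul_add, ← key]
    ring

/-- The residue of the logarithmic derivative at a zero is the multiplicity `m` of the zero, and
`m = 1` only for simple zeros. -/
lemma exists_tendsto_logDeriv_zero {g : ℂ → ℂ} {w : ℂ} (hg : AnalyticAt ℂ g w) (h0 : g w = 0)
    (hne : ¬ ∀ᶠ z in 𝓝 w, g z = 0) :
    ∃ m : ℕ, 1 ≤ m ∧ (m = 1 → deriv g w ≠ 0) ∧
      Tendsto (fun ζ => (ζ - w) * (deriv g ζ / g ζ)) (𝓝[≠] w) (𝓝 (m : ℂ)) := by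
  obtain ⟨m, h, hh, hhw, heq⟩ := hg.exists_eventuallyEq_pow_smul_nonzero_iff.2 hne
  have hm : 1 ≤ m := by
    rw [Nat.one_le_iff_ne_zero]
    rintro rfl
    have := heq.self_of_nhds
    simp only [pow_zero, one_smul] at this
    exact hhw (this ▸ h0)
  obtain ⟨k, rfl⟩ : ∃ k, m = k + 1 := ⟨m - 1, by omega⟩
  have hder : ∀ᶠ z in 𝓝 w, deriv g z =
      (k + 1 : ℕ) * (z - w) ^ k * h z + (z - w) ^ (k + 1) * deriv h z := by
    filter_upwards [heq.eventually_nhds, hh.eventually_analyticAt] with z hz hhz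
    rw [EventuallyEq.deriv_eq hz]
    simp only [smul_eq_mul]
    have h1 : HasDerivAt (fun z => (z - w) ^ (k + 1)) ((k + 1 : ℕ) * (z - w) ^ k * 1) z :=
      ((hasDerivAt_id z).sub_const w).pow (k + 1)
    have h2 := h1.mul hhz.differentiableAt.hasDerivAt
    simp only [mul_one] at h2
    exact h2.deriv
  refine ⟨k + 1, hm, fun hk => ?_, ?_⟩
  · obtain rfl : k = 0 := by omega
    rw [hder.self_of_nhds]
    simpa using hhw
  · have h1 : Tendsto (fun ζ => ((k + 1 : ℕ) : ℂ) + (ζ - w) * (deriv h ζ / h ζ)) (𝓝[≠] w)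
        (𝓝 (((k + 1 : ℕ) : ℂ) + (w - w) * (deriv h w / h w))) := by
      have : ContinuousAt (fun ζ => ((k + 1 : ℕ) : ℂ) + (ζ - w) * (deriv h ζ / h ζ)) w :=
        continuousAt_const.add ((continuousAt_id.sub continuousAt_const).mul
          (hh.deriv.continuousAt.div hh.continuousAt hhw))
      exact this.tendsto.mono_left nhdsWithin_le_nhds
    rw [sub_self, zero_mul, add_zero] at h1
    refine h1.congr' ?_
    filter_upwards [mem_nhdsWithin_of_mem_nhds hder, mem_nhdsWithin_of_mem_nhds heq,
      mem_nhdsWithin_of_mem_nhds (hh.continuousAt.eventually_ne hhw), self_mem_nhdsWithin]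
      with ζ h2 h3 h4 h5
    have h6 : ζ - w ≠ 0 := sub_ne_zero.2 h5
    rw [h2, h3, smul_eq_mul]
    field_simp
    ring

/-- An analytic function which is not constant takes a value only finitely often on a compact
set. -/
lemma finite_fibre_of_isCompact {g : ℂ → ℂ} {U : Set ℂ} (hg : AnalyticOnNhd ℂ g U)
    (hU : IsPreconnected U) {K : Set ℂ} (hK : IsCompact K) (hKU : K ⊆ U) {z : ℂ}
    (hne : ∃ w ∈ U, g w ≠ z) : {w ∈ K | g w = z}.Finite := by
  by_contra hinf
  obtain ⟨x, hxK, hx⟩ := Set.Infinite.exists_accPt_of_subset_isCompact hinf hK (sep_subset _ _)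
  obtain ⟨w, hwU, hw⟩ := hne
  refine hw (hg.eqOn_of_preconnected_of_frequently_eq analyticOnNhd_const hU (hKU hxK) ?_ hwU)
  exact (accPt_iff_frequently_nhdsNE.1 hx).mono fun y hy => hy.2

/-! ### The expanding map in logarithmic coordinates -/

/-- The strip `{log r < Re w < log R}`, which `exp` maps onto the annulus. -/
def AnnulusRadii.strip (A : AnnulusRadii) : Set ℂ := re ⁻¹' Ioo (Real.log A.r) (Real.log A.R)

variable {A : AnnulusRadii}

lemma AnnulusRadii.isOpen_strip : IsOpen A.strip := isOpen_Ioo.preimage Complex.continuous_re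

lemma AnnulusRadii.convex_strip : Convex ℝ A.strip :=
  (convex_Ioo _ _).linear_preimage Complex.reLm

lemma AnnulusRadii.log_r_neg : Real.log A.r < 0 := Real.log_neg A.r_pos A.r_lt_one

lemma AnnulusRadii.log_R_pos : 0 < Real.log A.R := Real.log_pos A.one_lt_R

lemma AnnulusRadii.exp_mem {w : ℂ} : cexp w ∈ A.toSet ↔ w ∈ A.strip := by
  change A.r < ‖cexp w‖ ∧ ‖cexp w‖ < A.R ↔ Real.log A.r < w.re ∧ w.re < Real.log A.R
  rw [Complex.norm_exp, Real.log_lt_iff_lt_exp A.r_pos, Real.lt_log_iff_exp_lt A.R_pos]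

lemma AnnulusRadii.exists_exp_eq {z : ℂ} (hz : z ∈ A.toSet) : ∃ w ∈ A.strip, cexp w = z := by
  have hz0 : z ≠ 0 := norm_pos_iff.1 (A.r_pos.trans hz.1)
  refine ⟨Complex.log z, ?_, Complex.exp_log hz0⟩
  rw [← AnnulusRadii.exp_mem, Complex.exp_log hz0]
  exact hz

lemma AnnulusRadii.mem_strip_of_re_eq_zero {w : ℂ} (hw : w.re = 0) : w ∈ A.strip := by
  change Real.log A.r < w.re ∧ w.re < Real.log A.R
  rw [hw]
  exact ⟨A.log_r_neg, A.log_R_pos⟩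

lemma AnnulusRadii.add_mem_strip {w : ℂ} (hw : w ∈ A.strip) {v : ℂ} (hv : v.re = 0) :
    w + v ∈ A.strip := by
  change Real.log A.r < (w + v).re ∧ (w + v).re < Real.log A.R
  rw [Complex.add_re, hv, add_zero]
  exact hw

lemma AnnulusRadii.isPreconnected : IsPreconnected A.toSet := by
  have : A.toSet = cexp '' A.strip := by
    ext z
    refine ⟨fun hz => ?_, ?_⟩
    · obtain ⟨w, hw, rfl⟩ := AnnulusRadii.exists_exp_eq hz
      exact ⟨w, hw, rfl⟩
    · rintro ⟨w, hw, rfl⟩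
      exact AnnulusRadii.exp_mem.2 hw
  rw [this]
  exact A.convex_strip.isPreconnected.image _ Complex.continuous_exp.continuousOn

lemma AnnulusRadii.isOpen_toSet : IsOpen A.toSet := isOpen_annulusSet _ _

/-- A lift of `τ` to the strip: a holomorphic `T` with `e^{T(w)} = τ(e^w)`. -/
structure IsLift (τ : ℂ → ℂ) (A : AnnulusRadii) (T : ℂ → ℂ) : Prop where
  continuousOn : ContinuousOn T A.strip
  exp_eq : ∀ w ∈ A.strip, cexp (T w) = τ (cexp w)

variable {τ : ℂ → ℂ}

lemma exists_isLift (hA : A ∈ holomorphyAnnuli τ) : ∃ T, IsLift τ A T := by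
  have hsc : IsSimplyConnected A.strip := by
    have : ContractibleSpace A.strip := A.convex_strip.contractibleSpace
      ⟨0, AnnulusRadii.mem_strip_of_re_eq_zero rfl⟩
    change SimplyConnectedSpace A.strip
    infer_instance
  have hc : ContinuousOn (fun w => τ (cexp w)) A.strip :=
    hA.1.continuousOn.comp Complex.continuous_exp.continuousOn
      fun w hw => AnnulusRadii.exp_mem.2 hw
  obtain ⟨T, hT, hexp⟩ := Complex.exists_continuousOn_eqOn_exp_comp hsc A.isOpen_strip hc (by
    rintro ⟨w, hw, h0⟩
    exact hA.2 _ (AnnulusRadii.exp_mem.2 hw) h0)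
  exact ⟨T, hT, hexp⟩

namespace IsLift

variable {T : ℂ → ℂ}

lemma hasDerivAt (hT : IsLift τ A T) (hA : A ∈ holomorphyAnnuli τ) {w : ℂ} (hw : w ∈ A.strip) :
    HasDerivAt T (cexp w * deriv τ (cexp w) / τ (cexp w)) w := by
  have hmem := A.isOpen_strip.mem_nhds hw
  have hew := AnnulusRadii.exp_mem.2 hw
  have hne := hA.2 _ hew
  -- near `w` the continuous branch `T` is a translate of the principal branch of the logarithm
  have hTc : ContinuousAt T w := hT.continuousOn.continuousAt hmem
  have him : ∀ᶠ v in 𝓝 w, |(T v - T w).im| < π := by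
    have h1 : ContinuousAt (fun v => |(T v - T w).im|) w :=
      (Complex.continuous_im.continuousAt.comp (hTc.sub continuousAt_const)).abs
    have h2 := h1.tendsto
    simp only [sub_self, Complex.zero_im, abs_zero] at h2
    exact h2.eventually_lt_const Real.pi_pos
  have heq : T =ᶠ[𝓝 w] fun v => T w + Complex.log (τ (cexp v) / τ (cexp w)) := by
    filter_upwards [him, hmem] with v hv hvS
    rw [← hT.exp_eq v hvS, ← hT.exp_eq w hw, ← Complex.exp_sub, Complex.log_exp]
    · ring
    · exact (abs_lt.1 hv).1
    · exact (abs_lt.1 hv).2.le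
  have hτ : HasDerivAt τ (deriv τ (cexp w)) (cexp w) :=
    (hA.1.differentiableAt (A.isOpen_toSet.mem_nhds hew)).hasDerivAt
  have h1 : HasDerivAt (fun v => τ (cexp v) / τ (cexp w))
      (deriv τ (cexp w) * cexp w / τ (cexp w)) w :=
    (hτ.comp w (Complex.hasDerivAt_exp w)).div_const _
  have h2 := (h1.clog (by simp [div_self hne])).const_add (T w)
  refine (h2.congr_of_eventuallyEq heq).congr_deriv ?_
  rw [div_self hne, div_one, mul_comm]

lemma differentiableOn (hT : IsLift τ A T) (hA : A ∈ holomorphyAnnuli τ) :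
    DifferentiableOn ℂ T A.strip :=
  fun _ hw => (hT.hasDerivAt hA hw).differentiableAt.differentiableWithinAt

lemma re_eq (hT : IsLift τ A T) {w : ℂ} (hw : w ∈ A.strip) : ‖τ (cexp w)‖ = Real.exp (T w).re := by
  rw [← hT.exp_eq w hw, Complex.norm_exp]

/-- On the imaginary axis `T'` is real, as `T` maps this axis to itself, and greater than `1`. -/
lemma one_lt_deriv_re (hT : IsLift τ A T) (hτ : IsAnalyticExpanding τ)
    (hA : A ∈ holomorphyAnnuli τ) (y : ℝ) :
    1 < (cexp (y * I) * deriv τ (cexp (y * I)) / τ (cexp (y * I))).re := by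
  set q := cexp (y * I) * deriv τ (cexp (y * I)) / τ (cexp (y * I)) with hq
  have hmem : ∀ t : ℝ, cexp (t * I) ∈ Metric.sphere (0 : ℂ) 1 := fun t => by
    simp [Complex.norm_exp_ofReal_mul_I]
  have hstrip : ∀ t : ℝ, (t * I : ℂ) ∈ A.strip := fun t =>
    AnnulusRadii.mem_strip_of_re_eq_zero (by simp)
  have hpos : 0 < q.re := hτ.orientation _ (hmem y)
  have hn1 : ‖τ (cexp (y * I))‖ = 1 := by simpa using hτ.mapsTo (hmem y)
  have hnorm : 1 < ‖q‖ := by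
    rw [hq, norm_div, norm_mul, hn1, Complex.norm_exp_ofReal_mul_I, one_mul, div_one]
    exact hτ.expanding _ (hmem y)
  have him : q.im = 0 := by
    have hline : HasDerivAt (fun t : ℝ => (t : ℂ) * I) I y := by
      simpa using (Complex.ofRealCLM.hasDerivAt (x := y)).mul_const I
    have h1 : HasDerivAt (fun t : ℝ => T (t * I)) (q * I) y :=
      (hT.hasDerivAt hA (hstrip y)).comp y hline
    have h2 : HasDerivAt (fun t : ℝ => (T (t * I)).re) (q * I).re y :=
      Complex.reCLM.hasFDerivAt.comp_hasDerivAt y h1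
    have h3 : (fun t : ℝ => (T (t * I)).re) = fun _ => 0 := by
      funext t
      have h4 := hT.re_eq (hstrip t)
      have h5 : ‖τ (cexp (t * I))‖ = 1 := by simpa using hτ.mapsTo (hmem t)
      rw [h5] at h4
      exact (Real.exp_eq_one_iff _).1 h4.symm
    rw [h3] at h2
    have h6 := h2.unique (hasDerivAt_const y (0 : ℝ))
    simpa using h6
  have h7 : ‖q‖ = q.re := by
    rw [← Complex.re_add_im q, him]
    simp [abs_of_pos hpos]
  rwa [h7] at hnorm

/-- The lift commutes with the deck transformations up to the degree `K > 1` of `τ`. -/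
lemma exists_degree (hT : IsLift τ A T) (hτ : IsAnalyticExpanding τ)
    (hA : A ∈ holomorphyAnnuli τ) :
    ∃ K : ℕ, 1 < K ∧ ∀ w ∈ A.strip, T (w + 2 * π * I) = T w + K * (2 * π * I) := by
  have hre : (2 * π * I : ℂ).re = 0 := by simp
  have h0 : (0 : ℂ) ∈ A.strip := AnnulusRadii.mem_strip_of_re_eq_zero rfl
  have hd : ∀ w ∈ A.strip, HasDerivAt (fun w => T (w + 2 * π * I) - T w) 0 w := by
    intro w hw
    have h1 := (hT.hasDerivAt hA (AnnulusRadii.add_mem_strip hw hre)).comp_add_const w (2 * π * I)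
    have h2 := h1.sub (hT.hasDerivAt hA hw)
    rwa [Complex.exp_add, Complex.exp_two_pi_mul_I, mul_one, sub_self] at h2
  have hconst : ∀ w ∈ A.strip, T (w + 2 * π * I) - T w = T (0 + 2 * π * I) - T 0 := fun w hw =>
    A.isOpen_strip.is_const_of_deriv_eq_zero A.convex_strip.isPreconnected
      (fun v hv => (hd v hv).differentiableAt.differentiableWithinAt)
      (fun v hv => (hd v hv).deriv) hw h0
  obtain ⟨n, hn⟩ : ∃ n : ℤ, T (0 + 2 * π * I) = T 0 + n * (2 * π * I) := by
    rw [← Complex.exp_eq_exp_iff_exists_int, hT.exp_eq _ (AnnulusRadii.add_mem_strip h0 hre),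
      hT.exp_eq _ h0, Complex.exp_add, Complex.exp_two_pi_mul_I, mul_one]
  -- the mean value theorem on the imaginary axis gives `Im T(2πi) - Im T(0) > 2π`
  have hn1 : 1 < n := by
    have hder : ∀ y : ℝ, HasDerivAt (fun t : ℝ => (T (t * I)).im)
        (cexp (y * I) * deriv τ (cexp (y * I)) / τ (cexp (y * I))).re y := by
      intro y
      have hline : HasDerivAt (fun t : ℝ => (t : ℂ) * I) I y := by
        simpa using (Complex.ofRealCLM.hasDerivAt (x := y)).mul_const I
      have h1 := (hT.hasDerivAt hA (AnnulusRadii.mem_strip_of_re_eq_zero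
        (w := (y * I : ℂ)) (by simp))).comp y hline
      have h2 : HasDerivAt (fun t : ℝ => (T (t * I)).im) _ y :=
        Complex.imCLM.hasFDerivAt.comp_hasDerivAt y h1
      refine h2.congr_deriv ?_
      simp
    obtain ⟨ξ, -, hξ⟩ := exists_hasDerivAt_eq_slope (fun t : ℝ => (T (t * I)).im) _
      Real.two_pi_pos (fun y _ => (hder y).continuousAt.continuousWithinAt) fun y _ => hder y
    have h3 := hT.one_lt_deriv_re hτ hA ξ
    have h4 : (T (((2 * π : ℝ) : ℂ) * I)).im = (T 0).im + n * (2 * π) := by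
      have : ((2 * π : ℝ) : ℂ) * I = 0 + 2 * π * I := by push_cast; ring
      rw [this, hn]
      simp
    have h5 : T (((0 : ℝ) : ℂ) * I) = T 0 := by simp
    rw [hξ, h4, h5] at h3
    have h6 : ((T 0).im + n * (2 * π) - (T 0).im) / (2 * π - 0) = n := by
      field_simp [Real.pi_ne_zero]
      ring
    rw [h6] at h3
    exact_mod_cast h3
  lift n to ℕ using by omega
  refine ⟨n, by exact_mod_cast hn1, fun w hw => ?_⟩
  have := hconst w hw
  rw [hn] at this
  push_cast at this
  linear_combination this

/-- Just outside the unit circle `|τ| > 1`, and just inside it `|τ| < 1`. -/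
lemma exists_norm_near_one (hT : IsLift τ A T) (hτ : IsAnalyticExpanding τ)
    (hA : A ∈ holomorphyAnnuli τ) :
    (∃ z : ℂ, 1 < ‖z‖ ∧ ‖z‖ < A.R ∧ 1 < ‖τ z‖) ∧ ∃ z : ℂ, A.r < ‖z‖ ∧ ‖z‖ < 1 ∧ ‖τ z‖ < 1 := by
  have h0 : (0 : ℂ) ∈ A.strip := AnnulusRadii.mem_strip_of_re_eq_zero rfl
  have hder : HasDerivAt (fun t : ℝ => (T t).re)
      (cexp 0 * deriv τ (cexp 0) / τ (cexp 0)).re 0 := by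
    have h1 : HasDerivAt T (cexp 0 * deriv τ (cexp 0) / τ (cexp 0)) ((0 : ℝ) : ℂ) := by
      simpa using hT.hasDerivAt hA h0
    exact h1.real_of_complex
  have hpos : 0 < (cexp 0 * deriv τ (cexp 0) / τ (cexp 0)).re :=
    hτ.orientation _ (by simp)
  have hT0 : (T ((0 : ℝ) : ℂ)).re = 0 := by
    have h4 := hT.re_eq h0
    have h5 : ‖τ (cexp 0)‖ = 1 := by simpa using hτ.mapsTo (x := cexp 0) (by simp)
    rw [h5] at h4
    simpa using (Real.exp_eq_one_iff _).1 h4.symm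
  have hslope := (hasDerivAt_iff_tendsto_slope.1 hder).eventually_const_lt hpos
  have hslope' : ∀ᶠ t : ℝ in 𝓝 0, t ≠ 0 → 0 < slope (fun t : ℝ => (T t).re) 0 t :=
    eventually_nhdsWithin_iff.1 hslope
  have hstrip : ∀ᶠ t : ℝ in 𝓝 0, t ∈ Ioo (Real.log A.r) (Real.log A.R) :=
    Ioo_mem_nhds A.log_r_neg A.log_R_pos
  obtain ⟨ε, hε, hball⟩ := Metric.eventually_nhds_iff.1 (hslope'.and hstrip)
  have key : ∀ t : ℝ, |t| < ε → t ≠ 0 →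
      0 < (T t).re / t ∧ t ∈ Ioo (Real.log A.r) (Real.log A.R) ∧
        ‖τ (cexp t)‖ = Real.exp (T t).re := by
    intro t ht ht0
    obtain ⟨h1, h2⟩ := hball (y := t) (by simpa using ht)
    have h3 := h1 ht0
    rw [slope_def_field, hT0, sub_zero, sub_zero] at h3
    exact ⟨h3, h2, hT.re_eq (w := t) h2⟩
  constructor
  · obtain ⟨h1, h2, h3⟩ := key (ε / 2) (by rw [abs_of_pos (by positivity)]; linarith)
      (by positivity)
    refine ⟨cexp ((ε / 2 : ℝ) : ℂ), ?_, ?_, ?_⟩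
    · rw [Complex.norm_exp, Complex.ofReal_re, Real.one_lt_exp_iff]
      positivity
    · exact (AnnulusRadii.exp_mem.2 (by simpa [AnnulusRadii.strip] using h2)).2
    · rw [h3, Real.one_lt_exp_iff]
      exact (div_pos_iff_of_pos_right (by positivity)).1 h1
  · obtain ⟨h1, h2, h3⟩ := key (-(ε / 2)) (by rw [abs_neg, abs_of_pos (by positivity)]; linarith)
      (by simpa using hε.ne')
    refine ⟨cexp ((-(ε / 2) : ℝ) : ℂ), ?_, ?_, ?_⟩
    · exact (AnnulusRadii.exp_mem.2 (by simpa [AnnulusRadii.strip] using h2)).1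
    · rw [Complex.norm_exp, Complex.ofReal_re, Real.exp_lt_one_iff]
      linarith
    · rw [h3, Real.exp_lt_one_iff]
      rw [div_neg, neg_pos] at h1
      simpa using (div_lt_iff₀ (by positivity)).1 h1

end IsLift

/-! ### Boundary behaviour of the expanding map -/

lemma AnnulusRadii.closure_toSet : closure A.toSet = {z | A.r ≤ ‖z‖ ∧ ‖z‖ ≤ A.R} := by
  apply subset_antisymm
  · refine closure_minimal (fun z hz => ⟨hz.1.le, hz.2.le⟩) ?_
    exact (isClosed_le continuous_const continuous_norm).inter
      (isClosed_le continuous_norm continuous_const)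
  · intro z hz
    have hz0 : z ≠ 0 := norm_pos_iff.1 (A.r_pos.trans_le hz.1)
    have h1 : Complex.log z ∈ closure A.strip := by
      rw [AnnulusRadii.strip, Complex.closure_preimage_re,
        closure_Ioo (A.log_r_neg.trans A.log_R_pos).ne]
      change (Complex.log z).re ∈ Icc _ _
      rw [Complex.log_re]
      exact ⟨Real.log_le_log A.r_pos hz.1, Real.log_le_log (norm_pos_iff.2 hz0) hz.2⟩
    have h2 : cexp '' A.strip ⊆ A.toSet := by
      rintro _ ⟨w, hw, rfl⟩
      exact AnnulusRadii.exp_mem.2 hw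
    rw [← Complex.exp_log hz0]
    exact closure_mono h2 (image_closure_subset_closure_image Complex.continuous_exp ⟨_, h1, rfl⟩)

lemma AnnulusRadii.isCompact_closure : IsCompact (closure A.toSet) := by
  refine (isCompact_closedBall (0 : ℂ) A.R).of_isClosed_subset isClosed_closure fun z hz => ?_
  rw [AnnulusRadii.closure_toSet] at hz
  simpa using hz.2

lemma AnnulusRadii.mem_frontier {z : ℂ} (hz : ‖z‖ = A.r ∨ ‖z‖ = A.R) : z ∈ frontier A.toSet := by
  rw [frontier, A.isOpen_toSet.interior_eq, AnnulusRadii.closure_toSet]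
  rcases hz with h | h
  · exact ⟨⟨h.ge, h.trans_le A.r_lt_R.le⟩, fun hm => hm.1.ne' h⟩
  · exact ⟨⟨A.r_lt_R.le.trans h.ge, h.le⟩, fun hm => hm.2.ne h⟩

/-- On a boundary circle of `A`, the values of `|τ|` lie on one side of `[r, R]`. -/
lemma norm_lt_or_gt_of_boundary (hA : IsSuitableAnnulus τ A) {ρ : ℝ} (hρ : ρ = A.r ∨ ρ = A.R) :
    (∀ z, ‖z‖ = ρ → ‖τ z‖ < A.r) ∨ ∀ z, ‖z‖ = ρ → A.R < ‖τ z‖ := by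
  have hfr : ∀ z : ℂ, ‖z‖ = ρ → z ∈ frontier A.toSet := fun z hz =>
    AnnulusRadii.mem_frontier (by rwa [hz])
  have hout : ∀ z, ‖z‖ = ρ → ‖τ z‖ < A.r ∨ A.R < ‖τ z‖ := by
    intro z hz
    by_contra h
    rw [not_or, not_lt, not_lt] at h
    have : τ z ∈ τ '' frontier A.toSet ∩ closure A.toSet :=
      ⟨⟨z, hfr z hz, rfl⟩, by rw [AnnulusRadii.closure_toSet]; exact h⟩
    rw [hA.boundary] at this
    exact this
  have hc : ContinuousOn (fun z => ‖τ z‖) (Metric.sphere 0 ρ) :=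
    (hA.continuousOn.mono fun z hz => frontier_subset_closure (hfr z (by simpa using hz))).norm
  have hpre : IsPreconnected ((fun z => ‖τ z‖) '' Metric.sphere 0 ρ) :=
    (isPreconnected_sphere (by rw [Complex.rank_real_complex]; norm_num) 0 ρ).image _ hc
  by_contra! h
  obtain ⟨⟨z₁, hz₁, h₁⟩, z₂, hz₂, h₂⟩ := h
  have h₁' := (hout z₁ hz₁).resolve_left (not_lt.2 h₁)
  have h₂' := (hout z₂ hz₂).resolve_right (not_lt.2 h₂)
  obtain ⟨z₃, hz₃, h₃⟩ := hpre.ordConnected.out (x := ‖τ z₂‖) (y := ‖τ z₁‖)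
    ⟨z₂, by simpa using hz₂, rfl⟩ ⟨z₁, by simpa using hz₁, rfl⟩
    (⟨h₂'.le.trans A.r_lt_R.le, h₁'.le⟩ : A.R ∈ Icc _ _)
  simp only at h₃
  rcases hout z₃ (by simpa using hz₃) with h | h
  · exact absurd (h₃ ▸ h) (not_lt.2 A.r_lt_R.le)
  · exact absurd h₃.symm h.ne

lemma closure_annulusSet_subset (a b : ℝ) : closure (annulusSet a b) ⊆ {z | a ≤ ‖z‖ ∧ ‖z‖ ≤ b} :=
  closure_minimal (fun _ hz => ⟨hz.1.le, hz.2.le⟩)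
    ((isClosed_le continuous_const continuous_norm).inter
      (isClosed_le continuous_norm continuous_const))

lemma norm_eq_of_mem_frontier {a b : ℝ} {z : ℂ} (hz : z ∈ frontier (annulusSet a b)) :
    ‖z‖ = a ∨ ‖z‖ = b := by
  rw [frontier, (isOpen_annulusSet a b).interior_eq] at hz
  obtain ⟨h1, h2⟩ := closure_annulusSet_subset a b hz.1
  by_contra h
  rw [not_or] at h
  exact hz.2 ⟨lt_of_le_of_ne h1 (Ne.symm h.1), lt_of_le_of_ne h2 h.2⟩

lemma isBounded_annulusSet (a b : ℝ) : Bornology.IsBounded (annulusSet a b) :=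
  (Metric.isBounded_ball (x := (0 : ℂ)) (r := b)).subset fun z hz => by simpa using hz.2

/-- `τ` maps the outer boundary circle into `{|z| > R}`: otherwise the maximum principle on
`{1 < |z| < R}` would give `|τ| ≤ 1` there. -/
lemma norm_gt_of_outer (hτ : IsAnalyticExpanding τ) (hA : IsSuitableAnnulus τ A) :
    ∀ z, ‖z‖ = A.R → A.R < ‖τ z‖ := by
  refine (norm_lt_or_gt_of_boundary hA (Or.inr rfl)).resolve_left fun hlt => ?_
  obtain ⟨T, hT⟩ := exists_isLift hA.mem
  obtain ⟨z, hz1, hzR, hz⟩ := (hT.exists_norm_near_one hτ hA.mem).1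
  have hd : DiffContOnCl ℂ τ (annulusSet 1 A.R) := by
    refine ⟨hA.mem.1.mono fun w hw => ⟨A.r_lt_one.trans hw.1, hw.2⟩,
      hA.continuousOn.mono fun w hw => ?_⟩
    rw [AnnulusRadii.closure_toSet]
    have := closure_annulusSet_subset _ _ hw
    exact ⟨A.r_lt_one.le.trans this.1, this.2⟩
  have := Complex.norm_le_of_forall_mem_frontier_norm_le (isBounded_annulusSet 1 A.R) hd (C := 1)
    (fun w hw => ?_) (subset_closure (⟨hz1, hzR⟩ : z ∈ annulusSet 1 A.R))
  · exact absurd hz (not_lt.2 this)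
  · rcases norm_eq_of_mem_frontier hw with h | h
    · have : ‖τ w‖ = 1 := by simpa using hτ.mapsTo (x := w) (by simpa using h)
      exact this.le
    · exact (hlt w h).le.trans A.r_lt_one.le

/-- `τ` maps the inner boundary circle into `{|z| < r}`: otherwise the maximum principle for `1/τ`
on `{r < |z| < 1}` would give `|τ| ≥ 1` there. -/
lemma norm_lt_of_inner (hτ : IsAnalyticExpanding τ) (hA : IsSuitableAnnulus τ A) :
    ∀ z, ‖z‖ = A.r → ‖τ z‖ < A.r := by
  refine (norm_lt_or_gt_of_boundary hA (Or.inl rfl)).resolve_right fun hgt => ?_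
  obtain ⟨T, hT⟩ := exists_isLift hA.mem
  obtain ⟨z, hzr, hz1, hz⟩ := (hT.exists_norm_near_one hτ hA.mem).2
  have hcl : closure (annulusSet A.r 1) ⊆ closure A.toSet := by
    refine closure_mono fun w hw => ⟨hw.1, hw.2.trans A.one_lt_R⟩
  have hne : ∀ w ∈ closure (annulusSet A.r 1), τ w ≠ 0 := by
    intro w hw
    obtain ⟨h1, h2⟩ := closure_annulusSet_subset _ _ hw
    rcases h1.eq_or_lt with h | h
    · exact norm_pos_iff.1 (A.R_pos.trans (hgt w h.symm))
    · exact hA.mem.2 w ⟨h, h2.trans_lt A.one_lt_R⟩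
  have hd : DiffContOnCl ℂ (fun w => (τ w)⁻¹) (annulusSet A.r 1) := by
    refine ⟨?_, (hA.continuousOn.mono hcl).inv₀ hne⟩
    exact (hA.mem.1.mono fun w hw => ⟨hw.1, hw.2.trans A.one_lt_R⟩).inv
      fun w hw => hne w (subset_closure hw)
  have := Complex.norm_le_of_forall_mem_frontier_norm_le (isBounded_annulusSet A.r 1) hd (C := 1)
    (fun w hw => ?_) (subset_closure (⟨hzr, hz1⟩ : z ∈ annulusSet A.r 1))
  · have hpos : 0 < ‖τ z‖ := norm_pos_iff.2 (hne z (subset_closure ⟨hzr, hz1⟩))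
    rw [norm_inv] at this
    exact absurd ((inv_le_one₀ hpos).1 this) (not_le.2 hz)
  · rw [norm_inv]
    rcases norm_eq_of_mem_frontier hw with h | h
    · exact inv_le_one_of_one_le₀ (A.one_lt_R.le.trans (hgt w h).le)
    · have : ‖τ w‖ = 1 := by simpa using hτ.mapsTo (x := w) (by simpa using h)
      rw [this, inv_one]

/-- Near the outer boundary circle `|τ| > R`. -/
lemma exists_outer_radius (hτ : IsAnalyticExpanding τ) (hA : IsSuitableAnnulus τ A) :
    ∃ R' ∈ Ioo 1 A.R, ∀ z, R' ≤ ‖z‖ → ‖z‖ ≤ A.R → A.R < ‖τ z‖ := by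
  have hK : IsCompact (closure A.toSet ∩ (fun z => ‖τ z‖) ⁻¹' Iic A.R) :=
    A.isCompact_closure.of_isClosed_subset
      (hA.continuousOn.norm.preimage_isClosed_of_isClosed isClosed_closure isClosed_Iic)
      inter_subset_left
  have h1 : (1 : ℂ) ∈ closure A.toSet ∩ (fun z => ‖τ z‖) ⁻¹' Iic A.R := by
    refine ⟨subset_closure ⟨by simpa using A.r_lt_one, by simpa using A.one_lt_R⟩, ?_⟩
    have : ‖τ 1‖ = 1 := by simpa using hτ.mapsTo (x := 1) (by simp)
    change ‖τ 1‖ ≤ A.R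
    rw [this]
    exact A.one_lt_R.le
  obtain ⟨z₀, hz₀, hmax⟩ := hK.exists_isMaxOn ⟨1, h1⟩ continuous_norm.continuousOn
  have hz₀' := hz₀.1
  rw [AnnulusRadii.closure_toSet] at hz₀'
  have hlt : ‖z₀‖ < A.R := lt_of_le_of_ne hz₀'.2 fun h =>
    absurd hz₀.2 (not_le.2 (norm_gt_of_outer hτ hA z₀ h))
  have h1' : 1 ≤ ‖z₀‖ := by simpa using hmax h1
  refine ⟨(‖z₀‖ + A.R) / 2, ⟨by linarith [A.one_lt_R], by linarith⟩, fun z hz hzR => ?_⟩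
  by_contra h
  have hzK : z ∈ closure A.toSet ∩ (fun z => ‖τ z‖) ⁻¹' Iic A.R := by
    refine ⟨?_, not_lt.1 h⟩
    rw [AnnulusRadii.closure_toSet]
    exact ⟨by linarith [A.r_lt_one], hzR⟩
  have : ‖z‖ ≤ ‖z₀‖ := hmax hzK
  linarith

/-- Near the inner boundary circle `|τ| < r`. -/
lemma exists_inner_radius (hτ : IsAnalyticExpanding τ) (hA : IsSuitableAnnulus τ A) :
    ∃ r' ∈ Ioo A.r 1, ∀ z, A.r ≤ ‖z‖ → ‖z‖ ≤ r' → ‖τ z‖ < A.r := by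
  have hK : IsCompact (closure A.toSet ∩ (fun z => ‖τ z‖) ⁻¹' Ici A.r) :=
    A.isCompact_closure.of_isClosed_subset
      (hA.continuousOn.norm.preimage_isClosed_of_isClosed isClosed_closure isClosed_Ici)
      inter_subset_left
  have h1 : (1 : ℂ) ∈ closure A.toSet ∩ (fun z => ‖τ z‖) ⁻¹' Ici A.r := by
    refine ⟨subset_closure ⟨by simpa using A.r_lt_one, by simpa using A.one_lt_R⟩, ?_⟩
    have : ‖τ 1‖ = 1 := by simpa using hτ.mapsTo (x := 1) (by simp)
    change A.r ≤ ‖τ 1‖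
    rw [this]
    exact A.r_lt_one.le
  obtain ⟨z₀, hz₀, hmin⟩ := hK.exists_isMinOn ⟨1, h1⟩ continuous_norm.continuousOn
  have hz₀' := hz₀.1
  rw [AnnulusRadii.closure_toSet] at hz₀'
  have hlt : A.r < ‖z₀‖ := lt_of_le_of_ne hz₀'.1 fun h =>
    absurd hz₀.2 (not_le.2 (norm_lt_of_inner hτ hA z₀ h.symm))
  have h1' : ‖z₀‖ ≤ 1 := by simpa using hmin h1
  refine ⟨(‖z₀‖ + A.r) / 2, ⟨by linarith, by linarith [A.r_lt_one]⟩, fun z hzr hz => ?_⟩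
  by_contra h
  have hzK : z ∈ closure A.toSet ∩ (fun z => ‖τ z‖) ⁻¹' Ici A.r := by
    refine ⟨?_, not_lt.1 h⟩
    rw [AnnulusRadii.closure_toSet]
    exact ⟨hzr, by linarith [A.one_lt_R]⟩
  have : ‖z₀‖ ≤ ‖z‖ := hmin hzK
  linarith

/-! ### Counting preimages -/

lemma map_add_int_mul_of_map_add {T : ℂ → ℂ} {K : ℕ}
    (hK : ∀ w ∈ A.strip, T (w + 2 * π * I) = T w + K * (2 * π * I)) (n : ℤ) :
    ∀ w ∈ A.strip, T (w + n * (2 * π * I)) = T w + n * (K * (2 * π * I)) := by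
  have hnat : ∀ (n : ℕ), ∀ w ∈ A.strip,
      T (w + n * (2 * π * I)) = T w + n * (K * (2 * π * I)) := by
    intro n
    induction n with
    | zero => intro w _; simp
    | succ n ih =>
      intro w hw
      have h1 := hK (w + n * (2 * π * I)) (AnnulusRadii.add_mem_strip hw (by simp))
      rw [ih w hw] at h1
      rw [show w + ((n + 1 : ℕ) : ℂ) * (2 * π * I) = w + n * (2 * π * I) + 2 * π * I by
        push_cast; ring, h1]
      push_cast
      ring
  intro w hw
  rcases Int.eq_nat_or_neg n with ⟨k, rfl | rfl⟩
  · exact_mod_cast hnat k w hw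
  · have h1 := hnat k (w + (-(k : ℤ) : ℤ) * (2 * π * I))
      (AnnulusRadii.add_mem_strip hw (by simp))
    rw [show w + (-(k : ℤ) : ℤ) * (2 * π * I) + k * (2 * π * I) = w by push_cast; ring] at h1
    rw [h1]
    push_cast
    ring

open scoped Pointwise in
/-- The lift takes every value in the strip. The image of the strip is open by the open mapping
theorem, and its part in the strip is closed as `|τ|` is outside `[r, R]` near `∂A`. -/
lemma IsLift.surjOn {T : ℂ → ℂ} (hT : IsLift τ A T) (hτ : IsAnalyticExpanding τ)
    (hA : IsSuitableAnnulus τ A) : A.strip ⊆ T '' A.strip := by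
  obtain ⟨K, hK1, hK⟩ := hT.exists_degree hτ hA.mem
  obtain ⟨R', hR', hRτ⟩ := exists_outer_radius hτ hA
  obtain ⟨r', hr', hrτ⟩ := exists_inner_radius hτ hA
  have hr'0 : 0 < r' := A.r_pos.trans hr'.1
  have hR'0 : 0 < R' := one_pos.trans hR'.1
  have hre : (2 * π * I : ℂ).re = 0 := by simp
  have h0 : (0 : ℂ) ∈ A.strip := AnnulusRadii.mem_strip_of_re_eq_zero rfl
  have hKI : (K * (2 * π * I) : ℂ) ≠ 0 :=
    mul_ne_zero (by exact_mod_cast (zero_lt_one.trans hK1).ne') Complex.two_pi_I_ne_zero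
  have hopen : IsOpen (T '' A.strip) := by
    refine (((hT.differentiableOn hA.mem).analyticOnNhd A.isOpen_strip).is_constant_or_isOpen
      A.convex_strip.isPreconnected).resolve_left ?_ _ subset_rfl A.isOpen_strip
    rintro ⟨w, hw⟩
    have h1 := hK 0 h0
    rw [hw _ (AnnulusRadii.add_mem_strip h0 hre), hw 0 h0] at h1
    exact hKI (by linear_combination -h1)
  have hKint := map_add_int_mul_of_map_add hK
  -- `T(S) ∩ S` lies in a closed set: the image of a compact fundamental domain of the deck
  -- transformations plus a discrete group
  set C : Set ℂ := Icc (Real.log r') (Real.log R') ×ℂ Icc 0 (2 * π) with hC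
  have hCS : C ⊆ A.strip := fun w hw =>
    ⟨(Real.log_lt_log A.r_pos hr'.1).trans_le hw.1.1,
      hw.1.2.trans_lt (Real.log_lt_log hR'0 hR'.2)⟩
  have hCc : IsCompact C := isCompact_Icc.reProdIm isCompact_Icc
  set Λ : Set ℂ := {z | z / (K * (2 * π * I)) ∈ range ((↑) : ℤ → ℂ)} with hΛ
  have hΛc : IsClosed Λ :=
    Complex.isClosed_range_intCast.preimage (continuous_id.div_const _)
  have hY : IsClosed (T '' C + Λ) :=
    hΛc.add_left_of_isCompact (hCc.image_of_continuousOn (hT.continuousOn.mono hCS))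
  have hYT : T '' C + Λ ⊆ T '' A.strip := by
    rintro _ ⟨_, ⟨w, hw, rfl⟩, v, ⟨n, hn⟩, rfl⟩
    refine ⟨w + n * (2 * π * I), AnnulusRadii.add_mem_strip (hCS hw) (by simp), ?_⟩
    rw [hKint n w (hCS hw), hn, div_mul_cancel₀ _ hKI]
  have hTY : T '' A.strip ∩ A.strip ⊆ T '' C + Λ := by
    rintro _ ⟨⟨w, hw, rfl⟩, hTw⟩
    have h1 := hT.re_eq hw
    have h2 : A.r < ‖τ (cexp w)‖ ∧ ‖τ (cexp w)‖ < A.R := by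
      rw [← hT.exp_eq w hw]
      exact AnnulusRadii.exp_mem.2 hTw
    have h3 := AnnulusRadii.exp_mem.2 hw
    have h4 : r' < ‖cexp w‖ := by
      by_contra h
      exact absurd h2.1 (not_lt.2 (hrτ _ h3.1.le (not_lt.1 h)).le)
    have h5 : ‖cexp w‖ < R' := by
      by_contra h
      exact absurd h2.2 (not_lt.2 (hRτ _ (not_lt.1 h) h3.2.le).le)
    rw [Complex.norm_exp] at h4 h5
    set n : ℤ := ⌊w.im / (2 * π)⌋ with hn
    have hn1 : (n : ℝ) * (2 * π) ≤ w.im := (le_div_iff₀ Real.two_pi_pos).1 (Int.floor_le _)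
    have hn2 : w.im < (n + 1 : ℝ) * (2 * π) :=
      (div_lt_iff₀ Real.two_pi_pos).1 (Int.lt_floor_add_one _)
    have hv : w + (-n : ℤ) * (2 * π * I) ∈ C := by
      refine ⟨⟨?_, ?_⟩, ?_, ?_⟩
      · simpa using (Real.log_le_iff_le_exp hr'0).2 h4.le
      · simpa using (Real.le_log_iff_exp_le hR'0).2 h5.le
      · simpa using hn1
      · have : w.im + -(n * (2 * π)) ≤ 2 * π := by linarith
        simpa using this
    refine ⟨_, ⟨_, hv, rfl⟩, n * (K * (2 * π * I)), ⟨n, ?_⟩, ?_⟩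
    · rw [mul_div_assoc, div_self hKI, mul_one]
    · change T (w + (-n : ℤ) * (2 * π * I)) + n * (K * (2 * π * I)) = T w
      rw [hKint (-n) w hw]
      push_cast
      ring
  refine A.convex_strip.isPreconnected.subset_of_closure_inter_subset hopen ?_ ?_
  · refine ⟨T 0, AnnulusRadii.mem_strip_of_re_eq_zero ?_, ⟨0, h0, rfl⟩⟩
    have h4 := hT.re_eq h0
    have h5 : ‖τ (cexp 0)‖ = 1 := by simpa using hτ.mapsTo (x := cexp 0) (by simp)
    rw [h5] at h4
    exact (Real.exp_eq_one_iff _).1 h4.symm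
  · refine Subset.trans ?_ hYT
    refine (IsOpen.closure_inter A.isOpen_strip).trans ?_
    exact closure_minimal hTY hY

lemma circleIntegrable_of_holomorphic {f g : ℂ → ℂ} (hf : ContinuousOn f A.toSet)
    (hg : ContinuousOn g A.toSet) {ρ : ℝ} (hρ : ρ ∈ Ioo A.r A.R)
    (hne : ∀ w : ℂ, ‖w‖ = ρ → g w ≠ 0) : CircleIntegrable (fun w => f w / g w) 0 ρ := by
  have hsub : Metric.sphere (0 : ℂ) ρ ⊆ A.toSet := sphere_subset_of_Ioo hρ
  exact ((hf.mono hsub).div (hg.mono hsub) fun w hw =>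
    hne w (by simpa using hw)).circleIntegrable (A.r_pos.trans hρ.1).le

/-- If `|τ| > |z|` on a circle, then `τ` winds around `z` as often as around `0`. -/
lemma IsLift.circleIntegral_logDeriv_outer {T : ℂ → ℂ} (hT : IsLift τ A T)
    (hA : A ∈ holomorphyAnnuli τ) {K : ℕ}
    (hK : ∀ w ∈ A.strip, T (w + 2 * π * I) = T w + K * (2 * π * I)) {ρ : ℝ}
    (hρ : ρ ∈ Ioo A.r A.R) {z : ℂ} (hz : ∀ w : ℂ, ‖w‖ = ρ → ‖z‖ < ‖τ w‖) :
    (∮ w in C(0, ρ), deriv τ w / (τ w - z)) = K * (2 * π * I) := by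
  have hρ0 : 0 < ρ := A.r_pos.trans hρ.1
  have hnorm : ∀ y : ℝ, ‖circleMap 0 ρ y‖ = ρ := fun y => by simp [abs_of_pos hρ0]
  have hmem : ∀ y : ℝ, circleMap 0 ρ y ∈ A.toSet := fun y =>
    ⟨by rw [hnorm]; exact hρ.1, by rw [hnorm]; exact hρ.2⟩
  have hne : ∀ w : ℂ, ‖w‖ = ρ → τ w - z ≠ 0 := by
    intro w hw h0
    rw [sub_eq_zero] at h0
    exact (hz w hw).ne (by rw [h0])
  have hexp : ∀ y : ℝ, cexp ((Real.log ρ : ℂ) + y * I) = circleMap 0 ρ y := by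
    intro y
    rw [Complex.exp_add, ← Complex.ofReal_exp, Real.exp_log hρ0, circleMap, zero_add]
  have hstrip : ∀ y : ℝ, (Real.log ρ : ℂ) + y * I ∈ A.strip := fun y => by
    rw [← AnnulusRadii.exp_mem, hexp]
    exact hmem y
  -- a primitive along the circle is `T + log (1 - z / τ)`
  have hder : ∀ y : ℝ, HasDerivAt (fun t : ℝ => T ((Real.log ρ : ℂ) + t * I) +
      Complex.log (1 - z / τ (circleMap 0 ρ t)))
      (deriv (circleMap 0 ρ) y • (deriv τ (circleMap 0 ρ y) / (τ (circleMap 0 ρ y) - z))) y := by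
    intro y
    have hline : HasDerivAt (fun t : ℝ => (Real.log ρ : ℂ) + (t : ℂ) * I) I y := by
      simpa using ((Complex.ofRealCLM.hasDerivAt (x := y)).mul_const I).const_add
        (Real.log ρ : ℂ)
    have h1 := (hT.hasDerivAt hA (hstrip y)).comp y hline
    have hτ0 : τ (circleMap 0 ρ y) ≠ 0 := hA.2 _ (hmem y)
    have hτd : HasDerivAt τ (deriv τ (circleMap 0 ρ y)) (circleMap 0 ρ y) :=
      (hA.1.differentiableAt (A.isOpen_toSet.mem_nhds (hmem y))).hasDerivAt
    have h2 : HasDerivAt (fun t : ℝ => τ (circleMap 0 ρ t))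
        (deriv τ (circleMap 0 ρ y) * (circleMap 0 ρ y * I)) y :=
      hτd.comp y (hasDerivAt_circleMap 0 ρ y)
    have h3 := ((hasDerivAt_const y z).div h2 hτ0).const_sub 1
    have hsl : 1 - z / τ (circleMap 0 ρ y) ∈ Complex.slitPlane := by
      refine Complex.mem_slitPlane_of_norm_lt_one (z := -(z / τ (circleMap 0 ρ y))) ?_
      rw [norm_neg, norm_div, div_lt_one (norm_pos_iff.2 hτ0)]
      exact hz _ (hnorm y)
    have h4 := h1.add (h3.clog_real hsl)
    refine h4.congr_deriv ?_
    have h5 := hne _ (hnorm y)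
    have h6 : (1 : ℂ) - z / τ (circleMap 0 ρ y) ≠ 0 := Complex.slitPlane_ne_zero hsl
    have h7 : (1 : ℂ) - z / τ (circleMap 0 ρ y) =
        (τ (circleMap 0 ρ y) - z) / τ (circleMap 0 ρ y) := by field_simp
    simp only [Pi.div_apply]
    rw [hexp, deriv_circleMap, smul_eq_mul, h7]
    field_simp
    ring
  have hint := (circleIntegrable_of_holomorphic (A := A) (f := deriv τ) (g := fun w => τ w - z)
    (hA.1.deriv A.isOpen_toSet).continuousOn (hA.1.continuousOn.sub continuousOn_const)
    hρ hne).out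
  rw [circleIntegral, intervalIntegral.integral_eq_sub_of_hasDerivAt (fun y _ => hder y) hint]
  have h1 := hK _ (hstrip 0)
  have h2 : (Real.log ρ : ℂ) + ((2 * π : ℝ) : ℂ) * I =
      (Real.log ρ : ℂ) + ((0 : ℝ) : ℂ) * I + 2 * π * I := by
    push_cast
    ring
  have h3 : circleMap 0 ρ (2 * π) = circleMap 0 ρ 0 := by
    simpa using periodic_circleMap 0 ρ 0
  rw [h2, h1, h3]
  ring

/-- If `|τ| < |z|` on a circle, then `τ` does not wind around `z`. -/
lemma circleIntegral_logDeriv_inner (hA : A ∈ holomorphyAnnuli τ) {ρ : ℝ}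
    (hρ : ρ ∈ Ioo A.r A.R) {z : ℂ} (hz : ∀ w : ℂ, ‖w‖ = ρ → ‖τ w‖ < ‖z‖) :
    (∮ w in C(0, ρ), deriv τ w / (τ w - z)) = 0 := by
  refine circleIntegral.integral_eq_zero_of_hasDerivWithinAt (A.r_pos.trans hρ.1).le
    (f := fun w => Complex.log (1 - τ w / z)) fun w hw => ?_
  have hw' : ‖w‖ = ρ := by simpa using hw
  have hlt := hz w hw'
  have hz0 : z ≠ 0 := norm_pos_iff.1 ((norm_nonneg _).trans_lt hlt)
  have hτd : HasDerivAt τ (deriv τ w) w :=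
    (hA.1.differentiableAt (A.isOpen_toSet.mem_nhds (sphere_subset_of_Ioo hρ hw))).hasDerivAt
  have hsl : 1 - τ w / z ∈ Complex.slitPlane := by
    refine Complex.mem_slitPlane_of_norm_lt_one (z := -(τ w / z)) ?_
    rw [norm_neg, norm_div, div_lt_one (norm_pos_iff.2 hz0)]
    exact hlt
  have h1 := ((hτd.div_const z).const_sub 1).clog hsl
  refine (h1.congr_deriv ?_).hasDerivWithinAt
  have hne : τ w - z ≠ 0 := by
    intro h0
    rw [sub_eq_zero] at h0
    exact hlt.ne (by rw [h0])
  have h7 : (1 : ℂ) - τ w / z = -(τ w - z) / z := by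
    field_simp
    ring
  rw [h7]
  field_simp

/-- The preimages of points of `A` stay away from `∂A`. -/
lemma exists_radii (hτ : IsAnalyticExpanding τ) (hA : IsSuitableAnnulus τ A) :
    ∃ r' R', r' ∈ Ioo A.r 1 ∧ R' ∈ Ioo 1 A.R ∧ (∀ z, A.r ≤ ‖z‖ → ‖z‖ ≤ r' → ‖τ z‖ < A.r) ∧
      (∀ z, R' ≤ ‖z‖ → ‖z‖ ≤ A.R → A.R < ‖τ z‖) ∧
      ∀ z ∈ A.toSet, ∀ w ∈ fibre τ A z, r' < ‖w‖ ∧ ‖w‖ < R' := by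
  obtain ⟨R', hR', hRτ⟩ := exists_outer_radius hτ hA
  obtain ⟨r', hr', hrτ⟩ := exists_inner_radius hτ hA
  refine ⟨r', R', hr', hR', hrτ, hRτ, fun z hz w hw => ?_⟩
  obtain ⟨hwA, rfl⟩ := hw
  constructor
  · by_contra h
    exact absurd hz.1 (not_lt.2 (hrτ w hwA.1.le (not_lt.1 h)).le)
  · by_contra h
    exact absurd hz.2 (not_lt.2 (hRτ w (not_lt.1 h) hwA.2.le).le)

/-- Every point of `A` has exactly `K > 1` preimages in `A`, all of them simple: the lift is
surjective and so gives `K` distinct ones, while by the argument principle there are `K` with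
multiplicities. -/
lemma exists_degree_fibre (hτ : IsAnalyticExpanding τ) (hA : IsSuitableAnnulus τ A) :
    ∃ K : ℕ, 1 < K ∧ ∀ z ∈ A.toSet, (fibre τ A z).Finite ∧ (fibre τ A z).ncard = K ∧
      ∀ w ∈ fibre τ A z, deriv τ w ≠ 0 := by
  obtain ⟨T, hT⟩ := exists_isLift hA.mem
  obtain ⟨K, hK1, hK⟩ := hT.exists_degree hτ hA.mem
  obtain ⟨r', R', hr', hR', hrτ, hRτ, hfib⟩ := exists_radii hτ hA
  refine ⟨K, hK1, fun z hz => ?_⟩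
  have han : AnalyticOnNhd ℂ τ A.toSet := hA.mem.1.analyticOnNhd A.isOpen_toSet
  have hr'A : r' ∈ Ioo A.r A.R := ⟨hr'.1, hr'.2.trans A.one_lt_R⟩
  have hR'A : R' ∈ Ioo A.r A.R := ⟨A.r_lt_one.trans hR'.1, hR'.2⟩
  have hnc : ∃ w ∈ A.toSet, τ w ≠ z := by
    refine ⟨R', sphere_subset_of_Ioo hR'A (by simp [abs_of_pos (one_pos.trans hR'.1)]), fun h => ?_⟩
    have h1 : ‖(R' : ℂ)‖ = R' := by simp [abs_of_pos (one_pos.trans hR'.1)]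
    have := hRτ R' h1.ge (by rw [h1]; exact hR'.2.le)
    rw [h] at this
    exact absurd hz.2 this.le.not_gt
  have hfin : (fibre τ A z).Finite := by
    have hcomp : IsCompact {w : ℂ | r' ≤ ‖w‖ ∧ ‖w‖ ≤ R'} := by
      refine (isCompact_closedBall (0 : ℂ) R').of_isClosed_subset
        ((isClosed_le continuous_const continuous_norm).inter
          (isClosed_le continuous_norm continuous_const)) fun w hw => by simpa using hw.2
    refine (finite_fibre_of_isCompact han A.isPreconnected hcomp
      (fun w hw => ⟨hr'.1.trans_le hw.1, hw.2.trans_lt hR'.2⟩) hnc).subset fun w hw => ?_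
    have := hfib z hz w hw
    exact ⟨⟨this.1.le, this.2.le⟩, hw.2⟩
  set Z := hfin.toFinset with hZ
  have hZmem : ∀ {w}, w ∈ Z ↔ w ∈ fibre τ A z := fun {w} => hfin.mem_toFinset
  -- `m w` is the multiplicity of `w` as a zero of `τ - z`; by the argument principle `∑ m w = K`
  have hmult : ∀ w ∈ Z, ∃ m : ℕ, 1 ≤ m ∧ (m = 1 → deriv τ w ≠ 0) ∧
      Tendsto (fun ζ => (ζ - w) * (deriv τ ζ / (τ ζ - z))) (𝓝[≠] w) (𝓝 (m : ℂ)) := by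
    intro w hw
    obtain ⟨hwA, hwz⟩ := hZmem.1 hw
    have hne : ¬ ∀ᶠ v in 𝓝 w, τ v - z = 0 := by
      intro h
      obtain ⟨v, hvA, hv⟩ := hnc
      refine hv ?_
      refine han.eqOn_of_preconnected_of_eventuallyEq analyticOnNhd_const A.isPreconnected hwA
        (h.mono fun v hv => sub_eq_zero.1 hv) hvA
    have hsub : AnalyticAt ℂ (fun v => τ v - z) w := (han w hwA).sub analyticAt_const
    simpa only [deriv_sub_const_fun] using
      exists_tendsto_logDeriv_zero hsub (sub_eq_zero.2 hwz) hne
  choose! m hm1 hm2 hm3 using hmult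
  have hsum : ∑ w ∈ Z, m w = K := by
    have hd : DifferentiableOn ℂ (fun ζ => deriv τ ζ / (τ ζ - z)) (annulusSet A.r A.R \ Z) := by
      refine ((hA.mem.1.deriv A.isOpen_toSet).mono sdiff_subset).div
        ((hA.mem.1.mono sdiff_subset).sub_const z) fun w hw h0 => ?_
      exact hw.2 (hZmem.2 ⟨hw.1, sub_eq_zero.1 h0⟩)
    have h1 := circleIntegral_sub_eq_sum_residues A.r_pos.le hr'.1 (hr'.2.trans hR'.1) hR'.2
      (c := fun w => (m w : ℂ)) Z (fun w hw => hfib z hz w (hZmem.1 hw)) hd hm3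
    rw [hT.circleIntegral_logDeriv_outer hA.mem hK hR'A fun w hw =>
        hz.2.trans (hRτ w hw.ge (hw.trans_le hR'.2.le)),
      circleIntegral_logDeriv_inner hA.mem hr'A fun w hw =>
        (hrτ w (hr'.1.le.trans hw.ge) hw.le).trans hz.1, sub_zero, mul_comm] at h1
    have h2 := mul_left_cancel₀ Complex.two_pi_I_ne_zero h1
    exact_mod_cast h2.symm
  -- the points `w j` of the strip with `T (w j) = ζ + 2πij`, where `exp ζ = z`, have different
  -- images under `exp` for `0 ≤ j < K`, as `T` moves by multiples of `2πiK` along a fibre of `exp`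
  have hcard : K ≤ Z.card := by
    obtain ⟨ζ, hζ, hζz⟩ := AnnulusRadii.exists_exp_eq hz
    have hshift : ∀ j : ℕ, ζ + j * (2 * π * I) ∈ A.strip := fun j =>
      AnnulusRadii.add_mem_strip hζ (by simp)
    choose w hwS hw using fun j : ℕ => hT.surjOn hτ hA (hshift j)
    have hinj : InjOn (fun j => cexp (w j)) (Finset.range K : Set ℕ) := by
      intro i hi j hj hij
      simp only [Finset.coe_range, mem_Iio] at hi hj
      obtain ⟨n, hn⟩ := Complex.exp_eq_exp_iff_exists_int.1 hij
      have h1 := map_add_int_mul_of_map_add hK n (w j) (hwS j)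
      rw [← hn, hw, hw] at h1
      have h2 : (i : ℂ) - j = n * K := by
        have h3 : (2 * π * I) * ((i : ℂ) - j) = (2 * π * I) * (n * K) := by
          linear_combination h1
        exact mul_left_cancel₀ Complex.two_pi_I_ne_zero h3
      have h4 : (i : ℤ) - j = n * K := by exact_mod_cast h2
      have h5 : |(i : ℤ) - j| < K := by rw [abs_lt]; constructor <;> omega
      have h6 : (i : ℤ) - j = 0 := Int.eq_zero_of_abs_lt_dvd ⟨n, by rw [h4, mul_comm]⟩ h5
      omega
    have hsub : (Finset.range K).image (fun j => cexp (w j)) ⊆ Z := by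
      intro v hv
      obtain ⟨j, -, rfl⟩ := Finset.mem_image.1 hv
      refine hZmem.2 ⟨AnnulusRadii.exp_mem.2 (hwS j), ?_⟩
      rw [← hT.exp_eq _ (hwS j), hw, Complex.exp_add, hζz]
      have := Complex.exp_int_mul_two_pi_mul_I j
      rw [Int.cast_natCast] at this
      rw [this, mul_one]
    calc K = ((Finset.range K).image fun j => cexp (w j)).card := by
          rw [Finset.card_image_of_injOn hinj, Finset.card_range]
      _ ≤ Z.card := Finset.card_le_card hsub
  have hle : Z.card ≤ ∑ w ∈ Z, m w := by
    simpa using Finset.card_nsmul_le_sum Z m 1 hm1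
  have hcardK : Z.card = K := le_antisymm (hle.trans hsum.le) hcard
  refine ⟨hfin, by rw [Set.ncard_eq_toFinset_card _ hfin, ← hZ, hcardK], fun w hw => ?_⟩
  have hall : ∀ v ∈ Z, 1 = m v := by
    refine (Finset.sum_eq_sum_iff_of_le hm1).1 ?_
    rw [hsum, Finset.sum_const, hcardK, smul_eq_mul, mul_one]
  exact hm2 w (hZmem.2 hw) (hall w (hZmem.2 hw)).symm

/-! ### Composition operators -/

lemma HardyDisk.apply_eq_tsum {r : ℝ} [Fact (0 < r)] (h : HardyDisk r) {z : ℂ} (hz : ‖z‖ < r) :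
    h z = ∑' n : ℕ, fourierCoeff (HardyDisk.bdry r h) n * (z / r) ^ n := by
  have hm : z ∈ Metric.ball (0 : ℂ) r := mem_ball_zero_iff.2 hz
  conv_lhs => rw [← rieszPlus_bdry h]
  change rieszPlusFun r r (HardyDisk.bdry r h) z = _
  rw [rieszPlusFun, indicator_of_mem hm]

lemma HardyExterior.apply_eq_tsum {R : ℝ} [Fact (0 < R)] (h : HardyExterior R) {z : ℂ}
    (hz : R < ‖z‖) : h z = ∑' n : ℕ, fourierCoeff (HardyExterior.bdry R h) (-((n : ℤ) + 1)) *
      (R / z) ^ (n + 1) := by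
  have hm : z ∈ exteriorSet R := hz
  conv_lhs => rw [← rieszMinus_bdry h]
  change rieszMinusFun R R (HardyExterior.bdry R h) z = _
  rw [rieszMinusFun, indicator_of_mem hm]

lemma HardyDisk.norm_apply_le {r : ℝ} [hr : Fact (0 < r)] (h : HardyDisk r) {z : ℂ} {q : ℝ}
    (hq : q < 1) (hz : ‖z‖ ≤ q * r) : ‖h z‖ ≤ (1 - q)⁻¹ * ‖h‖ := by
  have hr0 := hr.out
  have hq0 : 0 ≤ q := nonneg_of_mul_nonneg_left ((norm_nonneg z).trans hz) hr0
  rw [h.apply_eq_tsum (hz.trans_lt (mul_lt_of_lt_one_left hr0 hq)), mul_comm (1 - q)⁻¹]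
  refine tsum_of_norm_bounded ((hasSum_geometric_of_lt_one hq0 hq).mul_left ‖h‖) fun n => ?_
  rw [norm_mul, norm_pow, norm_div, Complex.norm_real, Real.norm_of_nonneg hr0.le]
  refine mul_le_mul (norm_fourierCoeff_le _ _) (pow_le_pow_left₀ (by positivity) ?_ n)
    (by positivity) (norm_nonneg _)
  rwa [div_le_iff₀ hr0]

lemma HardyExterior.norm_apply_le {R : ℝ} [hR : Fact (0 < R)] (h : HardyExterior R) {z : ℂ} {q : ℝ}
    (hq : q < 1) (hz : R * ‖z⁻¹‖ ≤ q) (hz' : R < ‖z‖) : ‖h z‖ ≤ (1 - q)⁻¹ * ‖h‖ := by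
  have hR0 := hR.out
  have hq0 : 0 ≤ q := (by positivity : 0 ≤ R * ‖z⁻¹‖).trans hz
  rw [h.apply_eq_tsum hz', mul_comm (1 - q)⁻¹]
  refine tsum_of_norm_bounded ((hasSum_geometric_of_lt_one hq0 hq).mul_left ‖h‖) fun n => ?_
  rw [norm_mul, norm_pow, div_eq_mul_inv, norm_mul, Complex.norm_real,
    Real.norm_of_nonneg hR0.le]
  refine mul_le_mul (norm_fourierCoeff_le _ _) ?_ (by positivity) (norm_nonneg _)
  exact (pow_le_pow_left₀ (by positivity) hz _).trans
    (pow_le_pow_of_le_one hq0 hq.le (Nat.le_succ n))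

lemma circlePt_mem_closure {ρ : ℝ} (hρ : ρ ∈ Icc A.r A.R) (θ : AddCircle (2 * π)) :
    circlePt ρ θ ∈ closure A.toSet := by
  rw [AnnulusRadii.closure_toSet]
  change A.r ≤ ‖circlePt ρ θ‖ ∧ ‖circlePt ρ θ‖ ≤ A.R
  rw [norm_circlePt (A.r_pos.le.trans hρ.1)]
  exact hρ

/-- The function `θ ↦ τ(r e^{iθ})`. -/
def tauInner (hA : IsSuitableAnnulus τ A) : C(AddCircle (2 * π), ℂ) :=
  ⟨fun θ => τ (circlePt A.r θ), continuous_comp_circlePt hA.continuousOn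
    fun θ => circlePt_mem_closure (left_mem_Icc.2 A.r_lt_R.le) θ⟩

lemma norm_tauInner_lt (hτ : IsAnalyticExpanding τ) (hA : IsSuitableAnnulus τ A) :
    ‖tauInner hA‖ < A.r :=
  (ContinuousMap.norm_lt_iff _ A.r_pos).2 fun θ =>
    norm_lt_of_inner hτ hA _ (norm_circlePt A.r_pos.le θ)

lemma lt_norm_tau_circlePt_R (hτ : IsAnalyticExpanding τ) (hA : IsSuitableAnnulus τ A)
    (θ : AddCircle (2 * π)) : A.R < ‖τ (circlePt A.R θ)‖ :=
  norm_gt_of_outer hτ hA _ (norm_circlePt A.R_pos.le θ)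

/-- The function `θ ↦ 1 / τ(R e^{iθ})`. -/
def tauOuterInv (hτ : IsAnalyticExpanding τ) (hA : IsSuitableAnnulus τ A) :
    C(AddCircle (2 * π), ℂ) :=
  ⟨fun θ => (τ (circlePt A.R θ))⁻¹, (continuous_comp_circlePt hA.continuousOn
    fun θ => circlePt_mem_closure (right_mem_Icc.2 A.r_lt_R.le) θ).inv₀ fun θ =>
      norm_pos_iff.1 (A.R_pos.trans (lt_norm_tau_circlePt_R hτ hA θ))⟩

lemma norm_tauOuterInv_lt (hτ : IsAnalyticExpanding τ) (hA : IsSuitableAnnulus τ A) :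
    ‖tauOuterInv hτ hA‖ < A.R⁻¹ := by
  refine (ContinuousMap.norm_lt_iff _ (inv_pos.2 A.R_pos)).2 fun θ => ?_
  change ‖(τ (circlePt A.R θ))⁻¹‖ < A.R⁻¹
  rw [norm_inv]
  exact inv_strictAnti₀ A.R_pos (lt_norm_tau_circlePt_R hτ hA θ)

lemma norm_tauInner_div_lt (hτ : IsAnalyticExpanding τ) (hA : IsSuitableAnnulus τ A) :
    ‖tauInner hA‖ / A.r < 1 :=
  (div_lt_one A.r_pos).2 (norm_tauInner_lt hτ hA)

lemma R_mul_norm_tauOuterInv_lt (hτ : IsAnalyticExpanding τ) (hA : IsSuitableAnnulus τ A) :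
    A.R * ‖tauOuterInv hτ hA‖ < 1 := by
  have := mul_lt_mul_of_pos_left (norm_tauOuterInv_lt hτ hA) A.R_pos
  rwa [mul_inv_cancel₀ A.R_pos.ne'] at this

lemma continuous_disk_comp (hτ : IsAnalyticExpanding τ) (hA : IsSuitableAnnulus τ A)
    (h : HardyDisk A.r) : Continuous fun θ => h (τ (circlePt A.r θ)) := by
  refine ContinuousOn.comp_continuous (s := Metric.ball 0 A.r) h.2.1.continuousOn
    (tauInner hA).continuous fun θ => ?_
  simpa using norm_lt_of_inner hτ hA _ (norm_circlePt A.r_pos.le θ)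

lemma continuous_exterior_comp (hτ : IsAnalyticExpanding τ) (hA : IsSuitableAnnulus τ A)
    (h : HardyExterior A.R) : Continuous fun θ => h (τ (circlePt A.R θ)) := by
  refine ContinuousOn.comp_continuous (s := exteriorSet A.R) h.2.1.1.continuousOn
    (continuous_comp_circlePt hA.continuousOn
      fun θ => circlePt_mem_closure (right_mem_Icc.2 A.r_lt_R.le) θ) fun θ => ?_
  exact lt_norm_tau_circlePt_R hτ hA θ

lemma norm_slice_le_of_bound {f : ℂ → ℂ} {ρ C : ℝ} (hC : 0 ≤ C)
    (hf : Continuous fun θ => f (circlePt ρ θ)) (hb : ∀ θ, ‖f (circlePt ρ θ)‖ ≤ C) :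
    ‖slice f ρ‖ ≤ C := by
  rw [slice_eq_contToL2 ⟨_, hf⟩ fun θ => rfl]
  exact (norm_contToL2_le _).trans ((ContinuousMap.norm_le _ hC).2 hb)

lemma slice_ae_eq {f : ℂ → ℂ} {ρ : ℝ} (hf : Continuous fun θ => f (circlePt ρ θ)) :
    slice f ρ =ᵐ[haarAddCircle] fun θ => f (circlePt ρ θ) := by
  rw [slice_eq hf]
  exact (memLp_of_continuous hf).coeFn_toLp

/-- The operator `C^{(r)}`: composition with `τ` on the inner circle. -/
def compInner (hτ : IsAnalyticExpanding τ) (hA : IsSuitableAnnulus τ A) :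
    HardyDisk A.r →L[ℂ] L2Circle :=
  LinearMap.mkContinuous
    { toFun := fun h => slice (fun w => h (τ w)) A.r
      map_add' := fun h₁ h₂ => slice_add (f := fun w => h₁ (τ w)) (g := fun w => h₂ (τ w))
        (continuous_disk_comp hτ hA h₁) (continuous_disk_comp hτ hA h₂)
      map_smul' := fun c h => slice_smul (f := fun w => h (τ w)) c
        (continuous_disk_comp hτ hA h) }
    (1 - ‖tauInner hA‖ / A.r)⁻¹ <| by
  intro h
  have hq := norm_tauInner_div_lt hτ hA
  refine norm_slice_le_of_bound (f := fun w => h (τ w))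
    (mul_nonneg (inv_nonneg.2 (sub_nonneg.2 hq.le)) (norm_nonneg _))
    (continuous_disk_comp hτ hA h) fun θ => h.norm_apply_le hq ?_
  rw [div_mul_cancel₀ _ A.r_pos.ne']
  exact (tauInner hA).norm_coe_le_norm θ

/-- The operator `C^{(R)}`: composition with `τ` on the outer circle. -/
def compOuter (hτ : IsAnalyticExpanding τ) (hA : IsSuitableAnnulus τ A) :
    HardyExterior A.R →L[ℂ] L2Circle :=
  LinearMap.mkContinuous
    { toFun := fun h => slice (fun w => h (τ w)) A.R
      map_add' := fun h₁ h₂ => slice_add (f := fun w => h₁ (τ w)) (g := fun w => h₂ (τ w))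
        (continuous_exterior_comp hτ hA h₁) (continuous_exterior_comp hτ hA h₂)
      map_smul' := fun c h => slice_smul (f := fun w => h (τ w)) c
        (continuous_exterior_comp hτ hA h) }
    (1 - A.R * ‖tauOuterInv hτ hA‖)⁻¹ <| by
  intro h
  have hq := R_mul_norm_tauOuterInv_lt hτ hA
  refine norm_slice_le_of_bound (f := fun w => h (τ w))
    (mul_nonneg (inv_nonneg.2 (sub_nonneg.2 hq.le)) (norm_nonneg _))
    (continuous_exterior_comp hτ hA h) fun θ => h.norm_apply_le hq ?_
      (lt_norm_tau_circlePt_R hτ hA θ)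
  exact mul_le_mul_of_nonneg_left ((tauOuterInv hτ hA).norm_coe_le_norm θ) A.R_pos.le

lemma compInner_ae_eq (hτ : IsAnalyticExpanding τ) (hA : IsSuitableAnnulus τ A)
    (h : HardyDisk A.r) :
    compInner hτ hA h =ᵐ[haarAddCircle] fun θ => h (τ (circlePt A.r θ)) :=
  slice_ae_eq (f := fun w => h (τ w)) (continuous_disk_comp hτ hA h)

lemma compOuter_ae_eq (hτ : IsAnalyticExpanding τ) (hA : IsSuitableAnnulus τ A)
    (h : HardyExterior A.R) :
    compOuter hτ hA h =ᵐ[haarAddCircle] fun θ => h (τ (circlePt A.R θ)) :=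
  slice_ae_eq (f := fun w => h (τ w)) (continuous_exterior_comp hτ hA h)

lemma compInner_rieszPlus_fourierLp (hτ : IsAnalyticExpanding τ) (hA : IsSuitableAnnulus τ A)
    (k : ℕ) : compInner hτ hA (rieszPlus A.r A.r le_rfl (fourierLp (T := 2 * π) 2 k)) =
      ((A.r : ℂ) ^ k)⁻¹ • contToL2 (tauInner hA ^ k) := by
  rw [← map_smul]
  generalize hg : (fourierLp (T := 2 * π) 2 (k : ℤ) : L2Circle) = g
  change slice (fun w => rieszPlusFun A.r A.r g (τ w)) A.r = _
  refine slice_eq_contToL2 _ fun θ => ?_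
  rw [← hg, rieszPlusFun_fourierLp (k : ℤ) (by
    simpa using norm_lt_of_inner hτ hA _ (norm_circlePt A.r_pos.le θ)), if_pos (by positivity),
    zpow_neg, zpow_natCast, zpow_natCast]
  rfl

lemma compOuter_rieszMinus_fourierLp (hτ : IsAnalyticExpanding τ) (hA : IsSuitableAnnulus τ A)
    (k : ℕ) : compOuter hτ hA (rieszMinus A.R A.R le_rfl
      (fourierLp (T := 2 * π) 2 (-((k : ℤ) + 1)))) =
      (A.R : ℂ) ^ (k + 1) • contToL2 (tauOuterInv hτ hA ^ (k + 1)) := by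
  rw [← map_smul]
  generalize hg : (fourierLp (T := 2 * π) 2 (-((k : ℤ) + 1)) : L2Circle) = g
  change slice (fun w => rieszMinusFun A.R A.R g (τ w)) A.R = _
  refine slice_eq_contToL2 _ fun θ => ?_
  rw [← hg, rieszMinusFun_fourierLp (-((k : ℤ) + 1)) (lt_norm_tau_circlePt_R hτ hA θ),
    if_neg (by omega), neg_neg, zpow_neg, ← inv_zpow, ← Nat.cast_succ, zpow_natCast,
    zpow_natCast]
  rfl

/-! ### The transfer operator as a boundary integral -/

lemma tendsto_slice {k : ℂ → ℂ} {a b e : ℝ} (ha : 0 ≤ a) (hab : a ≤ b)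
    (hk : ContinuousOn k {w | a ≤ ‖w‖ ∧ ‖w‖ ≤ b}) (he : e ∈ Icc a b) :
    Tendsto (slice k) (𝓝[Icc a b] e) (𝓝 (slice k e)) := by
  have hc : Continuous fun p : ℝ × AddCircle (2 * π) =>
      k (circlePt (projIcc a b hab p.1) p.2) := by
    refine hk.comp_continuous ?_ fun p => ?_
    · refine (Complex.continuous_ofReal.comp (continuous_subtype_val.comp
        (continuous_projIcc.comp continuous_fst))).mul ?_
      exact (continuous_subtype_val.comp continuous_toCircle).comp continuous_snd
    · have h := (projIcc a b hab p.1).2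
      change a ≤ ‖circlePt _ _‖ ∧ ‖circlePt _ _‖ ≤ b
      rw [norm_circlePt (ha.trans h.1)]
      exact h
  let Φ : C(ℝ, C(AddCircle (2 * π), ℂ)) := ContinuousMap.curry ⟨_, hc⟩
  have hΦ : ∀ ρ ∈ Icc a b, slice k ρ = contToL2 (Φ ρ) := fun ρ hρ =>
    slice_eq_contToL2 (Φ ρ) fun θ => by
      change _ = k (circlePt (projIcc a b hab ρ) θ)
      rw [projIcc_of_mem hab hρ]
  rw [hΦ e he]
  refine Tendsto.congr' ?_ ((contToL2.continuous.comp Φ.continuous).continuousWithinAt)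
  filter_upwards [self_mem_nhdsWithin] with ρ hρ using (hΦ ρ hρ).symm

lemma tendsto_apply_apply {α E F G : Type*} [NormedAddCommGroup E] [NormedSpace ℂ E]
    [NormedAddCommGroup F] [NormedSpace ℂ F] [NormedAddCommGroup G] [NormedSpace ℂ G]
    (B : E →L[ℂ] F →L[ℂ] G) {l : Filter α} {u : α → E} {v : α → F} {u₀ : E} {v₀ : F}
    (hu : Tendsto u l (𝓝 u₀)) (hv : Tendsto v l (𝓝 v₀)) :
    Tendsto (fun a => B (u a) (v a)) l (𝓝 (B u₀ v₀)) :=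
  (B.isBoundedBilinearMap.continuous.tendsto (u₀, v₀)).comp (hu.prodMk_nhds hv)

lemma tendsto_contourPairing {l : Filter ℝ} {e : ℝ} (hl : l ≤ 𝓝 e) {u v : ℝ → L2Circle}
    {u₀ v₀ : L2Circle} (hu : Tendsto u l (𝓝 u₀)) (hv : Tendsto v l (𝓝 v₀)) :
    Tendsto (fun ρ => contourPairing ρ (u ρ) (v ρ)) l (𝓝 (contourPairing e u₀ v₀)) := by
  have h1 : Tendsto (fun ρ => pairingCLM 1 (u ρ) (v ρ)) l (𝓝 (pairingCLM 1 u₀ v₀)) :=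
    tendsto_apply_apply (pairingCLM 1) hu hv
  have h2 : Tendsto (fun ρ : ℝ => (ρ : ℂ)) l (𝓝 (e : ℂ)) :=
    (Complex.continuous_ofReal.tendsto e).mono_left hl
  have h3 := h2.mul h1
  simp only [pairingCLM_apply, ← contourPairing_eq_mul] at h3
  exact h3

/-- The residue theorem writes the sum over the fibre, which defines the transfer operator, as a
contour integral over `∂A`. -/
lemma finsum_fibre_eq (hτ : IsAnalyticExpanding τ) (hA : IsSuitableAnnulus τ A)
    (f : HardyAnnulus A) {z : ℂ} (hz : z ∈ A.toSet) :
    ∑ᶠ w ∈ fibre τ A z, (deriv τ w)⁻¹ * f w =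
      contourPairing A.R (HardyAnnulus.outerBdry A f) (slice (fun w => (τ w - z)⁻¹) A.R) -
      contourPairing A.r (HardyAnnulus.innerBdry A f) (slice (fun w => (τ w - z)⁻¹) A.r) := by
  obtain ⟨K, -, hK⟩ := exists_degree_fibre hτ hA
  obtain ⟨hfin, -, hder⟩ := hK z hz
  obtain ⟨r', R', hr', hR', hrτ, hRτ, hfib⟩ := exists_radii hτ hA
  have hr'A : r' < A.R := hr'.2.trans A.one_lt_R
  have hR'A : A.r < R' := A.r_lt_one.trans hR'.1
  set k : ℂ → ℂ := fun w => (τ w - z)⁻¹ with hk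
  have hf : DifferentiableOn ℂ f A.toSet := f.2.1
  set Z := hfin.toFinset with hZ
  have hZmem : ∀ {w}, w ∈ Z ↔ w ∈ fibre τ A z := fun {w} => hfin.mem_toFinset
  have hcl : ∀ a b : ℝ, A.r ≤ a → b ≤ A.R → {w : ℂ | a ≤ ‖w‖ ∧ ‖w‖ ≤ b} ⊆ closure A.toSet := by
    intro a b ha hb w hw
    rw [AnnulusRadii.closure_toSet]
    exact ⟨ha.trans hw.1, hw.2.trans hb⟩
  have hkR : ContinuousOn k {w | R' ≤ ‖w‖ ∧ ‖w‖ ≤ A.R} := by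
    refine ((hA.continuousOn.mono (hcl _ _ hR'A.le le_rfl)).sub continuousOn_const).inv₀
      fun w hw h0 => ?_
    have h1 := hRτ w hw.1 hw.2
    rw [sub_eq_zero.1 h0] at h1
    exact absurd hz.2 h1.le.not_gt
  have hkr : ContinuousOn k {w | A.r ≤ ‖w‖ ∧ ‖w‖ ≤ r'} := by
    refine ((hA.continuousOn.mono (hcl _ _ le_rfl hr'A.le)).sub continuousOn_const).inv₀
      fun w hw h0 => ?_
    have h1 := hrτ w hw.1 hw.2
    rw [sub_eq_zero.1 h0] at h1
    exact absurd hz.1 h1.le.not_gt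
  -- the residue theorem on the circles of radii `s` close to `r` and `t` close to `R`
  have hres : ∀ s ∈ Ioo A.r r', ∀ t ∈ Ioo R' A.R,
      contourPairing t (slice f t) (slice k t) - contourPairing s (slice f s) (slice k s) =
        ∑ w ∈ Z, (deriv τ w)⁻¹ * f w := by
    intro s hs t ht
    have hst : s < t := hs.2.trans ((hr'.2.trans hR'.1).trans ht.1)
    have hd : DifferentiableOn ℂ (fun w => f w * k w) (annulusSet A.r A.R \ Z) := by
      refine (hf.mono sdiff_subset).mul (((hA.mem.1.mono sdiff_subset).sub_const z).inv
        fun w hw h0 => ?_)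
      exact hw.2 (hZmem.2 ⟨hw.1, sub_eq_zero.1 h0⟩)
    have hc : ∀ w ∈ Z, Tendsto (fun ζ => (ζ - w) * (f ζ * k ζ)) (𝓝[≠] w)
        (𝓝 ((deriv τ w)⁻¹ * f w)) := by
      intro w hw
      obtain ⟨hwA, hwz⟩ := hZmem.1 hw
      have hnh := A.isOpen_toSet.mem_nhds hwA
      have h1 := (hasDerivAt_iff_tendsto_slope.1
        (hA.mem.1.differentiableAt hnh).hasDerivAt).inv₀ (hder w (hZmem.1 hw))
      have h2 : Tendsto f (𝓝[≠] w) (𝓝 (f w)) :=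
        (hf.differentiableAt hnh).continuousAt.tendsto.mono_left nhdsWithin_le_nhds
      refine (h1.mul h2).congr fun ζ => ?_
      rw [slope_def_field, hwz, inv_div, hk]
      ring
    have h1 := circleIntegral_sub_eq_sum_residues A.r_pos.le hs.1 hst ht.2 Z
      (fun w hw => by
        have := hfib z hz w (hZmem.1 hw)
        exact ⟨hs.2.trans this.1, this.2.trans ht.1⟩) hd hc
    have hfc : ∀ ρ ∈ Ioo A.r A.R, Continuous fun θ => f (circlePt ρ θ) := fun ρ hρ =>
      continuous_comp_circlePt hf.continuousOn (circlePt_mem_annulusSet A.r_pos.le hρ)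
    have ht0 : 0 ≤ t := A.r_pos.le.trans (hs.1.trans hst).le
    have hs0 : 0 ≤ s := A.r_pos.le.trans hs.1.le
    rw [contourPairing_slice (hfc t ⟨hR'A.trans ht.1, ht.2⟩)
        (continuous_comp_circlePt hkR fun θ => by
          change R' ≤ ‖_‖ ∧ ‖_‖ ≤ A.R
          rw [norm_circlePt ht0]
          exact ⟨ht.1.le, ht.2.le⟩),
      contourPairing_slice (hfc s ⟨hs.1, hs.2.trans hr'A⟩)
        (continuous_comp_circlePt hkr fun θ => by
          change A.r ≤ ‖_‖ ∧ ‖_‖ ≤ r'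
          rw [norm_circlePt hs0]
          exact ⟨hs.1.le, hs.2.le⟩),
      ← mul_sub, h1, inv_mul_cancel_left₀ Complex.two_pi_I_ne_zero]
  have hlimR : Tendsto (fun t => contourPairing t (slice f t) (slice k t)) (𝓝[<] A.R)
      (𝓝 (contourPairing A.R (HardyAnnulus.outerBdry A f) (slice k A.R))) := by
    refine tendsto_contourPairing nhdsWithin_le_nhds
      (tendsto_bdryFromInside f.2 A.r_pos.le A.r_lt_R subset_rfl) ?_
    refine (tendsto_slice (zero_le_one.trans hR'.1.le) hR'.2.le hkR
      (right_mem_Icc.2 hR'.2.le)).mono_left ?_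
    rw [← nhdsWithin_Ioo_eq_nhdsLT hR'.2]
    exact nhdsWithin_mono _ Ioo_subset_Icc_self
  have hlimr : Tendsto (fun s => contourPairing s (slice f s) (slice k s)) (𝓝[>] A.r)
      (𝓝 (contourPairing A.r (HardyAnnulus.innerBdry A f) (slice k A.r))) := by
    refine tendsto_contourPairing nhdsWithin_le_nhds
      (tendsto_bdryFromOutside f.2 A.r_pos A.r_lt_R subset_rfl) ?_
    refine (tendsto_slice A.r_pos.le hr'.1.le hkr (left_mem_Icc.2 hr'.1.le)).mono_left ?_
    rw [← nhdsWithin_Ioo_eq_nhdsGT hr'.1]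
    exact nhdsWithin_mono _ Ioo_subset_Icc_self
  have hstep : ∀ s ∈ Ioo A.r r',
      contourPairing A.R (HardyAnnulus.outerBdry A f) (slice k A.R) -
        contourPairing s (slice f s) (slice k s) = ∑ w ∈ Z, (deriv τ w)⁻¹ * f w := by
    intro s hs
    refine tendsto_nhds_unique (hlimR.sub_const _) (tendsto_const_nhds.congr' ?_)
    rw [← nhdsWithin_Ioo_eq_nhdsLT hR'.2]
    filter_upwards [self_mem_nhdsWithin] with t ht using (hres s hs t ht).symm
  have hfinal : contourPairing A.R (HardyAnnulus.outerBdry A f) (slice k A.R) -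
      contourPairing A.r (HardyAnnulus.innerBdry A f) (slice k A.r) =
        ∑ w ∈ Z, (deriv τ w)⁻¹ * f w := by
    refine tendsto_nhds_unique (hlimr.const_sub _) (tendsto_const_nhds.congr' ?_)
    rw [← nhdsWithin_Ioo_eq_nhdsGT hr'.1]
    filter_upwards [self_mem_nhdsWithin] with s hs using (hstep s hs).symm
  rw [hfinal, finsum_mem_eq_finite_toFinset_sum _ hfin]

/-! ### The Laurent series of the transfer operator -/

/-- The coefficient of `z^k` in the Laurent series of the transfer operator applied to `f`. -/
def transferCoeffOuter (hτ : IsAnalyticExpanding τ) (hA : IsSuitableAnnulus τ A)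
    (f : HardyAnnulus A) (k : ℕ) : ℂ :=
  contourPairing A.R (HardyAnnulus.outerBdry A f) (contToL2 (tauOuterInv hτ hA ^ (k + 1)))

/-- The coefficient of `z^{-k-1}` in the Laurent series of the transfer operator applied to `f`. -/
def transferCoeffInner (hA : IsSuitableAnnulus τ A) (f : HardyAnnulus A) (k : ℕ) : ℂ :=
  contourPairing A.r (HardyAnnulus.innerBdry A f) (contToL2 (tauInner hA ^ k))

lemma hasSum_slice_outer (hτ : IsAnalyticExpanding τ) (hA : IsSuitableAnnulus τ A)
    {z : ℂ} (hz : z ∈ A.toSet) :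
    HasSum (fun k : ℕ => z ^ k • contToL2 (tauOuterInv hτ hA ^ (k + 1)))
      (slice (fun w => (τ w - z)⁻¹) A.R) := by
  set p := tauOuterInv hτ hA with hp
  have hx : ‖z • p‖ < 1 := by
    rw [norm_smul]
    exact (mul_le_mul_of_nonneg_right hz.2.le (norm_nonneg p)).trans_lt
      (R_mul_norm_tauOuterInv_lt hτ hA)
  have h1 := mul_neg_geom_series (z • p) hx
  have h2 := contToL2.hasSum ((summable_geometric_of_norm_lt_one hx).hasSum.mul_left p)
  generalize ∑' i : ℕ, (z • p) ^ i = S at h1 h2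
  have h3 : slice (fun w => (τ w - z)⁻¹) A.R = contToL2 (p * S) := by
    refine slice_eq_contToL2 _ fun θ => ?_
    have h4 : (1 - z * (τ (circlePt A.R θ))⁻¹) * S θ = 1 := congrArg (fun g => g θ) h1
    have h5 : τ (circlePt A.R θ) ≠ 0 :=
      norm_pos_iff.1 (A.R_pos.trans (lt_norm_tau_circlePt_R hτ hA θ))
    change _ = (τ (circlePt A.R θ))⁻¹ * S θ
    refine inv_eq_of_mul_eq_one_right ?_
    rw [← h4]
    field_simp
  rw [h3]
  refine h2.congr_fun fun k => ?_
  rw [smul_pow, mul_smul_comm, map_smul, ← pow_succ']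

lemma hasSum_slice_inner (hτ : IsAnalyticExpanding τ) (hA : IsSuitableAnnulus τ A)
    {z : ℂ} (hz : z ∈ A.toSet) :
    HasSum (fun k : ℕ => (z ^ (k + 1))⁻¹ • contToL2 (tauInner hA ^ k))
      (-slice (fun w => (τ w - z)⁻¹) A.r) := by
  set q := tauInner hA with hq
  have hz0 : 0 < ‖z‖ := A.r_pos.trans hz.1
  have hz0' : z ≠ 0 := norm_pos_iff.1 hz0
  have hx : ‖z⁻¹ • q‖ < 1 := by
    rw [norm_smul, norm_inv, inv_mul_lt_one₀ hz0]
    exact (norm_tauInner_lt hτ hA).trans hz.1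
  have h1 := mul_neg_geom_series (z⁻¹ • q) hx
  have h2 := contToL2.hasSum ((summable_geometric_of_norm_lt_one hx).hasSum.const_smul z⁻¹)
  generalize ∑' i : ℕ, (z⁻¹ • q) ^ i = S at h1 h2
  have h3 : slice (fun w => (τ w - z)⁻¹) A.r = contToL2 (-(z⁻¹ • S)) := by
    refine slice_eq_contToL2 _ fun θ => ?_
    have h4 : (1 - z⁻¹ * τ (circlePt A.r θ)) * S θ = 1 := congrArg (fun g => g θ) h1
    change _ = -(z⁻¹ * S θ)
    refine inv_eq_of_mul_eq_one_right ?_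
    rw [← h4]
    field_simp
    ring
  rw [h3, map_neg, neg_neg]
  refine h2.congr_fun fun k => ?_
  rw [smul_pow, smul_smul, map_smul, ← pow_succ', inv_pow]

lemma norm_transferCoeffOuter_le (hτ : IsAnalyticExpanding τ) (hA : IsSuitableAnnulus τ A)
    (f : HardyAnnulus A) (k : ℕ) :
    ‖transferCoeffOuter hτ hA f k‖ * A.R ^ k ≤ ‖f‖ * (A.R * ‖tauOuterInv hτ hA‖) ^ k := by
  have hR := A.R_pos
  have hq := R_mul_norm_tauOuterInv_lt hτ hA
  have h1 := norm_contourPairing_le A.R (HardyAnnulus.outerBdry A f)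
    (contToL2 (tauOuterInv hτ hA ^ (k + 1)))
  have h2 : ‖contToL2 (tauOuterInv hτ hA ^ (k + 1))‖ ≤ ‖tauOuterInv hτ hA‖ ^ (k + 1) :=
    (norm_contToL2_le _).trans (norm_pow_le _ _)
  rw [abs_of_pos hR] at h1
  calc ‖transferCoeffOuter hτ hA f k‖ * A.R ^ k
      ≤ (A.R * ‖f‖ * ‖tauOuterInv hτ hA‖ ^ (k + 1)) * A.R ^ k := by
        refine mul_le_mul_of_nonneg_right (h1.trans ?_) (by positivity)
        gcongr
        exact HardyAnnulus.norm_outerBdry_le f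
    _ = ‖f‖ * (A.R * ‖tauOuterInv hτ hA‖) ^ (k + 1) := by ring
    _ ≤ ‖f‖ * (A.R * ‖tauOuterInv hτ hA‖) ^ k := by
        gcongr _ * ?_
        exact pow_le_pow_of_le_one (by positivity) hq.le (Nat.le_succ k)

lemma norm_transferCoeffInner_le (hA : IsSuitableAnnulus τ A) (f : HardyAnnulus A) (k : ℕ) :
    ‖transferCoeffInner hA f k‖ * (A.r ^ (k + 1))⁻¹ ≤ ‖f‖ * (‖tauInner hA‖ / A.r) ^ k := by
  have hr := A.r_pos
  have h1 := norm_contourPairing_le A.r (HardyAnnulus.innerBdry A f)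
    (contToL2 (tauInner hA ^ k))
  have h2 : ‖contToL2 (tauInner hA ^ k)‖ ≤ ‖tauInner hA‖ ^ k :=
    (norm_contToL2_le _).trans (norm_pow_le _ _)
  rw [abs_of_pos hr] at h1
  calc ‖transferCoeffInner hA f k‖ * (A.r ^ (k + 1))⁻¹
      ≤ (A.r * ‖f‖ * ‖tauInner hA‖ ^ k) * (A.r ^ (k + 1))⁻¹ := by
        refine mul_le_mul_of_nonneg_right (h1.trans ?_) (by positivity)
        gcongr
        exact HardyAnnulus.norm_innerBdry_le f
    _ = ‖f‖ * (‖tauInner hA‖ / A.r) ^ k := by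
        rw [div_pow, pow_succ]
        field_simp

lemma norm_outer_term_le (hτ : IsAnalyticExpanding τ) (hA : IsSuitableAnnulus τ A)
    (f : HardyAnnulus A) (k : ℕ) {z : ℂ} (hz : z ∈ A.toSet) :
    ‖transferCoeffOuter hτ hA f k * z ^ k‖ ≤ ‖f‖ * (A.R * ‖tauOuterInv hτ hA‖) ^ k := by
  rw [norm_mul, norm_pow]
  exact (mul_le_mul_of_nonneg_left (pow_le_pow_left₀ (norm_nonneg z) hz.2.le k)
    (norm_nonneg _)).trans (norm_transferCoeffOuter_le hτ hA f k)

lemma norm_inner_term_le (hA : IsSuitableAnnulus τ A) (f : HardyAnnulus A) (k : ℕ) {z : ℂ}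
    (hz : z ∈ A.toSet) : ‖transferCoeffInner hA f k * (z ^ (k + 1))⁻¹‖ ≤
      ‖f‖ * (‖tauInner hA‖ / A.r) ^ k := by
  rw [norm_mul, norm_inv, norm_pow]
  exact (mul_le_mul_of_nonneg_left (inv_anti₀ (pow_pos A.r_pos _)
    (pow_le_pow_left₀ A.r_pos.le hz.1.le _)) (norm_nonneg _)).trans
    (norm_transferCoeffInner_le hA f k)

lemma hasSum_outer_bound (hτ : IsAnalyticExpanding τ) (hA : IsSuitableAnnulus τ A)
    (f : HardyAnnulus A) : HasSum (fun k : ℕ => ‖f‖ * (A.R * ‖tauOuterInv hτ hA‖) ^ k)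
      (‖f‖ * (1 - A.R * ‖tauOuterInv hτ hA‖)⁻¹) :=
  (hasSum_geometric_of_lt_one (mul_nonneg A.R_pos.le (norm_nonneg _))
    (R_mul_norm_tauOuterInv_lt hτ hA)).mul_left _

lemma hasSum_inner_bound (hτ : IsAnalyticExpanding τ) (hA : IsSuitableAnnulus τ A)
    (f : HardyAnnulus A) : HasSum (fun k : ℕ => ‖f‖ * (‖tauInner hA‖ / A.r) ^ k)
      (‖f‖ * (1 - ‖tauInner hA‖ / A.r)⁻¹) :=
  (hasSum_geometric_of_lt_one (div_nonneg (norm_nonneg _) A.r_pos.le)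
    (norm_tauInner_div_lt hτ hA)).mul_left _

/-- Expanding `1/(τ(w) - z)` in geometric series on the two circles, where `|τ(w)| > R > |z|` and
`|τ(w)| < r < |z|`, turns the boundary integral into a Laurent series. -/
lemma finsum_fibre_eq_tsum (hτ : IsAnalyticExpanding τ) (hA : IsSuitableAnnulus τ A)
    (f : HardyAnnulus A) {z : ℂ} (hz : z ∈ A.toSet) :
    ∑ᶠ w ∈ fibre τ A z, (deriv τ w)⁻¹ * f w =
      ∑' k : ℕ, transferCoeffOuter hτ hA f k * z ^ k +
      ∑' k : ℕ, transferCoeffInner hA f k * (z ^ (k + 1))⁻¹ := by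
  have h1 := (pairingCLM A.R (HardyAnnulus.outerBdry A f)).hasSum (hasSum_slice_outer hτ hA hz)
  have h2 := (pairingCLM A.r (HardyAnnulus.innerBdry A f)).hasSum (hasSum_slice_inner hτ hA hz)
  simp only [map_smul, map_neg, pairingCLM_apply, smul_eq_mul] at h1 h2
  rw [finsum_fibre_eq hτ hA f hz, sub_eq_add_neg, ← h1.tsum_eq, ← h2.tsum_eq]
  simp only [transferCoeffOuter, transferCoeffInner, mul_comm]

/-! ### The transfer operator on the Hardy space of the annulus -/

lemma HardyAnnulus.norm_le_of_bound (f : HardyAnnulus A) {C : ℝ} (hC : 0 ≤ C)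
    (h : ∀ z ∈ A.toSet, ‖f z‖ ≤ C) : ‖f‖ ≤ 2 * C := by
  have hs : ∀ s ∈ Ioo A.r A.R, ‖slice f s‖ ≤ C := fun s hs =>
    norm_slice_le_of_bound hC (hardy_slice_cont f.2 A.r_pos.le subset_rfl hs) fun θ =>
      h _ (circlePt_mem_annulusSet A.r_pos.le hs θ)
  have h1 : ‖HardyAnnulus.innerBdry A f‖ ≤ C := by
    refine le_of_tendsto (tendsto_bdryFromOutside f.2 A.r_pos A.r_lt_R subset_rfl).norm ?_
    rw [← nhdsWithin_Ioo_eq_nhdsGT A.r_lt_R]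
    filter_upwards [self_mem_nhdsWithin] with s h using hs s h
  have h2 : ‖HardyAnnulus.outerBdry A f‖ ≤ C := by
    refine le_of_tendsto (tendsto_bdryFromInside f.2 A.r_pos.le A.r_lt_R subset_rfl).norm ?_
    rw [← nhdsWithin_Ioo_eq_nhdsLT A.r_lt_R]
    filter_upwards [self_mem_nhdsWithin] with s h using hs s h
  refine (pow_le_pow_iff_left₀ (norm_nonneg _) (by positivity) two_ne_zero).1 ?_
  rw [HardyAnnulus.norm_sq_eq]
  have h3 := pow_le_pow_left₀ (norm_nonneg _) h1 2
  have h4 := pow_le_pow_left₀ (norm_nonneg _) h2 2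
  nlinarith [sq_nonneg C]

/-- The function `z ↦ ∑_{w ∈ A, τ(w) = z} f(w) / τ'(w)` on `A`, extended by zero. -/
def transferFun (τ : ℂ → ℂ) (f : HardyAnnulus A) : ℂ → ℂ :=
  A.toSet.indicator fun z => ∑ᶠ w ∈ fibre τ A z, (deriv τ w)⁻¹ * f w

lemma transferFun_eq_tsum (hτ : IsAnalyticExpanding τ) (hA : IsSuitableAnnulus τ A)
    (f : HardyAnnulus A) {z : ℂ} (hz : z ∈ A.toSet) :
    transferFun τ f z = ∑' k : ℕ, transferCoeffOuter hτ hA f k * z ^ k +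
      ∑' k : ℕ, transferCoeffInner hA f k * (z ^ (k + 1))⁻¹ := by
  rw [transferFun, indicator_of_mem hz, finsum_fibre_eq_tsum hτ hA f hz]

/-- The bound for the transfer operator from `H²(A)` to the bounded functions on `A`. -/
def transferBound (hτ : IsAnalyticExpanding τ) (hA : IsSuitableAnnulus τ A) : ℝ :=
  (1 - A.R * ‖tauOuterInv hτ hA‖)⁻¹ + (1 - ‖tauInner hA‖ / A.r)⁻¹

lemma transferBound_nonneg (hτ : IsAnalyticExpanding τ) (hA : IsSuitableAnnulus τ A) :
    0 ≤ transferBound hτ hA :=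
  add_nonneg (inv_nonneg.2 (sub_nonneg.2 (R_mul_norm_tauOuterInv_lt hτ hA).le))
    (inv_nonneg.2 (sub_nonneg.2 (norm_tauInner_div_lt hτ hA).le))

lemma norm_transferFun_le (hτ : IsAnalyticExpanding τ) (hA : IsSuitableAnnulus τ A)
    (f : HardyAnnulus A) {z : ℂ} (hz : z ∈ A.toSet) :
    ‖transferFun τ f z‖ ≤ transferBound hτ hA * ‖f‖ := by
  rw [transferFun_eq_tsum hτ hA f hz, transferBound, mul_comm, mul_add]
  exact norm_add_le_of_le
    (tsum_of_norm_bounded (hasSum_outer_bound hτ hA f) fun k => norm_outer_term_le hτ hA f k hz)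
    (tsum_of_norm_bounded (hasSum_inner_bound hτ hA f) fun k => norm_inner_term_le hA f k hz)

lemma differentiableOn_transferFun (hτ : IsAnalyticExpanding τ) (hA : IsSuitableAnnulus τ A)
    (f : HardyAnnulus A) : DifferentiableOn ℂ (transferFun τ f) A.toSet := by
  have h1 : DifferentiableOn ℂ (fun z => ∑' k : ℕ, transferCoeffOuter hτ hA f k * z ^ k)
      A.toSet :=
    differentiableOn_tsum_of_summable_norm (hasSum_outer_bound hτ hA f).summable
      (fun k => by fun_prop) A.isOpen_toSet fun k z hz => norm_outer_term_le hτ hA f k hz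
  have h2 : DifferentiableOn ℂ (fun z => ∑' k : ℕ, transferCoeffInner hA f k * (z ^ (k + 1))⁻¹)
      A.toSet := by
    refine differentiableOn_tsum_of_summable_norm (hasSum_inner_bound hτ hA f).summable
      (fun k => ?_) A.isOpen_toSet fun k z hz => norm_inner_term_le hA f k hz
    refine (differentiableOn_const _).mul ((differentiableOn_pow _).inv fun z hz => ?_)
    exact pow_ne_zero _ (norm_pos_iff.1 (A.r_pos.trans hz.1))
  exact (h1.add h2).congr fun z hz => transferFun_eq_tsum hτ hA f hz

lemma transferFun_mem (hτ : IsAnalyticExpanding τ) (hA : IsSuitableAnnulus τ A)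
    (f : HardyAnnulus A) : transferFun τ f ∈ hardySpace A.toSet := by
  have hd := differentiableOn_transferFun hτ hA f
  refine ⟨hd, fun z hz => indicator_of_notMem hz _, (transferBound hτ hA * ‖f‖) ^ 2,
    fun ρ hρ hU => ?_⟩
  have hm : ∀ θ, circlePt ρ θ ∈ A.toSet := fun θ => hU (by simp [norm_circlePt hρ.le])
  have hc := continuous_comp_circlePt hd.continuousOn hm
  rw [meanSq_eq hc]
  exact pow_le_pow_left₀ (norm_nonneg _) (norm_slice_le_of_bound
    (mul_nonneg (transferBound_nonneg hτ hA) (norm_nonneg _)) hc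
    fun θ => norm_transferFun_le hτ hA f (hm θ)) 2

lemma finite_fibre (hτ : IsAnalyticExpanding τ) (hA : IsSuitableAnnulus τ A) {z : ℂ}
    (hz : z ∈ A.toSet) : (fibre τ A z).Finite := by
  obtain ⟨K, -, hK⟩ := exists_degree_fibre hτ hA
  exact (hK z hz).1

/-- The transfer operator on `H²(A)`. -/
def transferOp (hτ : IsAnalyticExpanding τ) (hA : IsSuitableAnnulus τ A) :
    HardyAnnulus A →L[ℂ] HardyAnnulus A :=
  LinearMap.mkContinuous
    { toFun := fun f => (⟨transferFun τ f, transferFun_mem hτ hA f⟩ : hardySpace A.toSet)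
      map_add' := fun f g => Subtype.ext <| funext fun z => by
        change transferFun τ (f + g) z = transferFun τ f z + transferFun τ g z
        by_cases hz : z ∈ A.toSet
        · simp only [transferFun, indicator_of_mem hz]
          rw [← finsum_mem_add_distrib (finite_fibre hτ hA hz)]
          exact finsum_mem_congr rfl fun w _ => mul_add _ (f w) (g w)
        · simp only [transferFun, indicator_of_notMem hz, add_zero]
      map_smul' := fun c f => Subtype.ext <| funext fun z => by
        change transferFun τ (c • f) z = c * transferFun τ f z
        by_cases hz : z ∈ A.toSet
        · simp only [transferFun, indicator_of_mem hz]
          rw [mul_finsum_mem]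
          exact finsum_mem_congr rfl fun w _ => mul_left_comm _ c (f w)
        · simp only [transferFun, indicator_of_notMem hz, mul_zero] }
    (2 * transferBound hτ hA) <| by
  intro f
  rw [mul_assoc]
  exact HardyAnnulus.norm_le_of_bound _
    (mul_nonneg (transferBound_nonneg hτ hA) (norm_nonneg _))
    fun z hz => norm_transferFun_le hτ hA f hz

lemma transferOp_apply (hτ : IsAnalyticExpanding τ) (hA : IsSuitableAnnulus τ A)
    (f : HardyAnnulus A) (z : ℂ) : transferOp hτ hA f z = transferFun τ f z := rfl

lemma isTransferOperator_transferOp (hτ : IsAnalyticExpanding τ) (hA : IsSuitableAnnulus τ A) :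
    IsTransferOperator τ A (transferOp hτ hA) := by
  obtain ⟨K, hK1, hK⟩ := exists_degree_fibre hτ hA
  refine ⟨K, hK1, fun z hz => ⟨(hK z hz).2.1, (hK z hz).2.2, fun f => ?_⟩⟩
  rw [transferOp_apply, transferFun, indicator_of_mem hz]

/-- On the unit circle the image of `f` under the transfer operator has the Fourier series given by
the coefficients of its Laurent series. -/
lemma fourierCoeff_slice_transferOp (hτ : IsAnalyticExpanding τ) (hA : IsSuitableAnnulus τ A)
    (f : HardyAnnulus A) (k : ℕ) :
    fourierCoeff (slice (transferOp hτ hA f) 1) k = transferCoeffOuter hτ hA f k ∧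
      fourierCoeff (slice (transferOp hτ hA f) 1) (-((k : ℤ) + 1)) =
        transferCoeffInner hA f k := by
  have h1m : (1 : ℂ) ∈ A.toSet := by
    change A.r < ‖(1 : ℂ)‖ ∧ ‖(1 : ℂ)‖ < A.R
    rw [norm_one]
    exact ⟨A.r_lt_one, A.one_lt_R⟩
  have ho : Summable fun k : ℕ => transferCoeffOuter hτ hA f k •
      (fourier k : C(AddCircle (2 * π), ℂ)) := by
    refine Summable.of_norm_bounded (hasSum_outer_bound hτ hA f).summable fun k => ?_
    rw [norm_smul, fourier_norm, mul_one]
    simpa using norm_outer_term_le hτ hA f k h1m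
  have hi : Summable fun k : ℕ => transferCoeffInner hA f k •
      (fourier (-((k : ℤ) + 1)) : C(AddCircle (2 * π), ℂ)) := by
    refine Summable.of_norm_bounded (hasSum_inner_bound hτ hA f).summable fun k => ?_
    rw [norm_smul, fourier_norm, mul_one]
    simpa using norm_inner_term_le hA f k h1m
  have hs : slice (transferOp hτ hA f) 1 = contToL2 (∑' k : ℕ, transferCoeffOuter hτ hA f k •
      (fourier k : C(AddCircle (2 * π), ℂ)) + ∑' k : ℕ, transferCoeffInner hA f k •
      (fourier (-((k : ℤ) + 1)) : C(AddCircle (2 * π), ℂ))) := by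
    refine slice_eq_contToL2 _ fun θ => ?_
    rw [transferOp_apply, transferFun_eq_tsum hτ hA f
      (circlePt_mem_annulusSet A.r_pos.le ⟨A.r_lt_one, A.one_lt_R⟩ θ), ContinuousMap.add_apply,
      ← (ContinuousMap.hasSum_apply ho.hasSum θ).tsum_eq,
      ← (ContinuousMap.hasSum_apply hi.hasSum θ).tsum_eq]
    simp only [ContinuousMap.smul_apply, fourier_eq_zpow, circlePt, Complex.ofReal_one, one_mul,
      smul_eq_mul, ← Nat.cast_succ, zpow_neg, zpow_natCast]
  have hc : ∀ m : ℤ, fourierCoeff (slice (transferOp hτ hA f) 1) m =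
      ∑' k : ℕ, transferCoeffOuter hτ hA f k * (if m = k then 1 else 0) +
      ∑' k : ℕ, transferCoeffInner hA f k * (if m = -((k : ℤ) + 1) then 1 else 0) := by
    intro m
    have h1 := (fourierCoeffCLM m ∘L contToL2).hasSum ho.hasSum
    have h2 := (fourierCoeffCLM m ∘L contToL2).hasSum hi.hasSum
    rw [← fourierCoeffCLM_apply, hs, map_add, map_add]
    refine congrArg₂ _ (h1.tsum_eq.symm.trans ?_) (h2.tsum_eq.symm.trans ?_) <;>
    · refine tsum_congr fun k => ?_
      rw [ContinuousLinearMap.comp_apply, map_smul, map_smul, contToL2_fourier,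
        fourierCoeffCLM_fourierLp, smul_eq_mul]
  constructor
  · rw [hc, tsum_eq_single k fun j hj => by rw [if_neg (by omega), mul_zero]]
    have : ∀ j : ℕ, ¬ (k : ℤ) = -((j : ℤ) + 1) := fun j => by omega
    simp only [this, if_false, mul_zero, tsum_zero, add_zero, if_true, mul_one]
  · rw [hc, add_comm, tsum_eq_single k fun j hj => by rw [if_neg (by omega), mul_zero]]
    have : ∀ j : ℕ, ¬ -((k : ℤ) + 1) = (j : ℤ) := fun j => by omega
    simp only [this, if_false, mul_zero, tsum_zero, add_zero, if_true, mul_one]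

lemma fourierCoeff_bdry_transferOp (hτ : IsAnalyticExpanding τ) (hA : IsSuitableAnnulus τ A)
    (f : HardyAnnulus A) (k : ℕ) :
    fourierCoeff (HardyAnnulus.outerBdry A (transferOp hτ hA f)) k =
        transferCoeffOuter hτ hA f k * (A.R : ℂ) ^ k ∧
      fourierCoeff (HardyAnnulus.innerBdry A (transferOp hτ hA f)) (-((k : ℤ) + 1)) =
        transferCoeffInner hA f k * ((A.r : ℂ) ^ (k + 1))⁻¹ := by
  obtain ⟨c, hc, hcr, hcR⟩ := (transferOp hτ hA f).exists_coeff
  have h1 : ∀ n, fourierCoeff (slice (transferOp hτ hA f) 1) n = c n := fun n => by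
    rw [hc 1 ⟨A.r_lt_one, A.one_lt_R⟩, Complex.ofReal_one, one_zpow, mul_one]
  obtain ⟨h2, h3⟩ := fourierCoeff_slice_transferOp hτ hA f k
  rw [hcR, hcr, ← h1, ← h1, h2, h3, zpow_natCast, zpow_neg, ← Nat.cast_succ, zpow_natCast]
  exact ⟨rfl, rfl⟩

/-! ### The adjoint of the transfer operator -/

lemma rieszPlus_fourierLp_of_neg {ρ σ : ℝ} [Fact (0 < σ)] (h : σ ≤ ρ) {n : ℤ} (hn : n < 0) :
    rieszPlus ρ σ h (fourierLp (T := 2 * π) 2 n) = 0 :=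
  HardyDisk.bdry_injective σ <| by rw [bdry_rieszPlus_fourierLp, if_neg hn.not_ge, map_zero]

lemma rieszMinus_fourierLp_of_nonneg {ρ σ : ℝ} [Fact (0 < ρ)] [Fact (0 < σ)] (h : ρ ≤ σ) {n : ℤ}
    (hn : 0 ≤ n) : rieszMinus ρ σ h (fourierLp (T := 2 * π) 2 n) = 0 :=
  HardyExterior.bdry_injective σ <| by rw [bdry_rieszMinus_fourierLp, if_pos hn, map_zero]

/-- Under the pairing on the inner circle the transfer operator is dual to composition with `τ`. By
continuity it suffices to compare both sides on the monomials `h(z) = z^k`, where each is the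
coefficient of `z^{-k-1}` in the Laurent series of the transfer operator applied to `f`. -/
lemma contourPairing_innerBdry_transferOp (hτ : IsAnalyticExpanding τ)
    (hA : IsSuitableAnnulus τ A) (f : HardyAnnulus A) (h : HardyDisk A.r) :
    contourPairing A.r (HardyAnnulus.innerBdry A (transferOp hτ hA f)) (HardyDisk.bdry A.r h) =
      contourPairing A.r (HardyAnnulus.innerBdry A f) (compInner hτ hA h) := by
  have hr : (A.r : ℂ) ≠ 0 := by exact_mod_cast A.r_pos.ne'
  have key : (pairingCLM A.r (HardyAnnulus.innerBdry A (transferOp hτ hA f))) ∘L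
      (HardyDisk.bdryLI A.r).toContinuousLinearMap ∘L rieszPlus A.r A.r le_rfl =
      (pairingCLM A.r (HardyAnnulus.innerBdry A f)) ∘L compInner hτ hA ∘L
        rieszPlus A.r A.r le_rfl := by
    refine ext_fourierLp fun n => ?_
    simp only [ContinuousLinearMap.comp_apply]
    rcases lt_or_ge n 0 with hn | hn
    · rw [rieszPlus_fourierLp_of_neg _ hn, map_zero, map_zero, map_zero, map_zero]
    · lift n to ℕ using hn
      rw [compInner_rieszPlus_fourierLp, map_smul]
      change contourPairing A.r _ (HardyDisk.bdry A.r _) = _ • transferCoeffInner hA f n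
      rw [bdry_rieszPlus_fourierLp, if_pos (by positivity), ← zpow_add₀ hr, neg_add_cancel,
        zpow_zero, one_smul, contourPairing_fourierLp, ← neg_add',
        (fourierCoeff_bdry_transferOp hτ hA f n).2, smul_eq_mul, pow_succ]
      field_simp
  have := DFunLike.congr_fun key (HardyDisk.bdry A.r h)
  simp only [ContinuousLinearMap.comp_apply, rieszPlus_bdry] at this
  exact this

/-- Under the pairing on the outer circle the transfer operator is dual to composition with `τ`. -/
lemma contourPairing_outerBdry_transferOp (hτ : IsAnalyticExpanding τ)
    (hA : IsSuitableAnnulus τ A) (f : HardyAnnulus A) (h : HardyExterior A.R) :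
    contourPairing A.R (HardyAnnulus.outerBdry A (transferOp hτ hA f))
        (HardyExterior.bdry A.R h) =
      contourPairing A.R (HardyAnnulus.outerBdry A f) (compOuter hτ hA h) := by
  have hR : (A.R : ℂ) ≠ 0 := by exact_mod_cast A.R_pos.ne'
  have key : (pairingCLM A.R (HardyAnnulus.outerBdry A (transferOp hτ hA f))) ∘L
      (HardyExterior.bdryLI A.R).toContinuousLinearMap ∘L rieszMinus A.R A.R le_rfl =
      (pairingCLM A.R (HardyAnnulus.outerBdry A f)) ∘L compOuter hτ hA ∘L
        rieszMinus A.R A.R le_rfl := by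
    refine ext_fourierLp fun n => ?_
    simp only [ContinuousLinearMap.comp_apply]
    rcases le_or_gt 0 n with hn | hn
    · rw [rieszMinus_fourierLp_of_nonneg _ hn, map_zero, map_zero, map_zero, map_zero]
    · obtain ⟨k, rfl⟩ : ∃ k : ℕ, n = -((k : ℤ) + 1) := ⟨(-n - 1).toNat, by omega⟩
      rw [compOuter_rieszMinus_fourierLp, map_smul]
      change contourPairing A.R _ (HardyExterior.bdry A.R _) = _ • transferCoeffOuter hτ hA f k
      rw [bdry_rieszMinus_fourierLp, if_neg hn.not_ge, ← zpow_add₀ hR, neg_add_cancel,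
        zpow_zero, one_smul, contourPairing_fourierLp, neg_neg, add_sub_cancel_right,
        (fourierCoeff_bdry_transferOp hτ hA f k).1, smul_eq_mul]
      ring
  have := DFunLike.congr_fun key (HardyExterior.bdry A.R h)
  simp only [ContinuousLinearMap.comp_apply, rieszMinus_bdry] at this
  exact this

lemma dualityEquiv_blockOperator (hτ : IsAnalyticExpanding τ) (hA : IsSuitableAnnulus τ A)
    (h : DualModel A) (f : HardyAnnulus A) :
    dualityEquiv A h (transferOp hτ hA f) =
      dualityEquiv A (blockOperator A (compInner hτ hA) (compOuter hτ hA) h) f := by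
  rw [dualityEquiv_apply, contourPairing_innerBdry_transferOp,
    contourPairing_outerBdry_transferOp, contourPairing_inner f (compInner hτ hA h.fst),
    contourPairing_outer f (compOuter hτ hA h.snd), add_add_add_comm]
  change _ = pairingCLM A.r (HardyAnnulus.innerBdry A f) (HardyDisk.bdry A.r
      (rieszPlus A.r A.r le_rfl (compInner hτ hA h.fst) +
        rieszPlus A.R A.r A.r_lt_R.le (compOuter hτ hA h.snd))) +
    pairingCLM A.R (HardyAnnulus.outerBdry A f) (HardyExterior.bdry A.R
      (rieszMinus A.r A.R A.r_lt_R.le (compInner hτ hA h.fst) +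
        rieszMinus A.R A.R le_rfl (compOuter hτ hA h.snd)))
  rw [map_add, map_add, map_add, map_add]
  rfl

lemma symm_comp_banachAdjoint_comp (hτ : IsAnalyticExpanding τ) (hA : IsSuitableAnnulus τ A) :
    ((dualityEquiv A).symm : StrongDual ℂ (HardyAnnulus A) →L[ℂ] DualModel A) ∘L
        banachAdjoint (transferOp hτ hA) ∘L
        (dualityEquiv A : DualModel A →L[ℂ] StrongDual ℂ (HardyAnnulus A)) =
      blockOperator A (compInner hτ hA) (compOuter hτ hA) := by
  refine ContinuousLinearMap.ext fun h => ?_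
  refine (ContinuousLinearEquiv.symm_apply_eq _).2 ?_
  exact ContinuousLinearMap.ext fun f => dualityEquiv_blockOperator hτ hA h f

end ExpandingCircle

end

theorem proposition4p5 (τ : ℂ → ℂ) (A : ExpandingCircle.AnnulusRadii)
    (hτ : ExpandingCircle.IsAnalyticExpanding τ) (hA : ExpandingCircle.IsSuitableAnnulus τ A) :
    ∃ (L : ExpandingCircle.HardyAnnulus A →L[ℂ] ExpandingCircle.HardyAnnulus A)
      (J : ExpandingCircle.DualModel A ≃L[ℂ] StrongDual ℂ (ExpandingCircle.HardyAnnulus A))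
      (Cr : ExpandingCircle.HardyDisk A.r →L[ℂ] ExpandingCircle.L2Circle)
      (CR : ExpandingCircle.HardyExterior A.R →L[ℂ] ExpandingCircle.L2Circle),
      ExpandingCircle.IsTransferOperator τ A L ∧
      ExpandingCircle.IsDualityMap A J ∧
      (∀ h, Cr h =ᵐ[AddCircle.haarAddCircle] fun θ => h (τ (ExpandingCircle.circlePt A.r θ))) ∧
      (∀ h, CR h =ᵐ[AddCircle.haarAddCircle] fun θ => h (τ (ExpandingCircle.circlePt A.R θ))) ∧
      (J.symm : StrongDual ℂ (ExpandingCircle.HardyAnnulus A) →L[ℂ] ExpandingCircle.DualModel A) ∘L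
          ExpandingCircle.banachAdjoint L ∘L
          (J : ExpandingCircle.DualModel A →L[ℂ] StrongDual ℂ (ExpandingCircle.HardyAnnulus A)) =
        ExpandingCircle.blockOperator A Cr CR := by
  exact ⟨ExpandingCircle.transferOp hτ hA, ExpandingCircle.dualityEquiv A,
    ExpandingCircle.compInner hτ hA, ExpandingCircle.compOuter hτ hA,
    ExpandingCircle.isTransferOperator_transferOp hτ hA, ExpandingCircle.dualityEquiv_apply,
    ExpandingCircle.compInner_ae_eq hτ hA, ExpandingCircle.compOuter_ae_eq hτ hA,
    ExpandingCircle.symm_comp_banachAdjoint_comp hτ hA⟩
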